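/- **Setting.** Let $\Omega_v=\{-1,1\}$ with $\langle f\rangle=\frac12(f(-1)+f(1))$ (telegraph equation), or $\Omega_v=[-1,1]$ with $\langle f\rangle=\frac12\int_{-1}^1 f(v)\,dv$ (one-group transport equation in slab geometry). Let $\varepsilon>0$, $T>0$, $\Omega_x=[a,b]$ with periodic boundary conditions. Let $\rho(x,t)$, $g(x,v,t)$ with $\langle g\rangle=0$ be a smooth solution on $[0,T]$ of $$\partial_t\rho+\partial_x\langle vg\rangle=0,\qquad \partial_t g+\tfrac1\varepsilon\big(v\partial_xg-\langle v\partial_xg\rangle\big)+\tfrac1{\varepsilon^2}v\partial_x\rho=-\tfrac1{\varepsilon^2}g ;$$ it suffices that $\rho$ and $g(\cdot,v,\cdot)$ are of class $C^{k+2}$ in $(x,t)$. Write $\|\cdot\|$ for the norm of $L^2(\Omega_x)$, $(\cdot,\cdot)$ for its inner product, and $|||\phi|||^2=\langle\|\phi\|^2\rangle$. **Scheme.** Let $k\ge0$, $N\ge1$, $h=(b-a)/N$, $x_{i+1/2}=a+ih$ ($0\le i\le N$), $I_i=[x_{i-1/2},x_{i+1/2}]$ ($1\le i\le N$), and let $U_h^k$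 be the space of functions that are polynomials of degree at most $k$ on each $I_i$. With one-sided limits $u^\pm$ (periodically continued), put $[u]=u^+-u^-$, $\{u\}=\frac12(u^++u^-)$. For $\phi,\psi\in U_h^k$ let $$a_h(g,\phi)=-\sum_i\int_{I_i}\langle vg\rangle\,\partial_x\phi\,dx-\sum_i\widehat{\langle vg\rangle}_{i-\frac12}[\phi]_{i-\frac12},\qquad d_h(\rho,\psi)=\sum_i\int_{I_i}\rho\,\partial_x\psi\,dx+\sum_i\hat\rho_{i-\frac12}[\psi]_{i-\frac12},$$ and $b_{h,v}(g,\psi)=(\mathcal D_h(g;v)-\langle\mathcal D_h(g;\cdot)\rangle,\psi)$, where $\mathcal D_h(g;v)\in U_h^k$ is given by $(\mathcal D_h(g;v),\psi)=-\sum_i\int_{I_i}vg\,\partial_x\psi\,dx-\sum_i\widetilde{(vg)}_{i-\frac12}[\psi]_{i-\frac12}$ with the upwind flux $\widetilde{vg}=vg^-$ if $v>0$ and $\widetilde{vg}=vg^+$ if $v<0$. The fluxes are *alternating*, $(\widehat{\langle vg\rangle},\hat\rho)=(\langle vg\rangle^-,\rho^+)$ or $(\langle vg\rangle^+,\rho^-)$,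 or *central*, $(\widehat{\langle vg\rangle},\hat\rho)=(\{\langle vg\rangle\},\{\rho\})$. The numerical solution $\rho_h^n,\,g_h^n(\cdot,v)\in U_h^k$ is given by the $L^2$ projections $\rho_h^0$, $g_h^0$ of $\rho|_{t=0}$, $g|_{t=0}$ onto $U_h^k$ and, for all $n\ge0$ and $\phi,\psi\in U_h^k$, $$\Big(\tfrac{\rho_h^{n+1}-\rho_h^n}{\Delta t},\phi\Big)+a_h(g_h^n,\phi)=0,\qquad \Big(\tfrac{g_h^{n+1}-g_h^n}{\Delta t},\psi\Big)+\tfrac1\varepsilon b_{h,v}(g_h^n,\psi)-\tfrac v{\varepsilon^2}d_h(\rho_h^{n+1},\psi)=-\tfrac1{\varepsilon^2}(g_h^{n+1},\psi).$$ **Time step bound.** Let $C_{\rm inv},\hat C_{\rm inv}$ be constants such that $|w(y)|^2(d-c)\le C_{\rm inv}\int_c^d w^2\,dx$ for $y\in\{c,d\}$ and $(d-c)^2\int_c^d|w'|^2\,dx\le\hat C_{\rm inv}\int_c^d w^2\,dx$ for all $c<d$ and all polynomials $w$ of degree at most $k$. Put $\|v\|_\infty=\sup_{\Omega_v}|v|$,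 $\alpha_1=(\|v\|_\infty^2+\langle v^2\rangle)\hat C_{\rm inv}$, $\alpha_2=2(\|v\|_\infty+\langle|v|\rangle)C_{\rm inv}$, $\alpha_3=2\|v\|_\infty C_{\rm inv}$, and $$\Delta t_{\rm stab}=\frac{h}{\alpha_1+\alpha_2\alpha_3}\Big(h+\min\big(\varepsilon,\tfrac{\alpha_2h}{\alpha_1}\big)\alpha_3\Big)\ (k\ge1),\qquad \Delta t_{\rm stab}=\frac{2h}{\alpha_2\alpha_3}(h+\alpha_3\varepsilon)\ (k=0).$$ **Theorem (error estimate).** For each of the two models and all $k$, $T$, $M$ there is a constant $C_*>0$, depending on nothing else, such that the following holds. Suppose that $\|\partial_{tt}\rho\|$, $\|\partial_{xt}\rho\|$, $\|\rho\|_{H^{k+1}(\Omega_x)}$, $\|\partial_t\rho\|_{H^{k+1}(\Omega_x)}$, $|||\partial_{tt}g|||$, $\langle\|g\|^2_{H^{k+1}(\Omega_x)}\rangle$ and $\langle\|\partial_tg\|^2_{H^{k+1}(\Omega_x)}\rangle$ are at most $M$ for all $t\in[0,T]$. Let $\sigma\in(0,1)$, $0<\Delta t\le\sigma\Delta t_{\rm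 stab}$ and $\Delta t<\frac12$. Write $\rho^n,g^n$ for the exact solution at $t=n\Delta t$. Then for all $n\ge1$ with $n\Delta t\le T$: 1. with either alternating flux, $$\|\rho^n-\rho_h^n\|^2+\varepsilon^2|||g^{n-1}-g_h^{n-1}|||^2\le C_*\Big((1+\varepsilon^2)h^{2k+2}+\Delta t^2+\tfrac1{1-\sigma}\big((1+\varepsilon^4)\Delta t^2+h^{2k+2}+\varepsilon h^{2k+1}\big)\Big);$$ 2. with the central flux, $$\|\rho^n-\rho_h^n\|^2+\varepsilon^2|||g^{n-1}-g_h^{n-1}|||^2\le C_*\Big(\varepsilon^2h^{2k+2}+h^{2k}+\Delta t^2+\tfrac1{1-\sigma}\big((1+\varepsilon^4)\Delta t^2+h^{2k}+\varepsilon h^{2k+1}\big)\Big).$$ -/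

import Mathlib

open MeasureTheory
open scoped ENNReal NNReal Polynomial

namespace DGIMEX

/-! ### Velocity models -/

/-- The two kinetic models: the telegraph equation and the one-group transport equation in slab
geometry. -/
inductive Model
  | telegraph
  | slab

/-- The velocity space `Ω_v`. -/
def Model.velocities : Model → Set ℝ
  | .telegraph => {-1, 1}
  | .slab => Set.Icc (-1) 1

/-- The measure `μ` of the velocity space, as a measure on `ℝ` carried by `Ω_v`:
half the counting measure of `{-1, 1}`, respectively `dv / 2` on `[-1, 1]`.
The average `⟨f⟩` is `∫ v, f v ∂μ`. -/
noncomputable def Model.measure : Model → Measure ℝ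
  | .telegraph => (2⁻¹ : ℝ≥0∞) • (Measure.dirac (-1) + Measure.dirac 1)
  | .slab => (2⁻¹ : ℝ≥0∞) • volume.restrict (Set.Icc (-1) 1)

/-- `‖v‖_∞`, the supremum of `|v|` over `Ω_v`. -/
noncomputable def Model.vSup (m : Model) : ℝ := sSup ((fun v : ℝ => |v|) '' m.velocities)

/-! ### Norms on `Ω_x = [a, b]` -/

/-- The norm of `L²(a, b)`. -/
noncomputable def l2Norm (a b : ℝ) (w : ℝ → ℝ) : ℝ≥0∞ :=
  eLpNorm w 2 (volume.restrict (Set.Icc a b))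

/-- The squared norm of `H^r(a, b)`, for functions that are `r` times differentiable in the
classical sense (the only ones to which it is applied). -/
noncomputable def sobolevNormSq (a b : ℝ) (r : ℕ) (w : ℝ → ℝ) : ℝ≥0∞ :=
  ∑ j ∈ Finset.range (r + 1), l2Norm a b (iteratedDeriv j w) ^ 2

/-- The norm of `H^r(a, b)`. -/
noncomputable def sobolevNorm (a b : ℝ) (r : ℕ) (w : ℝ → ℝ) : ℝ≥0∞ :=
  sobolevNormSq a b r w ^ (1 / 2 : ℝ)

/-- `|||w|||² = ⟨‖w(·, v)‖²⟩` for `w = w(x, v)`. -/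
noncomputable def tripleNormSq (m : Model) (a b : ℝ) (w : ℝ → ℝ → ℝ) : ℝ≥0∞ :=
  ∫⁻ v, l2Norm a b (fun x => w x v) ^ 2 ∂m.measure

/-- `|||w|||`. -/
noncomputable def tripleNorm (m : Model) (a b : ℝ) (w : ℝ → ℝ → ℝ) : ℝ≥0∞ :=
  tripleNormSq m a b w ^ (1 / 2 : ℝ)

/-! ### Exact solutions of the micro-macro system -/

/-- The time derivative of `w = w(x, t)` on the time interval `[0, T]`, one-sided at `0`, `T`. -/
noncomputable def dt (T : ℝ) (w : ℝ → ℝ → ℝ) (x t : ℝ) : ℝ :=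
  derivWithin (fun s => w x s) (Set.Icc 0 T) t

/-- The space derivative of `w = w(x, t)`. -/
noncomputable def dx (w : ℝ → ℝ → ℝ) (x t : ℝ) : ℝ := deriv (fun y => w y t) x

/-- `ρ = ρ(x, t)`, `g = g(x, v, t)` is a smooth solution on `[0, T]` of the micro-macro system
`∂ₜρ + ∂ₓ⟨vg⟩ = 0`, `∂ₜg + ε⁻¹ (I - Π)(v ∂ₓg) + ε⁻² v ∂ₓρ = - ε⁻² g`, with `⟨g⟩ = 0` and
periodic boundary conditions on `[a, b]`.  Smooth means of class `C^r` in `(x, t)` up to the end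
points of the time interval; in `v` the function `g` is only measurable and square integrable. -/
structure IsSmoothSolution (m : Model) (ε a b T : ℝ) (r : ℕ)
    (ρ : ℝ → ℝ → ℝ) (g : ℝ → ℝ → ℝ → ℝ) : Prop where
  measurable_g : Measurable (fun p : ℝ × ℝ × ℝ => g p.1 p.2.1 p.2.2)
  contDiff_rho : ContDiffOn ℝ r (fun p : ℝ × ℝ => ρ p.1 p.2) (Set.univ ×ˢ Set.Icc 0 T)
  contDiff_g : ∀ᵐ v ∂m.measure,
    ContDiffOn ℝ r (fun p : ℝ × ℝ => g p.1 v p.2) (Set.univ ×ˢ Set.Icc 0 T)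
  periodic_rho : ∀ t ∈ Set.Icc 0 T, ∀ x, ρ (x + (b - a)) t = ρ x t
  periodic_g : ∀ᵐ v ∂m.measure, ∀ t ∈ Set.Icc 0 T, ∀ x, g (x + (b - a)) v t = g x v t
  memLp_g : ∀ t ∈ Set.Icc 0 T, ∀ x, MemLp (fun v => g x v t) 2 m.measure
  memLp_dx_g : ∀ t ∈ Set.Icc 0 T, ∀ x,
    MemLp (fun v => dx (fun y s => g y v s) x t) 2 m.measure
  avg_g : ∀ t ∈ Set.Icc 0 T, ∀ x, ∫ v, g x v t ∂m.measure = 0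
  macro_eq : ∀ t ∈ Set.Icc 0 T, ∀ x,
    HasDerivAt (fun y => ∫ v, v * g y v t ∂m.measure) (-(dt T ρ x t)) x
  micro_eq : ∀ᵐ v ∂m.measure, ∀ t ∈ Set.Icc 0 T, ∀ x,
    dt T (fun y s => g y v s) x t
      + 1 / ε * (v * dx (fun y s => g y v s) x t
          - ∫ w, w * dx (fun y s => g y w s) x t ∂m.measure)
      + 1 / ε ^ 2 * (v * dx ρ x t)
      = -(1 / ε ^ 2) * g x v t

/-- `M` is an upper bound over `t ∈ [0, T]` of
`‖∂ₜₜρ‖`, `‖∂ₓₜρ‖`, `‖ρ‖_{H^{k+1}}`, `‖∂ₜρ‖_{H^{k+1}}`,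
`|||∂ₜₜg|||`, `⟨‖g‖²_{H^{k+1}}⟩`, `⟨‖∂ₜg‖²_{H^{k+1}}⟩`. -/
structure SolutionBound (m : Model) (a b T : ℝ) (k : ℕ)
    (ρ : ℝ → ℝ → ℝ) (g : ℝ → ℝ → ℝ → ℝ) (M : ℝ≥0) : Prop where
  dtt_rho : ∀ t ∈ Set.Icc 0 T, l2Norm a b (fun x => dt T (dt T ρ) x t) ≤ M
  dxt_rho : ∀ t ∈ Set.Icc 0 T, l2Norm a b (fun x => dx (dt T ρ) x t) ≤ M
  sobolev_rho : ∀ t ∈ Set.Icc 0 T, sobolevNorm a b (k + 1) (fun x => ρ x t) ≤ M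
  sobolev_dt_rho : ∀ t ∈ Set.Icc 0 T, sobolevNorm a b (k + 1) (fun x => dt T ρ x t) ≤ M
  dtt_g : ∀ t ∈ Set.Icc 0 T,
    tripleNorm m a b (fun x v => dt T (dt T (fun y s => g y v s)) x t) ≤ M
  sobolev_g : ∀ t ∈ Set.Icc 0 T,
    ∫⁻ v, sobolevNormSq a b (k + 1) (fun x => g x v t) ∂m.measure ≤ M
  sobolev_dt_g : ∀ t ∈ Set.Icc 0 T,
    ∫⁻ v, sobolevNormSq a b (k + 1) (fun x => dt T (fun y s => g y v s) x t) ∂m.measure ≤ M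

/-! ### The discontinuous Galerkin space on the uniform mesh with `N` elements -/

/-- The mesh size `h = (b - a) / N`. -/
noncomputable def meshSize (a b : ℝ) (N : ℕ) : ℝ := (b - a) / N

/-- The mesh points `a + j h`, `j = 0, …, N`.  The element with index `i : Fin N` is
`[node i, node (i + 1)]`. -/
noncomputable def node (a b : ℝ) (N j : ℕ) : ℝ := a + j * meshSize a b N

/-- A piecewise polynomial function, given by one polynomial (in the variable `x`) for each
element. -/
abbrev PiecewisePoly (N : ℕ) := Fin N → ℝ[X]

/-- Membership in the space `U_h^k`. -/
def InDG {N : ℕ} (k : ℕ) (u : PiecewisePoly N) : Prop := ∀ i, (u i).natDegree ≤ k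

/-- The piecewise polynomial as a function on `Ω_x` (the values at the mesh points are irrelevant
for the `L²` norm, which is the only use). -/
noncomputable def toFun (a b : ℝ) {N : ℕ} (u : PiecewisePoly N) (x : ℝ) : ℝ :=
  ∑ i : Fin N, (Set.Ico (node a b N i) (node a b N (i + 1))).indicator
    (fun y => (u i).eval y) x

/-- The `L²(Ω_x)` inner product of two piecewise polynomials. -/
noncomputable def ip (a b : ℝ) {N : ℕ} (u w : PiecewisePoly N) : ℝ :=
  ∑ i : Fin N, ∫ x in (node a b N i)..(node a b N (i + 1)), (u i).eval x * (w i).eval x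

/-- `∑ᵢ ∫_{Iᵢ} u ∂ₓw dx`. -/
noncomputable def ipDeriv (a b : ℝ) {N : ℕ} (u w : PiecewisePoly N) : ℝ :=
  ∑ i : Fin N, ∫ x in (node a b N i)..(node a b N (i + 1)),
    (u i).eval x * (Polynomial.derivative (w i)).eval x

/-- The trace `u⁺` at the left end point of element `i`. -/
noncomputable def tracePlus (a b : ℝ) {N : ℕ} (u : PiecewisePoly N) (i : Fin N) : ℝ :=
  (u i).eval (node a b N i)

/-- The trace `u⁻` at the left end point of element `i`: the value of the preceding element at its
right end point.  By periodicity the element before the first one is the last one (`i - 1` is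
cyclic in `Fin N`). -/
noncomputable def traceMinus (a b : ℝ) {N : ℕ} [NeZero N] (u : PiecewisePoly N) (i : Fin N) : ℝ :=
  (u (i - 1)).eval (node a b N ((i - 1 : Fin N) + 1 : ℕ))

/-- The jump `[u] = u⁺ - u⁻` at the left end point of element `i`. -/
noncomputable def jump (a b : ℝ) {N : ℕ} [NeZero N] (u : PiecewisePoly N) (i : Fin N) : ℝ :=
  tracePlus a b u i - traceMinus a b u i

/-- `u = π_h w`, the `L²` projection of `w` onto `U_h^k`. -/
def IsL2Projection (a b : ℝ) {N : ℕ} (k : ℕ) (w : ℝ → ℝ) (u : PiecewisePoly N) : Prop :=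
  InDG k u ∧ ∀ i : Fin N, ∀ q : ℝ[X], q.natDegree ≤ k →
    ∫ x in (node a b N i)..(node a b N (i + 1)), ((u i).eval x - w x) * q.eval x = 0

/-! ### Fluxes, bilinear forms and the scheme -/

/-- The choices of the fluxes for `⟨vg⟩` and `ρ`: two alternating ones and the central one. -/
inductive Flux
  | leftRight
  | rightLeft
  | central

/-- The alternating fluxes. -/
def Flux.IsAlternating (fl : Flux) : Prop := fl = .leftRight ∨ fl = .rightLeft

/-- The flux for `⟨vg⟩` in terms of the traces `⟨vg⟩⁻`, `⟨vg⟩⁺`. -/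
noncomputable def Flux.hatVG : Flux → ℝ → ℝ → ℝ
  | .leftRight, um, _ => um
  | .rightLeft, _, up => up
  | .central, um, up => (um + up) / 2

/-- The flux for `ρ` in terms of the traces `ρ⁻`, `ρ⁺`. -/
noncomputable def Flux.hatRho : Flux → ℝ → ℝ → ℝ
  | .leftRight, _, up => up
  | .rightLeft, um, _ => um
  | .central, um, up => (um + up) / 2

/-- The upwind flux for `vg` in terms of the traces `g⁻`, `g⁺` (it vanishes for `v = 0`). -/
noncomputable def upwind (v um up : ℝ) : ℝ := if 0 < v then v * um else v * up

/-- `a_h(g, φ) = - ∑ᵢ ∫_{Iᵢ} ⟨vg⟩ ∂ₓφ dx - ∑ᵢ ⟨vg⟩^ [φ]`, for `g = g(v)` with values in the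
piecewise polynomials. -/
noncomputable def aForm (m : Model) (fl : Flux) (a b : ℝ) {N : ℕ} [NeZero N]
    (g : ℝ → PiecewisePoly N) (φ : PiecewisePoly N) : ℝ :=
  -(∑ i : Fin N, ∫ x in (node a b N i)..(node a b N (i + 1)),
      (∫ v, v * (g v i).eval x ∂m.measure) * (Polynomial.derivative (φ i)).eval x)
    - ∑ i : Fin N,
        fl.hatVG (∫ v, v * traceMinus a b (g v) i ∂m.measure)
          (∫ v, v * tracePlus a b (g v) i ∂m.measure) * jump a b φ i

/-- `(𝒟_h(g; v), ψ) = - ∑ᵢ ∫_{Iᵢ} v g ∂ₓψ dx - ∑ᵢ (vg)~ [ψ]`, with the upwind flux `(vg)~`. -/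
noncomputable def upwindForm (a b : ℝ) {N : ℕ} [NeZero N] (v : ℝ) (g ψ : PiecewisePoly N) : ℝ :=
  -(v * ipDeriv a b g ψ)
    - ∑ i : Fin N, upwind v (traceMinus a b g i) (tracePlus a b g i) * jump a b ψ i

/-- `b_{h,v}(g, ψ) = ((I - Π) 𝒟_h(g; v), ψ) = (𝒟_h(g; v), ψ) - ⟨(𝒟_h(g; ·), ψ)⟩`. -/
noncomputable def bForm (m : Model) (a b : ℝ) {N : ℕ} [NeZero N] (v : ℝ)
    (g : ℝ → PiecewisePoly N) (ψ : PiecewisePoly N) : ℝ :=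
  upwindForm a b v (g v) ψ - ∫ w, upwindForm a b w (g w) ψ ∂m.measure

/-- `d_h(ρ, ψ) = ∑ᵢ ∫_{Iᵢ} ρ ∂ₓψ dx + ∑ᵢ ρ^ [ψ]`. -/
noncomputable def dForm (fl : Flux) (a b : ℝ) {N : ℕ} [NeZero N] (ρ ψ : PiecewisePoly N) : ℝ :=
  ipDeriv a b ρ ψ
    + ∑ i : Fin N, fl.hatRho (traceMinus a b ρ i) (tracePlus a b ρ i) * jump a b ψ i

/-- The sequences `ρ_h^n ∈ U_h^k` and `g_h^n(·, v) ∈ U_h^k` (square integrable in `v`) are computed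
by the first order IMEX discontinuous Galerkin scheme with time step `τ`, started from the `L²`
projections of the initial data `ρ₀(x)`, `g₀(x, v)`. -/
structure IsDGIMEX1 (m : Model) (fl : Flux) (ε a b τ : ℝ) (k : ℕ) {N : ℕ} [NeZero N]
    (ρ₀ : ℝ → ℝ) (g₀ : ℝ → ℝ → ℝ)
    (ρh : ℕ → PiecewisePoly N) (gh : ℕ → ℝ → PiecewisePoly N) : Prop where
  inDG_rho : ∀ n, InDG k (ρh n)
  inDG_g : ∀ n, ∀ᵐ v ∂m.measure, InDG k (gh n v)
  memLp_g : ∀ n i j, MemLp (fun v => (gh n v i).coeff j) 2 m.measure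
  init_rho : IsL2Projection a b k ρ₀ (ρh 0)
  init_g : ∀ᵐ v ∂m.measure, IsL2Projection a b k (fun x => g₀ x v) (gh 0 v)
  step_rho : ∀ n, ∀ φ : PiecewisePoly N, InDG k φ →
    ip a b ((1 / τ) • (ρh (n + 1) - ρh n)) φ + aForm m fl a b (gh n) φ = 0
  step_g : ∀ n, ∀ᵐ v ∂m.measure, ∀ ψ : PiecewisePoly N, InDG k ψ →
    ip a b ((1 / τ) • (gh (n + 1) v - gh n v)) ψ
      + 1 / ε * bForm m a b v (gh n) ψ
      - v / ε ^ 2 * dForm fl a b (ρh (n + 1)) ψ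
      = -(1 / ε ^ 2) * ip a b (gh (n + 1) v) ψ

/-! ### The time step restriction -/

/-- `C` and `C'` (written `C_inv` and `Ĉ_inv`) are constants of the two inverse inequalities
`|w(y)|² (d - c) ≤ C ∫_c^d w²`, `y ∈ {c, d}`, and `(d - c)² ∫_c^d |w'|² ≤ C' ∫_c^d w²`
for polynomials of degree at most `k`. -/
structure AreInverseConstants (k : ℕ) (C C' : ℝ) : Prop where
  trace : ∀ c d : ℝ, c < d → ∀ w : ℝ[X], w.natDegree ≤ k → ∀ y, (y = c ∨ y = d) →
    |w.eval y| ^ 2 * (d - c) ≤ C * ∫ x in c..d, w.eval x ^ 2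
  deriv : ∀ c d : ℝ, c < d → ∀ w : ℝ[X], w.natDegree ≤ k →
    (d - c) ^ 2 * ∫ x in c..d, |(Polynomial.derivative w).eval x| ^ 2
      ≤ C' * ∫ x in c..d, w.eval x ^ 2

/-- `α₁ = (‖v‖_∞² + ⟨v²⟩) Ĉ_inv`. -/
noncomputable def alpha1 (m : Model) (C' : ℝ) : ℝ :=
  (m.vSup ^ 2 + ∫ v, v ^ 2 ∂m.measure) * C'

/-- `α₂ = 2 (‖v‖_∞ + ⟨|v|⟩) C_inv`. -/
noncomputable def alpha2 (m : Model) (C : ℝ) : ℝ :=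
  2 * (m.vSup + ∫ v, |v| ∂m.measure) * C

/-- `α₃ = 2 ‖v‖_∞ C_inv`. -/
noncomputable def alpha3 (m : Model) (C : ℝ) : ℝ := 2 * m.vSup * C

/-- The time step bound `Δt_stab` for the inverse constants `C = C_inv`, `C' = Ĉ_inv`. -/
noncomputable def dtStab (m : Model) (k : ℕ) (C C' ε h : ℝ) : ℝ :=
  if k = 0 then 2 * h / (alpha2 m C * alpha3 m C) * (h + alpha3 m C * ε)
  else h / (alpha1 m C' + alpha2 m C * alpha3 m C)
    * (h + min ε (alpha2 m C * h / alpha1 m C') * alpha3 m C)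

/-- The squared error `‖ρ^n - ρ_h^n‖² + ε² |||g^{n-1} - g_h^{n-1}|||²` at `t^n = n τ`, `n ≥ 1`. -/
noncomputable def errorSq (m : Model) (ε a b τ : ℝ) {N : ℕ}
    (ρ : ℝ → ℝ → ℝ) (g : ℝ → ℝ → ℝ → ℝ)
    (ρh : ℕ → PiecewisePoly N) (gh : ℕ → ℝ → PiecewisePoly N) (n : ℕ) : ℝ≥0∞ :=
  l2Norm a b (fun x => ρ x (n * τ) - toFun a b (ρh n) x) ^ 2
    + ENNReal.ofReal (ε ^ 2) *
      tripleNormSq m a b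
        (fun x v => g x v ((n - 1 : ℕ) * τ) - toFun a b (gh (n - 1) v) x)

end DGIMEX

open DGIMEX

namespace DGIMEX

/-! ### The velocity space -/

/-! The proof is an energy argument for the errors `ξ^n = ρ_h^n - P ρ^n` and `ζ^n = g_h^n - G g^n`,
where `P` and `G` are projections adapted to the fluxes of `ρ` and of `⟨vg⟩`: Gauss–Radau for the
alternating fluxes, `L²` for the central one. The energy is `‖ξ^{n+1}‖² + ε² |||ζ^n|||²`; the index
shift reflects that `g` is advanced with the new `ρ`.

In one step (`energy_step`) the equation for `ρ` is tested with `ξ` and the equation for `g` with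
the new `ζ`. By discrete integration by parts (`dForm_swap`) the two coupling terms cancel. Two
damping terms remain: `|||ζ|||²` from the implicit relaxation and `(ε/2) ⟨|v| ∑ [ζ]²⟩` from the
upwind flux. Against them stand two terms of the wrong sign: `‖ξ^{n+1} - ξ^n‖²`, bounded by testing
with the increment itself, and the error of the explicit transport term. Inverse inequalities bound
both by the damping terms, and the time step restriction says precisely that they use up at most the
fraction `σ` of them (`stability_condition`). The remaining fraction absorbs residuals by Young's
inequality, whence the factor `1 / (1 - σ)`. A discrete Gronwall inequality sums the steps.

The residuals come from consistency. For an adapted projection all volume terms of `d_h` agree with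
those of the smooth function, and only trace errors remain (`dForm_add_pint`). They vanish for
alternating fluxes, and give `h^k` for central ones. In the upwind form the trace errors of order
`h^(k + 1/2)` are paired with the jumps, so that the upwind dissipation pays for them and `ε
h^(2k+1)` results. The average `⟨v ∂ₓg⟩` and the part `Π` of the scheme never enter: they do not
depend on `v`, and the test function has mean zero in `v` (`IsDGIMEX1.avg_eq_zero`,
`SolutionOn.avg_projection_eq_zero`). Time residuals are integrals of time derivatives, bounded by
Cauchy–Schwarz and Tonelli.

The Gronwall argument starts from `ξ^1`, and the scheme starts from `L²` projections rather than
adapted ones, so the first step is estimated by hand (`SolutionOn.first_step_le`).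

Everything about projections on one element is derived from the two inverse inequalities alone:
stability in the maximum norm (`IsProj.abs_eval_le`), existence by injectivity in finite dimension
(`exists_projection`), and approximation by repeated integration (`exists_polynomial_approx`). In
`v` the solution is merely measurable and square integrable; families of polynomials are handled
through their coefficients, and almost everywhere conditions are collected on one set `S` of full
measure. -/

instance Model.isProbabilityMeasure (m : Model) : IsProbabilityMeasure m.measure := by
  constructor
  cases m
  · simp only [Model.measure, Measure.smul_apply, Measure.add_apply, measure_univ, smul_eq_mul]
    rw [one_add_one_eq_two]
    exact ENNReal.inv_mul_cancel two_ne_zero ENNReal.ofNat_ne_top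
  · simp only [Model.measure, Measure.smul_apply, Measure.restrict_apply_univ, Real.volume_Icc,
      smul_eq_mul]
    norm_num
    exact ENNReal.inv_mul_cancel two_ne_zero ENNReal.ofNat_ne_top

lemma Model.ae_abs_le_one (m : Model) : ∀ᵐ v ∂m.measure, |v| ≤ 1 := by
  cases m
  · refine Measure.ae_smul_measure ?_ _
    rw [ae_add_measure_iff]
    have hs : MeasurableSet {v : ℝ | |v| ≤ 1} := measurableSet_le measurable_id.abs measurable_const
    constructor <;> rw [ae_dirac_iff hs] <;> norm_num
  · refine Measure.ae_smul_measure ?_ _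
    filter_upwards [ae_restrict_mem measurableSet_Icc] with v hv
    exact abs_le.2 hv

lemma Model.vSup_eq (m : Model) : m.vSup = 1 := by
  have h : IsGreatest ((fun v : ℝ => |v|) '' m.velocities) 1 := by
    cases m
    · refine ⟨⟨1, by simp [Model.velocities], by simp⟩, ?_⟩
      rintro _ ⟨v, hv, rfl⟩
      simp only [Model.velocities, Set.mem_insert_iff, Set.mem_singleton_iff] at hv
      rcases hv with rfl | rfl <;> norm_num
    · refine ⟨⟨1, by simp [Model.velocities], by simp⟩, ?_⟩
      rintro _ ⟨v, hv, rfl⟩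
      exact abs_le.2 hv
  exact h.csSup_eq

lemma memLp_of_abs_le_one {m : Model} {p : ℝ≥0∞} {f : ℝ → ℝ} (hf : Measurable f)
    (h : ∀ v, |v| ≤ 1 → |f v| ≤ 1) : MemLp f p m.measure :=
  MemLp.of_bound hf.aestronglyMeasurable 1 (m.ae_abs_le_one.mono fun v hv => h v hv)

/-- Both measures are symmetric. This removes the term with `d_h` when the scheme for `g` is
averaged in `v`. -/
lemma Model.integral_id (m : Model) : ∫ v, v ∂m.measure = 0 := by
  cases m
  · simp only [Model.measure, integral_smul_measure]
    rw [integral_add_measure (integrable_dirac (by simp)) (integrable_dirac (by simp))]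
    simp
  · simp only [Model.measure, integral_smul_measure]
    rw [integral_Icc_eq_integral_Ioc, ← intervalIntegral.integral_of_le (by norm_num)]
    simp

lemma Model.integral_sq_nonneg (m : Model) : 0 ≤ ∫ v, v ^ 2 ∂m.measure :=
  integral_nonneg fun v => sq_nonneg v

lemma Model.integral_abs_nonneg (m : Model) : 0 ≤ ∫ v, |v| ∂m.measure :=
  integral_nonneg fun v => abs_nonneg v

lemma Model.integral_le_one (m : Model) {f : ℝ → ℝ} (hf : Measurable f)
    (h : ∀ v, |v| ≤ 1 → |f v| ≤ 1) : ∫ v, f v ∂m.measure ≤ 1 := by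
  have h1 : Integrable f m.measure := (memLp_of_abs_le_one (p := 1) hf h).integrable le_rfl
  calc ∫ v, f v ∂m.measure ≤ ∫ v, (1 : ℝ) ∂m.measure :=
        integral_mono_ae h1 (integrable_const _)
          (m.ae_abs_le_one.mono fun v hv => (abs_le.1 (h v hv)).2)
    _ = 1 := by simp

lemma Model.integral_sq_le_one (m : Model) : ∫ v, v ^ 2 ∂m.measure ≤ 1 :=
  m.integral_le_one (by fun_prop) fun v hv => by
    rw [abs_pow]; exact pow_le_one₀ (abs_nonneg v) hv

/-- The Cauchy–Schwarz inequality for real square integrable functions. -/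
lemma sq_integral_mul_le {α : Type*} [MeasurableSpace α] {μ : Measure α} {f g : α → ℝ}
    (hf : MemLp f 2 μ) (hg : MemLp g 2 μ) :
    (∫ x, f x * g x ∂μ) ^ 2 ≤ (∫ x, f x ^ 2 ∂μ) * ∫ x, g x ^ 2 ∂μ := by
  have hff := hf.integrable_sq
  have hgg := hg.integrable_sq
  have hfg : Integrable (fun x => f x * g x) μ := hf.integrable_mul hg
  have key : ∀ t : ℝ, 0 ≤ (∫ x, f x ^ 2 ∂μ) * (t * t) + (2 * ∫ x, f x * g x ∂μ) * t
      + ∫ x, g x ^ 2 ∂μ := by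
    intro t
    have h0 : 0 ≤ ∫ x, (t * f x + g x) ^ 2 ∂μ := integral_nonneg fun x => sq_nonneg _
    have h1 : ∫ x, (t * f x + g x) ^ 2 ∂μ
        = ∫ x, ((t * t) * f x ^ 2 + (2 * t) * (f x * g x)) + g x ^ 2 ∂μ := by
      congr 1; ext x; ring
    have e : Integrable (fun x => (t * t) * f x ^ 2 + (2 * t) * (f x * g x)) μ :=
      (hff.const_mul _).add (hfg.const_mul _)
    rw [h1, integral_add e hgg,
      integral_add (hff.const_mul _) (hfg.const_mul _), integral_const_mul,
      integral_const_mul] at h0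
    linarith
  have := discrim_le_zero key
  rw [discrim] at this
  nlinarith

/-! ### Families of piecewise polynomials that are square integrable in `v` -/

/-- `G = G(v)` takes values in `U_h^k` and is square integrable in `v`. -/
structure L2DG (m : Model) {N : ℕ} (k : ℕ) (G : ℝ → PiecewisePoly N) : Prop where
  inDG : ∀ᵐ v ∂m.measure, InDG k (G v)
  memLp : ∀ i j, MemLp (fun v => (G v i).coeff j) 2 m.measure

section
variable {N : ℕ} {k : ℕ}

lemma InDG.add {u w : PiecewisePoly N} (hu : InDG k u) (hw : InDG k w) : InDG k (u + w) :=
  fun i => Polynomial.natDegree_add_le_of_degree_le (hu i) (hw i)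

lemma InDG.sub {u w : PiecewisePoly N} (hu : InDG k u) (hw : InDG k w) : InDG k (u - w) :=
  fun i => (Polynomial.natDegree_sub_le _ _).trans (max_le (hu i) (hw i))

lemma InDG.zero : InDG k (0 : PiecewisePoly N) := fun i => by simp

lemma InDG.smul {u : PiecewisePoly N} (hu : InDG k u) (c : ℝ) : InDG k (c • u) :=
  fun i => (Polynomial.natDegree_smul_le c (u i)).trans (hu i)

/-- The basis functions `x^j` on element `i`. -/
noncomputable def basisFun (i : Fin N) (j : ℕ) : PiecewisePoly N := Pi.single i (Polynomial.X ^ j)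

lemma InDG.eq_sum {u : PiecewisePoly N} (hu : InDG k u) :
    u = ∑ i, ∑ j ∈ Finset.range (k + 1), (u i).coeff j • basisFun i j := by
  ext1 l
  have h := (u l).as_sum_range' (k + 1) (Nat.lt_succ_of_le (hu l))
  rw [Finset.sum_apply, Finset.sum_eq_single l]
  · conv_lhs => rw [h]
    rw [Finset.sum_apply]
    refine Finset.sum_congr rfl fun j _ => ?_
    simp [basisFun, ← Polynomial.C_mul_X_pow_eq_monomial, Polynomial.smul_eq_C_mul]
  · intro i _ hi
    rw [Finset.sum_apply]
    exact Finset.sum_eq_zero fun j _ => by simp [basisFun, hi.symm]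
  · simp

lemma InDG.map_eq_sum {u : PiecewisePoly N} (hu : InDG k u) (L : PiecewisePoly N →ₗ[ℝ] ℝ) :
    L u = ∑ i, ∑ j ∈ Finset.range (k + 1), (u i).coeff j * L (basisFun i j) := by
  conv_lhs => rw [hu.eq_sum]
  simp [map_sum]

variable {m : Model} {G H : ℝ → PiecewisePoly N}

lemma L2DG.sub (hG : L2DG m k G) (hH : L2DG m k H) : L2DG m k (fun v => G v - H v) where
  inDG := by filter_upwards [hG.inDG, hH.inDG] with v h1 h2 using h1.sub h2
  memLp i j := by
    simp only [Pi.sub_apply, Polynomial.coeff_sub]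
    exact (hG.memLp i j).sub (hH.memLp i j)

/-- A linear functional is a fixed finite combination of the coefficients, so no topology on the
space of polynomials is needed to speak of measurability in `v`. -/
lemma L2DG.memLp_map (hG : L2DG m k G) (L : PiecewisePoly N →ₗ[ℝ] ℝ) :
    MemLp (fun v => L (G v)) 2 m.measure := by
  have h : MemLp (fun v => ∑ i, ∑ j ∈ Finset.range (k + 1), (G v i).coeff j * L (basisFun i j)) 2
      m.measure :=
    memLp_finsetSum _ fun i _ => memLp_finsetSum _ fun j _ => by
      simpa [mul_comm] using (hG.memLp i j).const_mul (L (basisFun i j))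
  refine h.ae_eq ?_
  filter_upwards [hG.inDG] with v hv using (hv.map_eq_sum L).symm

/-- `⟨f G⟩`, the average in `v` of `f(v) G(v)`. -/
noncomputable def avg (m : Model) (k : ℕ) (f : ℝ → ℝ) (G : ℝ → PiecewisePoly N) :
    PiecewisePoly N :=
  ∑ i, ∑ j ∈ Finset.range (k + 1), (∫ v, f v * (G v i).coeff j ∂m.measure) • basisFun i j

lemma basisFun_inDG (i : Fin N) {j : ℕ} (hj : j ≤ k) : InDG k (basisFun i j) := by
  intro l
  by_cases h : l = i
  · subst h; simpa [basisFun] using hj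
  · simp [basisFun, h]

lemma InDG.sum {ι : Type*} (s : Finset ι) {u : ι → PiecewisePoly N} (h : ∀ i ∈ s, InDG k (u i)) :
    InDG k (∑ i ∈ s, u i) :=
  Finset.sum_induction _ (InDG k) (fun _ _ => InDG.add) InDG.zero h

lemma avg_inDG (m : Model) (k : ℕ) (f : ℝ → ℝ) (G : ℝ → PiecewisePoly N) :
    InDG k (avg m k f G) :=
  InDG.sum _ fun i _ => InDG.sum _ fun j hj =>
    (basisFun_inDG i (Nat.lt_succ_iff.1 (Finset.mem_range.1 hj))).smul _

/-- Expansion in the monomial basis replaces a vector valued integral by finitely many scalar ones.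
This is the tool that commutes `⟨·⟩` with traces, inner products and `d_h`. -/
lemma L2DG.integral_map (hG : L2DG m k G) {f : ℝ → ℝ} (hf : MemLp f 2 m.measure)
    (L : PiecewisePoly N →ₗ[ℝ] ℝ) :
    ∫ v, f v * L (G v) ∂m.measure = L (avg m k f G) := by
  have h : ∫ v, f v * L (G v) ∂m.measure
      = ∫ v, ∑ i, ∑ j ∈ Finset.range (k + 1), (f v * (G v i).coeff j) * L (basisFun i j)
        ∂m.measure := by
    refine integral_congr_ae ?_
    filter_upwards [hG.inDG] with v hv
    simp only [hv.map_eq_sum L, Finset.mul_sum, mul_assoc]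
  have hint : ∀ i j, Integrable (fun v => f v * (G v i).coeff j) m.measure := fun i j =>
    hf.integrable_mul (hG.memLp i j)
  rw [h, integral_finsetSum _ fun i _ => integrable_finsetSum _ fun j _ =>
    (hint i j).mul_const _]
  simp only [avg, map_sum, map_smul, smul_eq_mul]
  refine Finset.sum_congr rfl fun i _ => ?_
  rw [integral_finsetSum _ fun j _ => (hint i j).mul_const _]
  simp only [integral_mul_const]

lemma L2DG.integrable_bilin (hG : L2DG m k G) (hH : L2DG m k H)
    (B : PiecewisePoly N →ₗ[ℝ] PiecewisePoly N →ₗ[ℝ] ℝ) :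
    Integrable (fun v => B (G v) (H v)) m.measure := by
  have h : Integrable (fun v => ∑ i, ∑ j ∈ Finset.range (k + 1),
      (G v i).coeff j * B (basisFun i j) (H v)) m.measure :=
    integrable_finsetSum _ fun i _ => integrable_finsetSum _ fun j _ =>
      (hG.memLp i j).integrable_mul (hH.memLp_map (B (basisFun i j)))
  refine h.congr ?_
  filter_upwards [hG.inDG] with v hv
  exact (hv.map_eq_sum (B.flip (H v))).symm

lemma L2DG.integrable_mul_bilin (hG : L2DG m k G) (hH : L2DG m k H)
    (B : PiecewisePoly N →ₗ[ℝ] PiecewisePoly N →ₗ[ℝ] ℝ) {f : ℝ → ℝ} (hf : Measurable f)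
    (h : ∀ v, |v| ≤ 1 → |f v| ≤ 1) :
    Integrable (fun v => f v * B (G v) (H v)) m.measure :=
  (hG.integrable_bilin hH B).bdd_mul hf.aestronglyMeasurable
    (m.ae_abs_le_one.mono fun v hv => h v hv)

end

/-! ### The discrete bilinear forms -/

section mesh
variable {a b : ℝ} {N : ℕ}

lemma meshSize_pos [NeZero N] (hab : a < b) : 0 < meshSize a b N :=
  div_pos (sub_pos.2 hab) (Nat.cast_pos.2 (NeZero.pos N))

lemma node_succ (a b : ℝ) (N j : ℕ) : node a b N (j + 1) = node a b N j + meshSize a b N := by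
  simp only [node]; push_cast; ring

lemma node_zero (a b : ℝ) (N : ℕ) : node a b N 0 = a := by simp [node]

lemma node_last (a b : ℝ) (N : ℕ) [NeZero N] : node a b N N = b := by
  have : (N : ℝ) ≠ 0 := Nat.cast_ne_zero.2 (NeZero.ne N)
  simp only [node, meshSize]; field_simp; ring

lemma node_lt_succ [NeZero N] (hab : a < b) (j : ℕ) : node a b N j < node a b N (j + 1) := by
  rw [node_succ]; linarith [meshSize_pos (N := N) hab]

lemma node_mono [NeZero N] (hab : a < b) : Monotone (node a b N) :=
  monotone_nat_of_le_succ fun j => (node_lt_succ hab j).le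

lemma node_mem_Icc [NeZero N] (hab : a < b) {j : ℕ} (hj : j ≤ N) :
    node a b N j ∈ Set.Icc a b := by
  have h1 := node_mono (N := N) hab (Nat.zero_le j)
  have h2 := node_mono (N := N) hab hj
  rw [node_zero] at h1
  rw [node_last] at h2
  exact ⟨h1, h2⟩

lemma element_subset_Icc [NeZero N] (hab : a < b) (i : Fin N) :
    Set.Icc (node a b N i) (node a b N (i + 1)) ⊆ Set.Icc a b :=
  Set.Icc_subset_Icc (node_mem_Icc hab i.2.le).1 (node_mem_Icc hab i.2).2

end mesh

lemma intervalIntegrable_eval_mul (p q : ℝ[X]) (c d : ℝ) :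
    IntervalIntegrable (fun x => p.eval x * q.eval x) volume c d :=
  (p.continuous.mul q.continuous).intervalIntegrable c d

section forms
variable (a b : ℝ) {N : ℕ}

/-- The inner product as a bilinear map. -/
noncomputable def ipL : PiecewisePoly N →ₗ[ℝ] PiecewisePoly N →ₗ[ℝ] ℝ :=
  LinearMap.mk₂ ℝ (ip a b)
    (fun u u' w => by
      simp only [ip, ← Finset.sum_add_distrib]
      refine Finset.sum_congr rfl fun i _ => ?_
      rw [← intervalIntegral.integral_add (intervalIntegrable_eval_mul _ _ _ _)
        (intervalIntegrable_eval_mul _ _ _ _)]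
      simp [add_mul])
    (fun c u w => by
      simp only [ip, smul_eq_mul, Finset.mul_sum]
      refine Finset.sum_congr rfl fun i _ => ?_
      rw [← intervalIntegral.integral_const_mul]
      simp [mul_assoc])
    (fun u w w' => by
      simp only [ip, ← Finset.sum_add_distrib]
      refine Finset.sum_congr rfl fun i _ => ?_
      rw [← intervalIntegral.integral_add (intervalIntegrable_eval_mul _ _ _ _)
        (intervalIntegrable_eval_mul _ _ _ _)]
      simp [mul_add])
    (fun c u w => by
      simp only [ip, smul_eq_mul, Finset.mul_sum]
      refine Finset.sum_congr rfl fun i _ => ?_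
      rw [← intervalIntegral.integral_const_mul]
      simp [mul_left_comm])

@[simp] lemma ipL_apply (u w : PiecewisePoly N) : ipL a b u w = ip a b u w := rfl

/-- The elementwise derivative. -/
noncomputable def pderiv : PiecewisePoly N →ₗ[ℝ] PiecewisePoly N where
  toFun u i := Polynomial.derivative (u i)
  map_add' u w := by ext1 i; simp
  map_smul' c u := by ext1 i; simp

@[simp] lemma pderiv_apply (u : PiecewisePoly N) (i : Fin N) :
    pderiv u i = Polynomial.derivative (u i) := rfl

lemma ipDeriv_eq (u w : PiecewisePoly N) : ipDeriv a b u w = ip a b u (pderiv w) := rfl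

variable [NeZero N]

/-- The trace `u⁺` as a linear map. -/
noncomputable def tracePlusL (i : Fin N) : PiecewisePoly N →ₗ[ℝ] ℝ where
  toFun u := tracePlus a b u i
  map_add' u w := by simp [tracePlus]
  map_smul' c u := by simp [tracePlus]

/-- The trace `u⁻` as a linear map. -/
noncomputable def traceMinusL (i : Fin N) : PiecewisePoly N →ₗ[ℝ] ℝ where
  toFun u := traceMinus a b u i
  map_add' u w := by simp [traceMinus]
  map_smul' c u := by simp [traceMinus]

/-- The jump as a linear map. -/
noncomputable def jumpL (i : Fin N) : PiecewisePoly N →ₗ[ℝ] ℝ := tracePlusL a b i - traceMinusL a b i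

@[simp] lemma tracePlusL_apply (u : PiecewisePoly N) (i : Fin N) :
    tracePlusL a b i u = tracePlus a b u i := rfl
@[simp] lemma traceMinusL_apply (u : PiecewisePoly N) (i : Fin N) :
    traceMinusL a b i u = traceMinus a b u i := rfl
@[simp] lemma jumpL_apply (u : PiecewisePoly N) (i : Fin N) :
    jumpL a b i u = jump a b u i := rfl

/-- The numerical trace for `ρ` as a linear map. -/
noncomputable def hatL (fl : Flux) (i : Fin N) : PiecewisePoly N →ₗ[ℝ] ℝ :=
  match fl with
  | .leftRight => tracePlusL a b i
  | .rightLeft => traceMinusL a b i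
  | .central => (2⁻¹ : ℝ) • (traceMinusL a b i + tracePlusL a b i)

lemma hatL_apply (fl : Flux) (u : PiecewisePoly N) (i : Fin N) :
    hatL a b fl i u = fl.hatRho (traceMinus a b u i) (tracePlus a b u i) := by
  cases fl <;> simp [hatL, Flux.hatRho]
  ring

/-- `d_h` as a bilinear map. -/
noncomputable def dL (fl : Flux) : PiecewisePoly N →ₗ[ℝ] PiecewisePoly N →ₗ[ℝ] ℝ :=
  (ipL a b).compl₂ pderiv
    + ∑ i, (LinearMap.mul ℝ ℝ).compl₁₂ (hatL a b fl i) (jumpL a b i)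

lemma dL_apply (fl : Flux) (u w : PiecewisePoly N) : dL a b fl u w = dForm fl a b u w := by
  simp [dL, dForm, ipDeriv_eq, LinearMap.sum_apply, hatL_apply]

/-- The flux with the roles of `ρ` and `⟨vg⟩` exchanged. -/
def Flux.swap : Flux → Flux
  | .leftRight => .rightLeft
  | .rightLeft => .leftRight
  | .central => .central

lemma Flux.hatVG_eq (fl : Flux) (x y : ℝ) : fl.hatVG x y = fl.swap.hatRho x y := by
  cases fl <;> rfl

lemma sum_comp_sub_one (f : Fin N → ℝ) : ∑ i, f (i - 1) = ∑ i, f i :=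
  Equiv.sum_comp (Equiv.subRight 1) f

/-- Integration by parts on all the elements. -/
lemma ip_pderiv_add (u w : PiecewisePoly N) :
    ip a b u (pderiv w) + ip a b (pderiv u) w
      = ∑ i, (traceMinus a b u i * traceMinus a b w i - tracePlus a b u i * tracePlus a b w i) := by
  rw [Finset.sum_sub_distrib]
  have h : ∑ i, traceMinus a b u i * traceMinus a b w i
      = ∑ i : Fin N, (u i).eval (node a b N (i + 1)) * (w i).eval (node a b N (i + 1)) :=
    sum_comp_sub_one fun i : Fin N =>
      (u i).eval (node a b N (i + 1)) * (w i).eval (node a b N (i + 1))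
  rw [h, ← Finset.sum_sub_distrib, ip, ip, ← Finset.sum_add_distrib]
  refine Finset.sum_congr rfl fun i _ => ?_
  rw [← intervalIntegral.integral_add (intervalIntegrable_eval_mul _ _ _ _)
        (intervalIntegrable_eval_mul _ _ _ _)]
  simp only [pderiv_apply, tracePlus]
  rw [← intervalIntegral.integral_deriv_mul_eq_sub (fun x _ => (u i).hasDerivAt x)
    (fun x _ => (w i).hasDerivAt x) ((Polynomial.continuous _).intervalIntegrable _ _)
    ((Polynomial.continuous _).intervalIntegrable _ _)]
  exact intervalIntegral.integral_congr fun x _ => by ring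

lemma ip_comm (u w : PiecewisePoly N) : ip a b u w = ip a b w u := by
  simp only [ip, mul_comm]

/-- Discrete integration by parts: at each mesh point the two numerical traces satisfy `û[w] + ŵ[u]
= u⁺w⁺ - u⁻w⁻`, which cancels the boundary terms of the elements. This makes the coupling of `ρ` and
`g` skew and is the reason for pairing the fluxes as in the scheme. -/
lemma dForm_swap (fl : Flux) (u w : PiecewisePoly N) :
    dForm fl.swap a b u w = -dForm fl a b w u := by
  have h := ip_pderiv_add a b u w
  rw [ip_comm a b (pderiv u) w] at h
  have h2 : ∑ i, (fl.swap.hatRho (traceMinus a b u i) (tracePlus a b u i) * jump a b w i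
      + fl.hatRho (traceMinus a b w i) (tracePlus a b w i) * jump a b u i)
      = -∑ i, (traceMinus a b u i * traceMinus a b w i
        - tracePlus a b u i * tracePlus a b w i) := by
    rw [← Finset.sum_neg_distrib]
    refine Finset.sum_congr rfl fun i _ => ?_
    cases fl <;> simp only [Flux.swap, Flux.hatRho, jump] <;> ring
  rw [Finset.sum_add_distrib] at h2
  simp only [dForm, ipDeriv_eq]
  linarith

/-- `∑ᵢ [u]ᵢ²`. -/
noncomputable def jumpSq (u : PiecewisePoly N) : ℝ := ∑ i, jump a b u i ^ 2

lemma jumpSq_nonneg (u : PiecewisePoly N) : 0 ≤ jumpSq a b u :=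
  Finset.sum_nonneg fun _ _ => sq_nonneg _

/-- The polarisation of `jumpSq`. -/
noncomputable def jumpBilin : PiecewisePoly N →ₗ[ℝ] PiecewisePoly N →ₗ[ℝ] ℝ :=
  ∑ i, (LinearMap.mul ℝ ℝ).compl₁₂ (jumpL a b i) (jumpL a b i)

lemma jumpBilin_self (u : PiecewisePoly N) : jumpBilin a b u u = jumpSq a b u := by
  simp [jumpBilin, jumpSq, LinearMap.sum_apply, sq]

lemma dForm_rightLeft_self (u : PiecewisePoly N) :
    dForm .rightLeft a b u u = -(jumpSq a b u / 2) := by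
  have h := ip_pderiv_add a b u u
  rw [ip_comm a b (pderiv u) u] at h
  have h2 : 2 * ∑ i, traceMinus a b u i * jump a b u i
      + ∑ i, (traceMinus a b u i * traceMinus a b u i - tracePlus a b u i * tracePlus a b u i)
      = -jumpSq a b u := by
    rw [jumpSq, Finset.mul_sum, ← Finset.sum_add_distrib, ← Finset.sum_neg_distrib]
    refine Finset.sum_congr rfl fun i _ => ?_
    simp only [jump]; ring
  simp only [dForm, ipDeriv_eq, Flux.hatRho]
  linarith

lemma dForm_leftRight_self (u : PiecewisePoly N) :
    dForm .leftRight a b u u = jumpSq a b u / 2 := by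
  have h := dForm_swap a b .rightLeft u u
  rw [dForm_rightLeft_self] at h
  simpa [Flux.swap] using h

/-- Upwinding is an alternating trace chosen by the sign of `v`; every property of the upwind form
thereby reduces to one of `d_h`. -/
lemma upwindForm_eq (v : ℝ) (u w : PiecewisePoly N) :
    upwindForm a b v u w
      = -(max v 0 * dForm .rightLeft a b u w + min v 0 * dForm .leftRight a b u w) := by
  simp only [upwindForm, dForm, Flux.hatRho]
  rcases lt_or_ge 0 v with hv | hv
  · simp only [upwind, if_pos hv, max_eq_left hv.le, min_eq_right hv.le, mul_assoc,
      ← Finset.mul_sum]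
    ring
  · simp only [upwind, if_neg hv.not_gt, max_eq_right hv, min_eq_left hv, mul_assoc,
      ← Finset.mul_sum]
    ring

/-- The upwind form as a bilinear map. -/
noncomputable def upwindL (v : ℝ) : PiecewisePoly N →ₗ[ℝ] PiecewisePoly N →ₗ[ℝ] ℝ :=
  -(max v 0 • dL a b .rightLeft + min v 0 • dL a b .leftRight)

lemma upwindL_apply (v : ℝ) (u w : PiecewisePoly N) :
    upwindL a b v u w = upwindForm a b v u w := by
  simp [upwindL, upwindForm_eq, dL_apply]

/-- The upwind dissipation, one of the two sources of damping in the energy balance. -/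
lemma upwindForm_self (v : ℝ) (u : PiecewisePoly N) :
    upwindForm a b v u u = |v| * jumpSq a b u / 2 := by
  rw [upwindForm_eq, dForm_rightLeft_self, dForm_leftRight_self]
  rcases le_total 0 v with hv | hv
  · rw [max_eq_left hv, min_eq_right hv, abs_of_nonneg hv]; ring
  · rw [max_eq_right hv, min_eq_left hv, abs_of_nonpos hv]; ring

end forms

/-! ### Norms and inverse inequalities -/

section norms
variable {a b : ℝ} {N : ℕ} [NeZero N]

lemma ip_self_nonneg (hab : a < b) (u : PiecewisePoly N) : 0 ≤ ip a b u u :=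
  Finset.sum_nonneg fun i _ =>
    intervalIntegral.integral_nonneg (node_lt_succ hab i).le fun x _ => mul_self_nonneg _

lemma ip_sq_le (hab : a < b) (u w : PiecewisePoly N) : ip a b u w ^ 2 ≤ ip a b u u * ip a b w w :=
  LinearMap.BilinForm.apply_sq_le_of_symm (ipL a b) (fun u => ip_self_nonneg hab u)
    ⟨fun u w => ip_comm a b u w⟩ u w

end norms

/-- The norm of `U_h^k`. -/
noncomputable def nrm (a b : ℝ) {N : ℕ} (u : PiecewisePoly N) : ℝ := √(ip a b u u)

section norms
variable {a b : ℝ} {N : ℕ} [NeZero N]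

lemma nrm_nonneg (u : PiecewisePoly N) : 0 ≤ nrm a b u := Real.sqrt_nonneg _

lemma nrm_sq (hab : a < b) (u : PiecewisePoly N) : nrm a b u ^ 2 = ip a b u u :=
  Real.sq_sqrt (ip_self_nonneg hab u)

lemma abs_ip_le (hab : a < b) (u w : PiecewisePoly N) :
    |ip a b u w| ≤ nrm a b u * nrm a b w := by
  rw [nrm, nrm, ← Real.sqrt_mul (ip_self_nonneg hab u)]
  exact Real.abs_le_sqrt (ip_sq_le hab u w)

lemma abs_sum_mul_le {ι : Type*} (s : Finset ι) (f g : ι → ℝ) :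
    |∑ i ∈ s, f i * g i| ≤ √(∑ i ∈ s, f i ^ 2) * √(∑ i ∈ s, g i ^ 2) := by
  rw [← Real.sqrt_mul (Finset.sum_nonneg fun i _ => sq_nonneg _)]
  exact Real.abs_le_sqrt (Finset.sum_mul_sq_le_sq_mul_sq s f g)

variable {k : ℕ} {C C' : ℝ}

lemma AreInverseConstants.one_le (hC : AreInverseConstants k C C') : 1 ≤ C := by
  have := hC.trace 0 1 one_pos 1 (by simp) 0 (Or.inl rfl)
  simpa using this

/-- The test polynomial `X` is admissible only for `k ≠ 0`. For piecewise constants the second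
constant may vanish, which is why `derivConst` and `sumConst` treat that case apart. -/
lemma AreInverseConstants.pos (hC : AreInverseConstants k C C') (hk : k ≠ 0) : 0 < C' := by
  have := hC.deriv 0 1 one_pos Polynomial.X (by simpa using Nat.one_le_iff_ne_zero.2 hk)
  norm_num at this
  linarith

lemma sum_tracePlus_sq_le (hab : a < b) (hC : AreInverseConstants k C C') {u : PiecewisePoly N}
    (hu : InDG k u) : ∑ i, tracePlus a b u i ^ 2 ≤ C / meshSize a b N * ip a b u u := by
  have hh := meshSize_pos (N := N) hab
  rw [div_mul_eq_mul_div, le_div_iff₀ hh, Finset.sum_mul, ip, Finset.mul_sum]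
  refine Finset.sum_le_sum fun i _ => ?_
  have := hC.trace _ _ (node_lt_succ (N := N) hab i) (u i) (hu i) _ (Or.inl rfl)
  rw [node_succ, add_sub_cancel_left, sq_abs] at this
  simpa [tracePlus, node_succ, sq] using this

lemma sum_traceMinus_sq_le (hab : a < b) (hC : AreInverseConstants k C C') {u : PiecewisePoly N}
    (hu : InDG k u) : ∑ i, traceMinus a b u i ^ 2 ≤ C / meshSize a b N * ip a b u u := by
  have hh := meshSize_pos (N := N) hab
  have h : ∑ i, traceMinus a b u i ^ 2 = ∑ i : Fin N, (u i).eval (node a b N (i + 1)) ^ 2 :=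
    sum_comp_sub_one fun i : Fin N => (u i).eval (node a b N (i + 1)) ^ 2
  rw [h, div_mul_eq_mul_div, le_div_iff₀ hh, Finset.sum_mul, ip, Finset.mul_sum]
  refine Finset.sum_le_sum fun i _ => ?_
  have := hC.trace _ _ (node_lt_succ (N := N) hab i) (u i) (hu i) _ (Or.inr rfl)
  rw [sq_abs] at this
  simpa [node_succ, sq] using this

lemma sum_hat_sq_le (fl : Flux) (x y : Fin N → ℝ) {K : ℝ} (hx : ∑ i, x i ^ 2 ≤ K)
    (hy : ∑ i, y i ^ 2 ≤ K) : ∑ i, fl.hatRho (x i) (y i) ^ 2 ≤ K := by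
  cases fl
  · exact hy
  · exact hx
  · calc ∑ i, ((x i + y i) / 2) ^ 2 ≤ ∑ i, (x i ^ 2 / 2 + y i ^ 2 / 2) :=
          Finset.sum_le_sum fun i _ => by nlinarith [sq_nonneg (x i - y i)]
      _ ≤ K := by
          rw [Finset.sum_add_distrib, ← Finset.sum_div, ← Finset.sum_div]; linarith

lemma jumpSq_le (hab : a < b) (hC : AreInverseConstants k C C') {u : PiecewisePoly N}
    (hu : InDG k u) : jumpSq a b u ≤ 4 * C / meshSize a b N * ip a b u u := by
  have h1 := sum_tracePlus_sq_le hab hC hu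
  have h2 := sum_traceMinus_sq_le hab hC hu
  calc jumpSq a b u ≤ ∑ i, (2 * tracePlus a b u i ^ 2 + 2 * traceMinus a b u i ^ 2) :=
        Finset.sum_le_sum fun i _ => by
          rw [jump]; nlinarith [sq_nonneg (tracePlus a b u i + traceMinus a b u i)]
    _ = 2 * ∑ i, tracePlus a b u i ^ 2 + 2 * ∑ i, traceMinus a b u i ^ 2 := by
        rw [Finset.sum_add_distrib, ← Finset.mul_sum, ← Finset.mul_sum]
    _ ≤ 2 * (C / meshSize a b N * ip a b u u) + 2 * (C / meshSize a b N * ip a b u u) := by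
        linarith
    _ = 4 * C / meshSize a b N * ip a b u u := by ring

lemma ip_pderiv_self_le (hab : a < b) (hC : AreInverseConstants k C C') {u : PiecewisePoly N}
    (hu : InDG k u) :
    ip a b (pderiv u) (pderiv u) ≤ C' / meshSize a b N ^ 2 * ip a b u u := by
  have hh := meshSize_pos (N := N) hab
  rw [div_mul_eq_mul_div, le_div_iff₀ (pow_pos hh 2), mul_comm, ip, ip, Finset.mul_sum,
    Finset.mul_sum]
  refine Finset.sum_le_sum fun i _ => ?_
  have := hC.deriv _ _ (node_lt_succ (N := N) hab i) (u i) (hu i)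
  rw [node_succ, add_sub_cancel_left] at this
  simpa [node_succ, ← sq] using this

lemma pderiv_eq_zero {u : PiecewisePoly N} (hu : InDG 0 u) : pderiv u = 0 := by
  ext1 i
  exact Polynomial.derivative_of_natDegree_zero (Nat.le_zero.1 (hu i))

/-- Continuity of `d_h` with respect to its second argument's derivative and jumps. -/
lemma abs_dForm_le (hab : a < b) (hC : AreInverseConstants k C C') (fl : Flux)
    {u : PiecewisePoly N} (hu : InDG k u) (w : PiecewisePoly N) :
    |dForm fl a b u w| ≤ nrm a b u *
      (nrm a b (pderiv w) + √(C / meshSize a b N) * √(jumpSq a b w)) := by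
  have hh := meshSize_pos (N := N) hab
  have hC0 : 0 ≤ C / meshSize a b N := div_nonneg (zero_le_one.trans hC.one_le) hh.le
  have h1 := abs_ip_le hab u (pderiv w)
  have h2 := abs_sum_mul_le Finset.univ
    (fun i => fl.hatRho (traceMinus a b u i) (tracePlus a b u i)) (jump a b w)
  have h3 : √(∑ i, fl.hatRho (traceMinus a b u i) (tracePlus a b u i) ^ 2)
      ≤ √(C / meshSize a b N) * nrm a b u := by
    rw [nrm, ← Real.sqrt_mul hC0]
    exact Real.sqrt_le_sqrt (sum_hat_sq_le fl _ _ (sum_traceMinus_sq_le hab hC hu)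
      (sum_tracePlus_sq_le hab hC hu))
  calc |dForm fl a b u w|
      ≤ nrm a b u * nrm a b (pderiv w) + √(C / meshSize a b N) * nrm a b u * √(jumpSq a b w) := by
        refine (abs_add_le _ _).trans (add_le_add h1 (h2.trans ?_))
        exact mul_le_mul_of_nonneg_right h3 (Real.sqrt_nonneg _)
    _ = _ := by ring

lemma abs_upwindForm_le (hab : a < b) (hC : AreInverseConstants k C C') (v : ℝ)
    {u : PiecewisePoly N} (hu : InDG k u) (w : PiecewisePoly N) :
    |upwindForm a b v u w| ≤ |v| * (nrm a b u *
      (nrm a b (pderiv w) + √(C / meshSize a b N) * √(jumpSq a b w))) := by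
  rw [upwindForm_eq]
  rcases le_total 0 v with hv | hv
  · rw [max_eq_left hv, min_eq_right hv, zero_mul, add_zero, abs_neg, abs_mul]
    exact mul_le_mul_of_nonneg_left (abs_dForm_le hab hC _ hu w) (abs_nonneg v)
  · rw [max_eq_right hv, min_eq_left hv, zero_mul, zero_add, abs_neg, abs_mul]
    exact mul_le_mul_of_nonneg_left (abs_dForm_le hab hC _ hu w) (abs_nonneg v)

end norms

/-! ### Projections on one element -/

lemma Polynomial.exists_derivative_eq (n : ℕ) (p : ℝ[X]) (hp : p.natDegree ≤ n) :
    ∃ P : ℝ[X], P.natDegree ≤ n + 1 ∧ Polynomial.derivative P = p := by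
  refine ⟨∑ j ∈ Finset.range (n + 1), Polynomial.monomial (j + 1) (p.coeff j / (j + 1)), ?_, ?_⟩
  · refine Polynomial.natDegree_sum_le_of_forall_le _ _ fun j hj => ?_
    refine (Polynomial.natDegree_monomial_le _).trans ?_
    have := Finset.mem_range.1 hj
    omega
  · rw [Polynomial.derivative_sum]
    conv_rhs => rw [p.as_sum_range' (n + 1) (Nat.lt_succ_of_le hp)]
    refine Finset.sum_congr rfl fun j _ => ?_
    rw [Polynomial.derivative_monomial]
    have : (j : ℝ) + 1 ≠ 0 := by positivity
    simp [this]

lemma sq_integral_interval_le {f g : ℝ → ℝ} {c d : ℝ} (hcd : c ≤ d)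
    (hf : ContinuousOn f (Set.Icc c d)) (hg : ContinuousOn g (Set.Icc c d)) :
    (∫ x in c..d, f x * g x) ^ 2 ≤ (∫ x in c..d, f x ^ 2) * ∫ x in c..d, g x ^ 2 := by
  simp only [intervalIntegral.integral_of_le hcd, ← integral_Icc_eq_integral_Ioc]
  have h : ∀ f : ℝ → ℝ, ContinuousOn f (Set.Icc c d) →
      MemLp f 2 (volume.restrict (Set.Icc c d)) := fun f hf =>
    (memLp_two_iff_integrable_sq (hf.aestronglyMeasurable measurableSet_Icc)).2
      ((hf.pow 2).integrableOn_compact isCompact_Icc)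
  exact sq_integral_mul_le (h f hf) (h g hg)

/-- Approximation by polynomials in the maximum norm. -/
lemma exists_polynomial_approx (k : ℕ) {c d : ℝ} (hcd : c < d) : ∀ w : ℝ → ℝ,
    ContDiff ℝ (k + 1) w → ∃ p : ℝ[X], p.natDegree ≤ k ∧ ∀ x ∈ Set.Icc c d,
      |w x - p.eval x| ≤ (d - c) ^ k * √((d - c) * ∫ y in c..d, iteratedDeriv (k + 1) w y ^ 2) := by
  induction k with
  | zero =>
    intro w hw
    have hw1 : ContDiff ℝ 1 w := by simpa using hw
    -- The value at the left end is enough: the deviation is an integral of `w'`, bounded by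
    -- Cauchy–Schwarz.
    refine ⟨Polynomial.C (w c), by simp, fun x hx => ?_⟩
    have hc : Continuous (deriv w) := hw1.continuous_deriv le_rfl
    have h1 : ∫ y in c..x, deriv w y * 1 = w x - w c := by
      simp only [mul_one]
      exact intervalIntegral.integral_deriv_eq_sub (fun y _ => hw1.differentiable one_ne_zero y)
        (hc.intervalIntegrable _ _)
    have h2 := sq_integral_interval_le hx.1 hc.continuousOn
      (continuousOn_const (c := (1 : ℝ)))
    rw [h1] at h2
    rw [pow_zero, one_mul, Polynomial.eval_C, zero_add, iteratedDeriv_one]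
    refine Real.abs_le_sqrt (h2.trans ?_)
    have h3 : ∫ y in c..x, deriv w y ^ 2 ≤ ∫ y in c..d, deriv w y ^ 2 := by
      refine intervalIntegral.integral_mono_interval le_rfl hx.1 hx.2 ?_
        ((hc.pow 2).intervalIntegrable _ _)
      exact Filter.Eventually.of_forall fun y => sq_nonneg _
    have h4 : 0 ≤ ∫ y in c..x, deriv w y ^ 2 :=
      intervalIntegral.integral_nonneg hx.1 fun y _ => sq_nonneg _
    simp only [one_pow, intervalIntegral.integral_const, smul_eq_mul, mul_one]
    rw [mul_comm]
    exact mul_le_mul (by linarith [hx.2]) h3 h4 (by linarith)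
  | succ k ih =>
    intro w hw
    have hw' : ContDiff ℝ ((k + 1 : ℕ) + 1) w := by exact_mod_cast hw
    have hd : Differentiable ℝ w := (contDiff_succ_iff_deriv.1 hw').1
    have hdw : ContDiff ℝ (k + 1) (deriv w) := by
      exact_mod_cast (contDiff_succ_iff_deriv.1 hw').2.2
    -- Approximate the derivative, integrate the polynomial and match the value at `c`; the mean
    -- value inequality costs one factor `d - c`.
    obtain ⟨p', hp', hb⟩ := ih (deriv w) hdw
    obtain ⟨P, hP, hPd⟩ := Polynomial.exists_derivative_eq k p' hp'
    rw [← iteratedDeriv_succ'] at hb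
    set B := (d - c) ^ k * √((d - c) * ∫ y in c..d, iteratedDeriv (k + 1 + 1) w y ^ 2) with hB
    refine ⟨P + Polynomial.C (w c - P.eval c), (Polynomial.natDegree_add_C).trans_le hP,
      fun x hx => ?_⟩
    have hder : ∀ y ∈ Set.Icc c d, HasDerivWithinAt (fun y => w y - P.eval y)
        (deriv w y - p'.eval y) (Set.Icc c d) y := fun y _ => by
      rw [← hPd]
      exact ((hd y).hasDerivAt.sub (P.hasDerivAt y)).hasDerivWithinAt
    have := (convex_Icc c d).norm_image_sub_le_of_norm_hasDerivWithin_le hder hb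
      (Set.left_mem_Icc.2 hcd.le) hx
    have hB0 : 0 ≤ B := mul_nonneg (pow_nonneg (sub_pos.2 hcd).le _) (Real.sqrt_nonneg _)
    rw [Real.norm_eq_abs, Real.norm_eq_abs, abs_of_nonneg (sub_nonneg.2 hx.1)] at this
    calc |w x - (P + Polynomial.C (w c - P.eval c)).eval x|
        = |w x - P.eval x - (w c - P.eval c)| := by
          rw [Polynomial.eval_add, Polynomial.eval_C]; ring_nf
      _ ≤ B * (x - c) := this
      _ ≤ B * (d - c) := mul_le_mul_of_nonneg_left (by linarith [hx.2]) hB0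
      _ = _ := by rw [hB]; ring

/-- `q` is the projection of `w` onto the polynomials of degree at most `k` on `[c, d]` that is
adapted to the numerical trace `fl.hatRho`: a Gauss–Radau projection for the alternating fluxes, the
`L²` projection for the central one. -/
structure IsProj (fl : Flux) (k : ℕ) (c d : ℝ) (w : ℝ → ℝ) (q : ℝ[X]) : Prop where
  natDegree_le : q.natDegree ≤ k
  orth : ∀ p : ℝ[X], p.natDegree < k ∨ (fl = .central ∧ p.natDegree ≤ k) →
    ∫ x in c..d, (q.eval x - w x) * p.eval x = 0
  left : fl = .leftRight → q.eval c = w c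
  right : fl = .rightLeft → q.eval d = w d

section element
variable {k : ℕ} {C C' c d : ℝ}

/-- The trace inequality is available on every interval, so an interior point may be treated as an
end point of `[c, y]` and of `[y, d]`; the two bounds are added. -/
lemma sq_eval_mul_le (hC : AreInverseConstants k C C') (hcd : c < d) {s : ℝ[X]}
    (hs : s.natDegree ≤ k) {y : ℝ} (hy : y ∈ Set.Icc c d) :
    s.eval y ^ 2 * (d - c) ≤ 2 * C * ∫ x in c..d, s.eval x ^ 2 := by
  have hint : ∀ u v : ℝ, IntervalIntegrable (fun x => s.eval x ^ 2) volume u v := fun u v =>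
    (s.continuous.pow 2).intervalIntegrable u v
  have h1 : s.eval y ^ 2 * (y - c) ≤ C * ∫ x in c..y, s.eval x ^ 2 := by
    rcases hy.1.eq_or_lt with h | h
    · simp [h]
    · simpa using hC.trace c y h s hs y (Or.inr rfl)
  have h2 : s.eval y ^ 2 * (d - y) ≤ C * ∫ x in y..d, s.eval x ^ 2 := by
    rcases hy.2.eq_or_lt with h | h
    · simp [h]
    · simpa using hC.trace y d h s hs y (Or.inl rfl)
  have h3 := intervalIntegral.integral_add_adjacent_intervals (hint c y) (hint y d)
  have h4 : 0 ≤ ∫ x in c..d, s.eval x ^ 2 :=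
    intervalIntegral.integral_nonneg hcd.le fun x _ => sq_nonneg _
  have := hC.one_le
  nlinarith

/-- For a polynomial, a weight that vanishes linearly at one end point does not weaken the
`L²` norm. -/
lemma integral_sq_le_weighted (hC : AreInverseConstants k C C') (hcd : c < d) {s : ℝ[X]}
    (hs : s.natDegree ≤ k) {ω : ℝ → ℝ} (hω : Continuous ω) (hω1 : ∀ x ∈ Set.Icc c d, ω x ≤ 1) {n : ℕ} (hn : 4 * C ≤ n + 1)
    (hωn : ∫ x in c..d, (1 - ω x) ^ n = (d - c) / (n + 1)) :
    ∫ x in c..d, s.eval x ^ 2 ≤ 2 * n * ∫ x in c..d, ω x * s.eval x ^ 2 := by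
  set I := ∫ x in c..d, s.eval x ^ 2 with hI
  have hs2 : Continuous fun x => s.eval x ^ 2 := s.continuous.pow 2
  have hI0 : 0 ≤ I := intervalIntegral.integral_nonneg hcd.le fun x _ => sq_nonneg _
  have hh : 0 < d - c := sub_pos.2 hcd
  have h1 : I ≤ ∫ x in c..d, (n * (ω x * s.eval x ^ 2)
      + (2 * C * I / (d - c)) * (1 - ω x) ^ n) := by
    refine intervalIntegral.integral_mono_on hcd.le (hs2.intervalIntegrable _ _)
      (Continuous.intervalIntegrable (by fun_prop) _ _) fun x hx => ?_
    -- Bernoulli's inequality in the form `1 ≤ n ω + (1 - ω)^n`. The last power has mean `1 / (n +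
    -- 1)`, and the supremum of `s²` is at most `2 C` times its mean; hence `4 C ≤ n + 1` lets half
    -- of the left-hand side absorb that term.
    have hb : 1 + (n : ℝ) * (-ω x) ≤ (1 + -ω x) ^ n :=
      one_add_mul_le_pow (by linarith [hω1 x hx]) n
    have hp : 0 ≤ (1 - ω x) ^ n := pow_nonneg (by linarith [hω1 x hx]) n
    have hsup : s.eval x ^ 2 ≤ 2 * C * I / (d - c) := by
      rw [le_div_iff₀ hh]; exact sq_eval_mul_le hC hcd hs hx
    calc s.eval x ^ 2 = s.eval x ^ 2 * 1 := by ring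
      _ ≤ s.eval x ^ 2 * (n * ω x + (1 - ω x) ^ n) := by
          refine mul_le_mul_of_nonneg_left ?_ (sq_nonneg _)
          rw [← sub_eq_add_neg] at hb; linarith
      _ = n * (ω x * s.eval x ^ 2) + s.eval x ^ 2 * (1 - ω x) ^ n := by ring
      _ ≤ _ := by gcongr
  rw [intervalIntegral.integral_add (Continuous.intervalIntegrable (by fun_prop) _ _)
    (Continuous.intervalIntegrable (by fun_prop) _ _), intervalIntegral.integral_const_mul,
    intervalIntegral.integral_const_mul, hωn] at h1
  have h2 : 2 * C * I / (d - c) * ((d - c) / (n + 1)) ≤ I / 2 := by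
    have hn1 : (0 : ℝ) < n + 1 := by positivity
    rw [div_mul_div_comm, mul_comm (d - c), mul_div_mul_right _ _ hh.ne', div_le_iff₀ hn1]
    nlinarith
  linarith

/-- The stability constant of the projections. -/
noncomputable def projConst (C : ℝ) : ℝ := 1 + √(128 * C) * (⌈4 * C⌉₊ : ℝ)

/-- The Gauss–Radau case of `IsProj.abs_eval_le`. -/
lemma abs_eval_le_of_radau (hC : AreInverseConstants k C C') (hcd : c < d) {r : ℝ → ℝ}
    (hr : ContinuousOn r (Set.Icc c d)) {R : ℝ} (hR : ∀ x ∈ Set.Icc c d, |r x| ≤ R) {q : ℝ[X]}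
    (hq : q.natDegree ≤ k) (horth : ∀ p : ℝ[X], p.natDegree < k →
      ∫ x in c..d, (q.eval x - r x) * p.eval x = 0)
    {e κ : ℝ} (he : e ∈ Set.Icc c d) (hκ : |κ| = 1)
    (hω1 : ∀ x ∈ Set.Icc c d, κ * (x - e) / (d - c) ≤ 1)
    (hωn : ∀ n : ℕ, ∫ x in c..d, (1 - κ * (x - e) / (d - c)) ^ n = (d - c) / (n + 1))
    (hqe : q.eval e = r e) {x : ℝ} (hx : x ∈ Set.Icc c d) :
    |q.eval x| ≤ projConst C * R := by
  have hh : 0 < d - c := sub_pos.2 hcd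
  have hR0 : 0 ≤ R := (abs_nonneg _).trans (hR x hx)
  have hre : |r e| ≤ R := hR e he
  -- Subtracting the interpolated value leaves `(x - e) s` with `s` of degree below `k`, so that `s`
  -- itself is an admissible test function.
  obtain ⟨s, hs⟩ : (Polynomial.X - Polynomial.C e) ∣ q - Polynomial.C (q.eval e) := by
    rw [Polynomial.dvd_iff_isRoot]; simp
  have hqs : ∀ y, q.eval y = r e + (y - e) * s.eval y := fun y => by
    have := congrArg (Polynomial.eval y) hs
    simp only [Polynomial.eval_sub, Polynomial.eval_C, Polynomial.eval_mul,
      Polynomial.eval_X] at this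
    linarith
  -- The degree count below needs `s ≠ 0`. For `k = 0` only the present case occurs.
  by_cases hk : s = 0
  · rw [hqs, hk]
    simp only [Polynomial.eval_zero, mul_zero, add_zero]
    have : 1 * R ≤ projConst C * R := by
      refine mul_le_mul_of_nonneg_right ?_ hR0
      have : 0 ≤ √(128 * C) * (⌈4 * C⌉₊ : ℝ) := by positivity
      simp only [projConst]; linarith
    linarith
  have hdeg : s.natDegree < k := by
    have h1 := congrArg Polynomial.natDegree hs
    rw [Polynomial.natDegree_sub_C, Polynomial.natDegree_mul (Polynomial.X_sub_C_ne_zero e) hk,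
      Polynomial.natDegree_X_sub_C] at h1
    omega
  set n := ⌈4 * C⌉₊ with hn
  have hnC : 4 * C ≤ n := Nat.le_ceil _
  have hn1 : (1 : ℝ) ≤ n := by linarith [hC.one_le]
  have hwt := integral_sq_le_weighted hC hcd hdeg.le (ω := fun x => κ * (x - e) / (d - c))
    (by fun_prop) hω1 (n := n) (by linarith) (hωn n)
  set I := ∫ x in c..d, s.eval x ^ 2 with hI
  have hI0 : 0 ≤ I := intervalIntegral.integral_nonneg hcd.le fun x _ => sq_nonneg _
  have hint : ∀ f : ℝ → ℝ, ContinuousOn f (Set.Icc c d) → IntervalIntegrable f volume c d :=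
    fun f hf => ContinuousOn.intervalIntegrable (by rwa [Set.uIcc_of_le hcd.le])
  have hpoly : ∀ p : ℝ[X], ContinuousOn (fun x => p.eval x) (Set.Icc c d) := fun p =>
    p.continuous.continuousOn
  -- Orthogonality against `s`: the weighted square of `s` is expressed by the data, and the sign
  -- `κ` makes the weight nonnegative on the element.
  have hweq : ∫ x in c..d, κ * (x - e) / (d - c) * s.eval x ^ 2
      = κ / (d - c) * ∫ x in c..d, (r x - r e) * s.eval x := by
    have h1 := horth s hdeg
    have h2 : ∫ x in c..d, ((x - e) * s.eval x ^ 2 - (r x - r e) * s.eval x) = 0 := by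
      rw [← h1]
      refine intervalIntegral.integral_congr fun y _ => ?_
      simp only [hqs]; ring
    have hi1 : IntervalIntegrable (fun x => (x - e) * s.eval x ^ 2) volume c d :=
      Continuous.intervalIntegrable (by fun_prop) _ _
    have hi2 : IntervalIntegrable (fun x => (r x - r e) * s.eval x) volume c d :=
      hint _ ((hr.sub continuousOn_const).mul (hpoly s))
    rw [intervalIntegral.integral_sub hi1 hi2, sub_eq_zero] at h2
    rw [← h2, ← intervalIntegral.integral_const_mul]
    refine intervalIntegral.integral_congr fun y _ => ?_
    ring
  have hcs : (∫ x in c..d, (r x - r e) * s.eval x) ^ 2 ≤ (4 * R ^ 2 * (d - c)) * I := by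
    refine (sq_integral_interval_le hcd.le (hr.sub continuousOn_const) (hpoly s)).trans ?_
    refine mul_le_mul_of_nonneg_right ?_ hI0
    calc ∫ x in c..d, (r x - r e) ^ 2 ≤ ∫ x in c..d, 4 * R ^ 2 := by
          refine intervalIntegral.integral_mono_on hcd.le
            (hint _ ((hr.sub continuousOn_const).pow 2)) intervalIntegrable_const fun y hy => ?_
          have h1 := abs_le.1 (hR y hy)
          have h2 := abs_le.1 hre
          nlinarith
      _ = 4 * R ^ 2 * (d - c) := by
          rw [intervalIntegral.integral_const, smul_eq_mul, mul_comm]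
  have hIle : I * (d - c) ≤ 16 * n ^ 2 * R ^ 2 := by
    rw [hweq] at hwt
    set Z := ∫ x in c..d, (r x - r e) * s.eval x with hZ
    have h1 : I * (d - c) ≤ 2 * n * (κ * Z) := by
      calc I * (d - c) ≤ 2 * n * (κ / (d - c) * Z) * (d - c) := by gcongr
        _ = 2 * n * (κ * Z) := by field_simp
    have h2 : (I * (d - c)) ^ 2 ≤ (2 * n * (κ * Z)) ^ 2 :=
      pow_le_pow_left₀ (mul_nonneg hI0 hh.le) h1 2
    have hκ2 : κ ^ 2 = 1 := by rw [← sq_abs, hκ, one_pow]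
    have h3 : (2 * n * (κ * Z)) ^ 2 = 4 * n ^ 2 * Z ^ 2 := by
      calc (2 * n * (κ * Z)) ^ 2 = 4 * n ^ 2 * Z ^ 2 * κ ^ 2 := by ring
        _ = _ := by rw [hκ2, mul_one]
    rcases hI0.eq_or_lt with h0 | h0
    · rw [← h0, zero_mul]; positivity
    have h4 : I * (d - c) * (I * (d - c)) ≤ (16 * n ^ 2 * R ^ 2) * (I * (d - c)) := by
      have : 4 * (n : ℝ) ^ 2 * Z ^ 2 ≤ 4 * n ^ 2 * (4 * R ^ 2 * (d - c) * I) := by gcongr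
      nlinarith
    exact le_of_mul_le_mul_right h4 (mul_pos h0 hh)
  have hsup := sq_eval_mul_le hC hcd hdeg.le hx
  have hxe : (x - e) ^ 2 ≤ (d - c) ^ 2 := by
    apply sq_le_sq'
    · linarith [hx.1, he.2]
    · linarith [hx.2, he.1]
  have hfin : ((x - e) * s.eval x) ^ 2 ≤ (√(128 * C) * n * R) ^ 2 := by
    have hC0 : 0 ≤ 128 * C := by linarith [hC.one_le]
    rw [mul_pow, mul_pow, mul_pow, Real.sq_sqrt hC0]
    calc (x - e) ^ 2 * s.eval x ^ 2 ≤ (d - c) ^ 2 * s.eval x ^ 2 := by gcongr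
      _ = (s.eval x ^ 2 * (d - c)) * (d - c) := by ring
      _ ≤ (2 * C * I) * (d - c) := by gcongr
      _ = 2 * C * (I * (d - c)) := by ring
      _ ≤ 2 * C * (16 * n ^ 2 * R ^ 2) := by
          refine mul_le_mul_of_nonneg_left hIle (by linarith)
      _ ≤ 128 * C * n ^ 2 * R ^ 2 := by
          have : 0 ≤ C * n ^ 2 * R ^ 2 := by
            have : 0 ≤ C := by linarith
            positivity
          linarith
  have h5 := abs_le_of_sq_le_sq hfin (by positivity)
  rw [hqs]
  calc |r e + (x - e) * s.eval x| ≤ |r e| + |(x - e) * s.eval x| := abs_add_le _ _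
    _ ≤ R + √(128 * C) * n * R := add_le_add hre h5
    _ = projConst C * R := by simp only [projConst, ← hn]; ring

/-- The projections are bounded in the maximum norm, uniformly in the element. -/
lemma IsProj.abs_eval_le (hC : AreInverseConstants k C C') (hcd : c < d) {fl : Flux} {r : ℝ → ℝ}
    (hr : ContinuousOn r (Set.Icc c d)) {R : ℝ} (hR : ∀ x ∈ Set.Icc c d, |r x| ≤ R) {q : ℝ[X]}
    (hq : IsProj fl k c d r q) {x : ℝ} (hx : x ∈ Set.Icc c d) :
    |q.eval x| ≤ projConst C * R := by
  have hh : 0 < d - c := sub_pos.2 hcd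
  cases fl
  · refine abs_eval_le_of_radau hC hcd hr hR hq.natDegree_le (fun p hp => hq.orth p (Or.inl hp))
      (Set.left_mem_Icc.2 hcd.le) (κ := 1) (by simp) (fun y hy => ?_)
      (fun n => ?_) (hq.left rfl) hx
    · rw [one_mul, div_le_one hh]; linarith [hy.2]
    · have h : ∀ y, 1 - 1 * (y - c) / (d - c) = d / (d - c) - y / (d - c) := fun y => by
        field_simp; ring
      simp only [h]
      rw [intervalIntegral.integral_comp_sub_div (fun z => z ^ n) hh.ne', integral_pow, ← sub_div,
        ← sub_div, sub_self, zero_div, div_self hh.ne']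
      simp [div_eq_mul_inv]
  · refine abs_eval_le_of_radau hC hcd hr hR hq.natDegree_le (fun p hp => hq.orth p (Or.inl hp))
      (Set.right_mem_Icc.2 hcd.le) (κ := -1) (by simp) (fun y hy => ?_)
      (fun n => ?_) (hq.right rfl) hx
    · rw [div_le_one hh]; linarith [hy.1]
    · have h : ∀ y, 1 - -1 * (y - d) / (d - c) = y / (d - c) - c / (d - c) := fun y => by
        field_simp; ring
      simp only [h]
      rw [intervalIntegral.integral_comp_div_sub (fun z => z ^ n) hh.ne', integral_pow, ← sub_div,
        ← sub_div, sub_self, zero_div, div_self hh.ne']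
      simp [div_eq_mul_inv]
  · have hR0 : 0 ≤ R := (abs_nonneg _).trans (hR x hx)
    have hint : ∀ f : ℝ → ℝ, ContinuousOn f (Set.Icc c d) → IntervalIntegrable f volume c d :=
      fun f hf => ContinuousOn.intervalIntegrable (by rwa [Set.uIcc_of_le hcd.le])
    have hqc : ContinuousOn (fun x => q.eval x) (Set.Icc c d) := q.continuous.continuousOn
    -- The `L²` projection may be tested with itself; `q² - r² ≤ 2 (q - r) q` then bounds its norm
    -- by that of the data.
    have h1 := hq.orth q (Or.inr ⟨rfl, hq.natDegree_le⟩)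
    have h2 : ∫ y in c..d, q.eval y ^ 2 ≤ R ^ 2 * (d - c) := by
      have e : ∫ y in c..d, (q.eval y ^ 2 - R ^ 2) ≤ 0 := by
        have : ∫ y in c..d, (q.eval y ^ 2 - R ^ 2)
            ≤ ∫ y in c..d, 2 * ((q.eval y - r y) * q.eval y) := by
          refine intervalIntegral.integral_mono_on hcd.le
            (hint _ ((hqc.pow 2).sub continuousOn_const))
            (hint _ (continuousOn_const.mul ((hqc.sub hr).mul hqc))) fun y hy => ?_
          have h3 := abs_le.1 (hR y hy)
          nlinarith [sq_nonneg (q.eval y - r y)]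
        rwa [intervalIntegral.integral_const_mul, h1, mul_zero] at this
      have hi : IntervalIntegrable (fun x => q.eval x ^ 2) volume c d := hint _ (hqc.pow 2)
      rw [intervalIntegral.integral_sub hi intervalIntegrable_const,
        intervalIntegral.integral_const, smul_eq_mul] at e
      linarith
    have h3 := sq_eval_mul_le hC hcd hq.natDegree_le hx
    have hC1 := hC.one_le
    have h4 : q.eval x ^ 2 ≤ 2 * C * R ^ 2 := by
      refine le_of_mul_le_mul_right (h3.trans ?_) hh
      calc 2 * C * ∫ y in c..d, q.eval y ^ 2 ≤ 2 * C * (R ^ 2 * (d - c)) := by gcongr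
        _ = _ := by ring
    have h5 : q.eval x ^ 2 ≤ (√(128 * C) * R) ^ 2 := by
      rw [mul_pow, Real.sq_sqrt (by linarith)]
      nlinarith [sq_nonneg R]
    have h6 := abs_le_of_sq_le_sq h5 (by positivity)
    refine h6.trans (mul_le_mul_of_nonneg_right ?_ hR0)
    have hn1 : (1 : ℝ) ≤ (⌈4 * C⌉₊ : ℝ) := by linarith [Nat.le_ceil (4 * C)]
    simp only [projConst]
    nlinarith [Real.sqrt_nonneg (128 * C)]

/-- Since polynomials are reproduced, stability applied to `w - p` turns any approximation of `w` by
polynomials into an estimate of the projection error. -/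
lemma IsProj.sub_polynomial {fl : Flux} {w : ℝ → ℝ} {q : ℝ[X]}
    (hq : IsProj fl k c d w q) {p : ℝ[X]} (hp : p.natDegree ≤ k) :
    IsProj fl k c d (fun x => w x - p.eval x) (q - p) where
  natDegree_le := (Polynomial.natDegree_sub_le _ _).trans (max_le hq.natDegree_le hp)
  orth s hs := by
    rw [← hq.orth s hs]
    refine intervalIntegral.integral_congr fun y _ => ?_
    simp only [Polynomial.eval_sub]; ring
  left h := by rw [Polynomial.eval_sub, hq.left h]
  right h := by rw [Polynomial.eval_sub, hq.right h]

/-- The projection error in the maximum norm. -/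
lemma IsProj.sq_sub_le (hC : AreInverseConstants k C C') (hcd : c < d) {fl : Flux} {w : ℝ → ℝ}
    (hw : ContDiff ℝ (k + 1) w) {q : ℝ[X]} (hq : IsProj fl k c d w q) {x : ℝ}
    (hx : x ∈ Set.Icc c d) :
    (q.eval x - w x) ^ 2 ≤ (1 + projConst C) ^ 2 * (d - c) ^ (2 * k + 1)
      * ∫ y in c..d, iteratedDeriv (k + 1) w y ^ 2 := by
  obtain ⟨p, hp, hb⟩ := exists_polynomial_approx k hcd w hw
  have hh : 0 < d - c := sub_pos.2 hcd
  have hI0 : 0 ≤ ∫ y in c..d, iteratedDeriv (k + 1) w y ^ 2 :=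
    intervalIntegral.integral_nonneg hcd.le fun x _ => sq_nonneg _
  have h1 := (hq.sub_polynomial hp).abs_eval_le hC hcd
    (hw.continuous.sub p.continuous).continuousOn hb hx
  have h2 := hb x hx
  set B := (d - c) ^ k * √((d - c) * ∫ y in c..d, iteratedDeriv (k + 1) w y ^ 2) with hB
  have h3 : |q.eval x - w x| ≤ (1 + projConst C) * B := by
    calc |q.eval x - w x| = |(q - p).eval x - (w x - p.eval x)| := by
          rw [Polynomial.eval_sub]; ring_nf
      _ ≤ |(q - p).eval x| + |w x - p.eval x| := abs_sub _ _
      _ ≤ (1 + projConst C) * B := by linarith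
  calc (q.eval x - w x) ^ 2 = |q.eval x - w x| ^ 2 := (sq_abs _).symm
    _ ≤ ((1 + projConst C) * B) ^ 2 := pow_le_pow_left₀ (abs_nonneg _) h3 2
    _ = _ := by
        rw [hB, mul_pow, mul_pow, Real.sq_sqrt (mul_nonneg hh.le hI0)]; ring

/-- The error of the `L²` projection, with one order less. -/
lemma IsProj.integral_sq_sub_le (hcd : c < d) {w : ℝ → ℝ}
    (hw : ContDiff ℝ k w) {q : ℝ[X]} (hq : IsProj .central k c d w q) :
    ∫ x in c..d, (q.eval x - w x) ^ 2
      ≤ (d - c) ^ (2 * k) * ∫ y in c..d, iteratedDeriv k w y ^ 2 := by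
  have hh : 0 < d - c := sub_pos.2 hcd
  -- Pythagoras: the `L²` projection is the best approximation, so no stability constant appears
  -- here.
  have hbest : ∀ p : ℝ[X], p.natDegree ≤ k →
      ∫ x in c..d, (q.eval x - w x) ^ 2 ≤ ∫ x in c..d, (w x - p.eval x) ^ 2 := by
    intro p hp
    have h1 := hq.orth (q - p) (Or.inr ⟨rfl, (Polynomial.natDegree_sub_le _ _).trans
      (max_le hq.natDegree_le hp)⟩)
    have hwc := hw.continuous
    have e : ∫ x in c..d, (w x - p.eval x) ^ 2 = ∫ x in c..d, (((q.eval x - w x) ^ 2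
        + ((q - p).eval x) ^ 2) - 2 * ((q.eval x - w x) * (q - p).eval x)) := by
      refine intervalIntegral.integral_congr fun y _ => ?_
      simp only [Polynomial.eval_sub]; ring
    rw [e, intervalIntegral.integral_sub (Continuous.intervalIntegrable (by fun_prop) _ _)
      (Continuous.intervalIntegrable (by fun_prop) _ _), intervalIntegral.integral_const_mul, h1,
      intervalIntegral.integral_add (Continuous.intervalIntegrable (by fun_prop) _ _)
      (Continuous.intervalIntegrable (by fun_prop) _ _)]
    have : 0 ≤ ∫ x in c..d, ((q - p).eval x) ^ 2 :=
      intervalIntegral.integral_nonneg hcd.le fun x _ => sq_nonneg _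
    linarith
  cases k with
  | zero =>
    refine (hbest 0 (by simp)).trans ?_
    simp
  | succ k =>
    obtain ⟨p, hp, hb⟩ := exists_polynomial_approx k hcd w (by exact_mod_cast hw)
    refine (hbest p (hp.trans (Nat.le_succ k))).trans ?_
    have hI0 : 0 ≤ ∫ y in c..d, iteratedDeriv (k + 1) w y ^ 2 :=
      intervalIntegral.integral_nonneg hcd.le fun x _ => sq_nonneg _
    have hwc := hw.continuous
    calc ∫ x in c..d, (w x - p.eval x) ^ 2
        ≤ ∫ x in c..d, ((d - c) ^ (2 * k + 1) * ∫ y in c..d, iteratedDeriv (k + 1) w y ^ 2) := by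
          refine intervalIntegral.integral_mono_on hcd.le
            (Continuous.intervalIntegrable (by fun_prop) _ _) intervalIntegrable_const
            fun x hx => ?_
          rw [← sq_abs]
          refine (pow_le_pow_left₀ (abs_nonneg _) (hb x hx) 2).trans_eq ?_
          rw [mul_pow, Real.sq_sqrt (mul_nonneg hh.le hI0)]; ring
      _ = _ := by rw [intervalIntegral.integral_const, smul_eq_mul]; ring

/-! ### Existence of the projections -/

/-- The degrees of freedom that determine the projection. -/
noncomputable def dof (fl : Flux) (k : ℕ) (c d : ℝ) (w : ℝ → ℝ) (j : Fin (k + 1)) : ℝ :=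
  if (j : ℕ) < k then ∫ x in c..d, w x * x ^ (j : ℕ) else
    match fl with
    | .leftRight => w c
    | .rightLeft => w d
    | .central => ∫ x in c..d, w x * x ^ k

lemma isProj_of_dof_eq {fl : Flux} (hcd : c < d) {w : ℝ → ℝ} (hw : ContinuousOn w (Set.Icc c d))
    {q : ℝ[X]} (hq : q.natDegree ≤ k) (h : dof fl k c d (fun x => q.eval x) = dof fl k c d w) :
    IsProj fl k c d w q := by
  have hint : ∀ f : ℝ → ℝ, ContinuousOn f (Set.Icc c d) → IntervalIntegrable f volume c d :=
    fun f hf => ContinuousOn.intervalIntegrable (by rwa [Set.uIcc_of_le hcd.le])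
  have hqc : ContinuousOn (fun x => q.eval x) (Set.Icc c d) := q.continuous.continuousOn
  have hmom : ∀ j : ℕ, (j < k ∨ (fl = .central ∧ j ≤ k)) →
      ∫ x in c..d, (q.eval x - w x) * x ^ j = 0 := by
    intro j hj
    have hj' : j < k + 1 := by omega
    have := congrFun h ⟨j, hj'⟩
    have e : ∫ x in c..d, q.eval x * x ^ j = ∫ x in c..d, w x * x ^ j := by
      by_cases hjk : j < k
      · simpa [dof, hjk] using this
      · obtain ⟨rfl, hle⟩ := hj.resolve_left hjk
        obtain rfl : j = k := by omega
        simpa [dof] using this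
    have hp : ContinuousOn (fun x : ℝ => x ^ j) (Set.Icc c d) := by fun_prop
    have hi1 : IntervalIntegrable (fun x => q.eval x * x ^ j) volume c d := hint _ (hqc.mul hp)
    have hi2 : IntervalIntegrable (fun x => w x * x ^ j) volume c d := hint _ (hw.mul hp)
    simp only [sub_mul]
    rw [intervalIntegral.integral_sub hi1 hi2, e, sub_self]
  refine ⟨hq, fun p hp => ?_, fun hfl => ?_, fun hfl => ?_⟩
  · have e : ∀ x, (q.eval x - w x) * p.eval x
        = ∑ j ∈ Finset.range (p.natDegree + 1), p.coeff j * ((q.eval x - w x) * x ^ j) := fun x => by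
      rw [Polynomial.eval_eq_sum_range (p := p), Finset.mul_sum]
      exact Finset.sum_congr rfl fun j _ => by ring
    simp only [e]
    have hi : ∀ j : ℕ, IntervalIntegrable (fun x => p.coeff j * ((q.eval x - w x) * x ^ j))
        volume c d := fun j =>
      hint _ (continuousOn_const.mul ((hqc.sub hw).mul (continuous_pow j).continuousOn))
    rw [intervalIntegral.integral_finsetSum fun j _ => hi j]
    refine Finset.sum_eq_zero fun j hj => ?_
    rw [intervalIntegral.integral_const_mul, hmom j, mul_zero]
    have := Finset.mem_range.1 hj
    rcases hp with hp | ⟨h1, h2⟩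
    · left; omega
    · right; exact ⟨h1, by omega⟩
  · subst hfl
    simpa [dof] using congrFun h (Fin.last k)
  · subst hfl
    simpa [dof] using congrFun h (Fin.last k)

/-- Unisolvence: there are as many degrees of freedom as coefficients, and stability with zero data
shows that the map between them is injective, hence bijective. The operator is stated as linear in
the degrees of freedom because this later gives square integrability in `v` of the coefficients. -/
lemma exists_projection (hC : AreInverseConstants k C C') (hcd : c < d) (fl : Flux) :
    ∃ P : (Fin (k + 1) → ℝ) →ₗ[ℝ] ℝ[X], ∀ w : ℝ → ℝ, ContinuousOn w (Set.Icc c d) →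
      IsProj fl k c d w (P (dof fl k c d w)) := by
  let ι : (Fin (k + 1) → ℝ) →ₗ[ℝ] ℝ[X] :=
    (Polynomial.degreeLT ℝ (k + 1)).subtype ∘ₗ
      (Polynomial.degreeLTEquiv ℝ (k + 1)).symm.toLinearMap
  have hι : ∀ y, (ι y).natDegree ≤ k := fun y => by
    have := ((Polynomial.degreeLTEquiv ℝ (k + 1)).symm y).2
    rw [Polynomial.mem_degreeLT, Polynomial.degree_lt_iff_coeff_zero] at this
    rw [Polynomial.natDegree_le_iff_coeff_eq_zero]
    exact fun n hn => this n hn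
  have hιinj : Function.Injective ι :=
    (Submodule.subtype_injective _).comp (LinearEquiv.injective _)
  have hint : ∀ (p : ℝ[X]) (j : ℕ), IntervalIntegrable (fun x => p.eval x * x ^ j) volume c d :=
    fun p j => (p.continuous.mul (continuous_pow j)).intervalIntegrable _ _
  let A : (Fin (k + 1) → ℝ) →ₗ[ℝ] (Fin (k + 1) → ℝ) :=
    { toFun := fun y => dof fl k c d fun x => (ι y).eval x
      map_add' := fun y z => by
        ext j
        simp only [dof, map_add, Polynomial.eval_add, Pi.add_apply, add_mul]
        rw [intervalIntegral.integral_add (hint _ _) (hint _ _),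
          intervalIntegral.integral_add (hint _ _) (hint _ _)]
        split_ifs
        · rfl
        · cases fl <;> rfl
      map_smul' := fun t y => by
        ext j
        simp only [dof, map_smul, Polynomial.eval_smul, Pi.smul_apply, smul_eq_mul, mul_assoc,
          RingHom.id_apply]
        rw [intervalIntegral.integral_const_mul, intervalIntegral.integral_const_mul]
        split_ifs
        · rfl
        · cases fl <;> rfl }
  have hA : Function.Injective A := by
    rw [← LinearMap.ker_eq_bot, LinearMap.ker_eq_bot']
    intro y hy
    have h0 : dof fl k c d (fun x => (ι y).eval x) = dof fl k c d fun _ => 0 := by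
      have : dof fl k c d (fun x => (ι y).eval x) = 0 := hy
      rw [this]; ext j; simp only [dof]
      split_ifs
      · simp
      · cases fl <;> simp
    have hp := isProj_of_dof_eq hcd continuousOn_const (hι y) h0
    have hz : ∀ x ∈ Set.Icc c d, (ι y).eval x = 0 := fun x hx => by
      have := hp.abs_eval_le hC hcd continuousOn_const (R := 0) (by simp) hx
      simpa using this
    have : ι y = 0 := Polynomial.eq_zero_of_infinite_isRoot _
      ((Set.Icc_infinite hcd).mono fun x hx => hz x hx)
    exact hιinj (by rw [this, map_zero])
  let E := LinearEquiv.ofInjectiveEndo A hA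
  refine ⟨ι ∘ₗ E.symm.toLinearMap, fun w hw => isProj_of_dof_eq hcd hw (hι _) ?_⟩
  exact E.apply_symm_apply (dof fl k c d w)

end element

/-! ### Projections onto `U_h^k` -/

/-- `∑ᵢ ∫_{Iᵢ} f ψ dx` for a function `f` and a piecewise polynomial `ψ`. -/
noncomputable def pint (a b : ℝ) {N : ℕ} (f : ℝ → ℝ) (ψ : PiecewisePoly N) : ℝ :=
  ∑ i : Fin N, ∫ x in (node a b N i)..(node a b N (i + 1)), f x * (ψ i).eval x

/-- `∫_a^b f² dx`. -/
noncomputable def sqInt (a b : ℝ) (f : ℝ → ℝ) : ℝ := ∫ x in a..b, f x ^ 2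

/-- `P` is the projection of `w` onto `U_h^k` that is adapted to the flux. -/
def IsProjection (fl : Flux) (a b : ℝ) {N : ℕ} (k : ℕ) (w : ℝ → ℝ) (P : PiecewisePoly N) : Prop :=
  ∀ i : Fin N, IsProj fl k (node a b N i) (node a b N (i + 1)) w (P i)

/-- The order of consistency of the flux. -/
noncomputable def Flux.rate (fl : Flux) (k : ℕ) (h : ℝ) : ℝ :=
  match fl with
  | .central => h ^ k
  | _ => h ^ (k + 1)

lemma Flux.rate_nonneg (fl : Flux) (k : ℕ) {h : ℝ} (hh : 0 ≤ h) : 0 ≤ fl.rate k h := by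
  cases fl <;> simp only [Flux.rate] <;> positivity

lemma Flux.rate_swap (fl : Flux) (k : ℕ) (h : ℝ) : fl.swap.rate k h = fl.rate k h := by
  cases fl <;> rfl

/-- The constant in the estimates of the projection error. -/
noncomputable def errConst (C : ℝ) : ℝ := 2 * C * (1 + projConst C)

lemma one_le_projConst (C : ℝ) : 1 ≤ projConst C := by
  have : 0 ≤ √(128 * C) * (⌈4 * C⌉₊ : ℝ) := by positivity
  simp only [projConst]; linarith

lemma sqInt_nonneg {a b : ℝ} (hab : a < b) (f : ℝ → ℝ) : 0 ≤ sqInt a b f :=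
  intervalIntegral.integral_nonneg hab.le fun x _ => sq_nonneg (f x)

section
variable {a b : ℝ} {N : ℕ} [NeZero N] {k : ℕ} {C C' : ℝ}

lemma IsL2Projection.isProjection {w : ℝ → ℝ} {P : PiecewisePoly N}
    (h : IsL2Projection a b k w P) : IsProjection .central a b k w P := fun i =>
  ⟨h.1 i, fun p hp => h.2 i p (hp.elim (fun h => h.le) fun h => h.2), by simp, by simp⟩

lemma IsProjection.inDG {fl : Flux} {w : ℝ → ℝ} {P : PiecewisePoly N}
    (h : IsProjection fl a b k w P) : InDG k P := fun i => (h i).natDegree_le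

lemma sum_integral_element (hab : a < b) {f : ℝ → ℝ} (hf : ContinuousOn f (Set.Icc a b)) :
    ∑ i : Fin N, ∫ x in (node a b N i)..(node a b N (i + 1)), f x = ∫ x in a..b, f x := by
  have h := intervalIntegral.sum_integral_adjacent_intervals (f := f) (μ := volume)
    (a := node a b N) (n := N) fun j hj => by
      refine ContinuousOn.intervalIntegrable ?_
      rw [Set.uIcc_of_le (node_lt_succ hab j).le]
      exact hf.mono (element_subset_Icc hab ⟨j, hj⟩)
  rw [node_zero, node_last] at h
  rw [← h, Finset.sum_range]

lemma sum_integral_sq (hab : a < b) {f : ℝ → ℝ} (hf : ContinuousOn f (Set.Icc a b)) :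
    ∑ i : Fin N, ∫ x in (node a b N i)..(node a b N (i + 1)), f x ^ 2 = sqInt a b f :=
  sum_integral_element hab (hf.pow 2)

/-- The right end of the preceding element is the same mesh point, except for the first element,
where the cyclic predecessor ends at `b` and periodicity is used. -/
lemma node_sub_one_add_one (w : ℝ → ℝ) (hw : w b = w a) (i : Fin N) :
    w (node a b N ((i - 1 : Fin N) + 1 : ℕ)) = w (node a b N i) := by
  by_cases hi : i = 0
  · subst hi
    have h : ((0 - 1 : Fin N) : ℕ) + 1 = N := by
      obtain ⟨n, rfl⟩ : ∃ n, N = n + 1 := ⟨N - 1, by have := NeZero.pos N; omega⟩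
      rw [zero_sub, Fin.coe_neg_one]
    rw [h, node_last, Fin.val_zero, node_zero, hw]
  · rw [Fin.val_sub_one_of_ne_zero hi]
    have : (i : ℕ) ≠ 0 := fun h => hi (Fin.ext h)
    congr 2; omega

lemma intervalIntegrable_mul_eval {f : ℝ → ℝ} (hab : a < b) (hf : ContinuousOn f (Set.Icc a b))
    (p : ℝ[X]) (i : Fin N) :
    IntervalIntegrable (fun x => f x * p.eval x) volume (node a b N i) (node a b N (i + 1)) := by
  refine ContinuousOn.intervalIntegrable ?_
  rw [Set.uIcc_of_le (node_lt_succ hab i).le]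
  exact (hf.mono (element_subset_Icc hab i)).mul p.continuous.continuousOn

lemma pint_sub {f g : ℝ → ℝ} (hab : a < b) (hf : ContinuousOn f (Set.Icc a b))
    (hg : ContinuousOn g (Set.Icc a b)) (ψ : PiecewisePoly N) :
    pint a b (fun x => f x - g x) ψ = pint a b f ψ - pint a b g ψ := by
  simp only [pint, ← Finset.sum_sub_distrib]
  refine Finset.sum_congr rfl fun i _ => ?_
  rw [← intervalIntegral.integral_sub (intervalIntegrable_mul_eval hab hf _ i)
    (intervalIntegrable_mul_eval hab hg _ i)]
  simp only [sub_mul]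

lemma pint_add {f g : ℝ → ℝ} (hab : a < b) (hf : ContinuousOn f (Set.Icc a b))
    (hg : ContinuousOn g (Set.Icc a b)) (ψ : PiecewisePoly N) :
    pint a b (fun x => f x + g x) ψ = pint a b f ψ + pint a b g ψ := by
  simp only [pint, ← Finset.sum_add_distrib]
  refine Finset.sum_congr rfl fun i _ => ?_
  rw [← intervalIntegral.integral_add (intervalIntegrable_mul_eval hab hf _ i)
    (intervalIntegrable_mul_eval hab hg _ i)]
  simp only [add_mul]

lemma pint_const_mul (c : ℝ) (f : ℝ → ℝ) (ψ : PiecewisePoly N) :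
    pint a b (fun x => c * f x) ψ = c * pint a b f ψ := by
  simp only [pint, Finset.mul_sum, ← intervalIntegral.integral_const_mul, mul_assoc]

/-- `ψ ↦ ∑ᵢ ∫_{Iᵢ} f ψ dx` as a linear map. -/
noncomputable def pintL (hab : a < b) {f : ℝ → ℝ} (hf : ContinuousOn f (Set.Icc a b)) :
    PiecewisePoly N →ₗ[ℝ] ℝ where
  toFun ψ := pint a b f ψ
  map_add' ψ χ := by
    simp only [pint, ← Finset.sum_add_distrib]
    refine Finset.sum_congr rfl fun i _ => ?_
    rw [← intervalIntegral.integral_add (intervalIntegrable_mul_eval hab hf _ i)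
      (intervalIntegrable_mul_eval hab hf _ i)]
    simp [mul_add]
  map_smul' c ψ := by
    simp [pint, Finset.mul_sum, ← intervalIntegral.integral_const_mul, mul_left_comm]

/-- The Cauchy–Schwarz inequality on all the elements. -/
lemma abs_sum_integral_le (hab : a < b) {f : Fin N → ℝ → ℝ}
    (hf : ∀ i, ContinuousOn (f i) (Set.Icc a b)) (ψ : PiecewisePoly N) :
    |∑ i : Fin N, ∫ x in (node a b N i)..(node a b N (i + 1)), f i x * (ψ i).eval x|
      ≤ √(∑ i : Fin N, ∫ x in (node a b N i)..(node a b N (i + 1)), f i x ^ 2) * nrm a b ψ := by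
  have h0 : ∀ i : Fin N, 0 ≤ ∫ x in (node a b N i)..(node a b N (i + 1)), f i x ^ 2 := fun i =>
    intervalIntegral.integral_nonneg (node_lt_succ hab i).le fun x _ => sq_nonneg _
  have h1 : ∀ i : Fin N, 0 ≤ ∫ x in (node a b N i)..(node a b N (i + 1)), (ψ i).eval x ^ 2 :=
    fun i => intervalIntegral.integral_nonneg (node_lt_succ hab i).le fun x _ => sq_nonneg _
  calc |∑ i : Fin N, ∫ x in (node a b N i)..(node a b N (i + 1)), f i x * (ψ i).eval x|
      ≤ ∑ i : Fin N, √(∫ x in (node a b N i)..(node a b N (i + 1)), f i x ^ 2)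
          * √(∫ x in (node a b N i)..(node a b N (i + 1)), (ψ i).eval x ^ 2) := by
        refine (Finset.abs_sum_le_sum_abs _ _).trans (Finset.sum_le_sum fun i _ => ?_)
        rw [← Real.sqrt_mul (h0 i)]
        exact Real.abs_le_sqrt (sq_integral_interval_le (node_lt_succ hab i).le
          ((hf i).mono (element_subset_Icc hab i)) (ψ i).continuous.continuousOn)
    _ ≤ _ := by
        refine (Real.sum_sqrt_mul_sqrt_le _ h0 h1).trans_eq ?_
        simp only [nrm, ip, sq]

lemma abs_pint_le (hab : a < b) {f : ℝ → ℝ} (hf : ContinuousOn f (Set.Icc a b))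
    (ψ : PiecewisePoly N) : |pint a b f ψ| ≤ √(sqInt a b f) * nrm a b ψ := by
  refine (abs_sum_integral_le hab (fun _ => hf) ψ).trans_eq ?_
  rw [sum_integral_sq hab hf]

/-! ### Consistency of the forms for smooth periodic functions. -/

lemma pint_pderiv (hab : a < b) {w w' : ℝ → ℝ} (hw : ∀ x, HasDerivAt w (w' x) x)
    (hw' : Continuous w') (hper : w b = w a) (ψ : PiecewisePoly N) :
    pint a b w (pderiv ψ) + pint a b w' ψ = -∑ i : Fin N, w (node a b N i) * jump a b ψ i := by
  have hwc : Continuous w := continuous_iff_continuousAt.2 fun x => (hw x).continuousAt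
  have h1 : pint a b w (pderiv ψ) + pint a b w' ψ
      = ∑ i : Fin N, (w (node a b N (i + 1)) * (ψ i).eval (node a b N (i + 1))
        - w (node a b N i) * (ψ i).eval (node a b N i)) := by
    simp only [pint, ← Finset.sum_add_distrib]
    refine Finset.sum_congr rfl fun i _ => ?_
    rw [← intervalIntegral.integral_add (intervalIntegrable_mul_eval hab hwc.continuousOn _ i)
      (intervalIntegrable_mul_eval hab hw'.continuousOn _ i),
      ← intervalIntegral.integral_deriv_mul_eq_sub (fun x _ => hw x)
      (fun x _ => (ψ i).hasDerivAt x) (hw'.intervalIntegrable _ _)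
      ((Polynomial.continuous _).intervalIntegrable _ _)]
    simp only [pderiv_apply]
    exact intervalIntegral.integral_congr fun x _ => by ring
  have h2 : ∑ i : Fin N, w (node a b N (i + 1)) * (ψ i).eval (node a b N (i + 1))
      = ∑ i : Fin N, w (node a b N i) * traceMinus a b ψ i := by
    rw [← sum_comp_sub_one]
    refine Finset.sum_congr rfl fun i _ => ?_
    rw [node_sub_one_add_one w hper i]; rfl
  rw [h1, Finset.sum_sub_distrib, h2, ← Finset.sum_sub_distrib, ← Finset.sum_neg_distrib]
  refine Finset.sum_congr rfl fun i _ => ?_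
  simp only [jump, tracePlus]; ring

/-- The derivative of a test function has degree below `k` (or is zero), and against such
polynomials every one of the projections is orthogonal. -/
lemma pint_pderiv_eq_ip (hab : a < b) {fl : Flux} {w : ℝ → ℝ} (hw : Continuous w)
    {P : PiecewisePoly N} (hP : IsProjection fl a b k w P) {ψ : PiecewisePoly N}
    (hψ : InDG k ψ) : ip a b P (pderiv ψ) = pint a b w (pderiv ψ) := by
  simp only [ip, pint]
  refine Finset.sum_congr rfl fun i _ => ?_
  rw [← sub_eq_zero, ← intervalIntegral.integral_sub (intervalIntegrable_eval_mul _ _ _ _)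
    (intervalIntegrable_mul_eval hab hw.continuousOn _ i)]
  simp only [← sub_mul]
  by_cases h0 : (ψ i).natDegree = 0
  · simp [Polynomial.derivative_of_natDegree_zero h0]
  · refine (hP i).orth _ (Or.inl ?_)
    exact (Polynomial.natDegree_derivative_lt h0).trans_le (hψ i)

/-- The consistency error of `d_h`. -/
lemma dForm_add_pint (hab : a < b) {fl' : Flux} (fl : Flux) {w w' : ℝ → ℝ}
    (hw : ∀ x, HasDerivAt w (w' x) x) (hw' : Continuous w') (hper : w b = w a)
    {P : PiecewisePoly N} (hP : IsProjection fl' a b k w P) {ψ : PiecewisePoly N}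
    (hψ : InDG k ψ) :
    dForm fl a b P ψ + pint a b w' ψ
      = ∑ i, (fl.hatRho (traceMinus a b P i) (tracePlus a b P i) - w (node a b N i))
          * jump a b ψ i := by
  have hwc : Continuous w := continuous_iff_continuousAt.2 fun x => (hw x).continuousAt
  have h1 := pint_pderiv hab hw hw' hper ψ
  -- The volume terms agree, so only trace errors survive. The flux of the form need not be the one
  -- of the projection; the upwind form exploits this.
  rw [← pint_pderiv_eq_ip hab hwc hP hψ] at h1
  simp only [dForm, ipDeriv_eq, sub_mul, Finset.sum_sub_distrib]
  linarith

/-- The Gauss–Radau projection interpolates at the end point from which the alternating flux takes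
its trace. -/
lemma IsProjection.hatRho_eq {fl : Flux} (hfl : fl ≠ .central) {w : ℝ → ℝ} (hper : w b = w a)
    {P : PiecewisePoly N} (hP : IsProjection fl a b k w P) (i : Fin N) :
    fl.hatRho (traceMinus a b P i) (tracePlus a b P i) = w (node a b N i) := by
  cases fl
  · exact (hP i).left rfl
  · exact ((hP (i - 1)).right rfl).trans (node_sub_one_add_one w hper i)
  · exact absurd rfl hfl

/-! ### Estimates of the projection error -/

lemma IsProjection.sum_tracePlus_sub_sq_le (hab : a < b) (hC : AreInverseConstants k C C')
    {fl : Flux} {w : ℝ → ℝ} (hw : ContDiff ℝ (k + 1) w) {P : PiecewisePoly N}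
    (hP : IsProjection fl a b k w P) :
    ∑ i, (tracePlus a b P i - w (node a b N i)) ^ 2
      ≤ (1 + projConst C) ^ 2 * meshSize a b N ^ (2 * k + 1)
        * sqInt a b (iteratedDeriv (k + 1) w) := by
  have hc : Continuous (iteratedDeriv (k + 1) w) :=
    hw.continuous_iteratedDeriv (k + 1) (by exact_mod_cast le_rfl)
  rw [← sum_integral_sq (N := N) hab hc.continuousOn, Finset.mul_sum]
  refine Finset.sum_le_sum fun i _ => ?_
  have := (hP i).sq_sub_le hC (node_lt_succ hab i) hw (Set.left_mem_Icc.2 (node_lt_succ hab i).le)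
  rwa [node_succ, add_sub_cancel_left, ← node_succ] at this

lemma IsProjection.sum_traceMinus_sub_sq_le (hab : a < b) (hC : AreInverseConstants k C C')
    {fl : Flux} {w : ℝ → ℝ} (hw : ContDiff ℝ (k + 1) w) (hper : w b = w a) {P : PiecewisePoly N}
    (hP : IsProjection fl a b k w P) :
    ∑ i, (traceMinus a b P i - w (node a b N i)) ^ 2
      ≤ (1 + projConst C) ^ 2 * meshSize a b N ^ (2 * k + 1)
        * sqInt a b (iteratedDeriv (k + 1) w) := by
  have hc : Continuous (iteratedDeriv (k + 1) w) :=
    hw.continuous_iteratedDeriv (k + 1) (by exact_mod_cast le_rfl)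
  have h : ∑ i, (traceMinus a b P i - w (node a b N i)) ^ 2
      = ∑ i : Fin N, ((P i).eval (node a b N (i + 1)) - w (node a b N (i + 1))) ^ 2 := by
    refine (Finset.sum_congr rfl fun i _ => ?_).trans (sum_comp_sub_one fun i : Fin N =>
      ((P i).eval (node a b N (i + 1)) - w (node a b N (i + 1))) ^ 2)
    rw [node_sub_one_add_one w hper i]; rfl
  rw [h, ← sum_integral_sq (N := N) hab hc.continuousOn, Finset.mul_sum]
  refine Finset.sum_le_sum fun i _ => ?_
  have := (hP i).sq_sub_le hC (node_lt_succ hab i) hw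
    (Set.right_mem_Icc.2 (node_lt_succ hab i).le)
  rwa [node_succ, add_sub_cancel_left, ← node_succ] at this

/-- `‖P - w‖²`. -/
noncomputable def distSq (a b : ℝ) (P : PiecewisePoly N) (w : ℝ → ℝ) : ℝ :=
  ∑ i : Fin N, ∫ x in (node a b N i)..(node a b N (i + 1)), ((P i).eval x - w x) ^ 2

lemma IsProjection.distSq_le (hab : a < b) (hC : AreInverseConstants k C C')
    {fl : Flux} {w : ℝ → ℝ} (hw : ContDiff ℝ (k + 1) w) {P : PiecewisePoly N}
    (hP : IsProjection fl a b k w P) :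
    distSq a b P w ≤ (1 + projConst C) ^ 2 * meshSize a b N ^ (2 * (k + 1))
        * sqInt a b (iteratedDeriv (k + 1) w) := by
  have hc : Continuous (iteratedDeriv (k + 1) w) :=
    hw.continuous_iteratedDeriv (k + 1) (by exact_mod_cast le_rfl)
  have hwc := hw.continuous
  rw [distSq, ← sum_integral_sq (N := N) hab hc.continuousOn, Finset.mul_sum]
  refine Finset.sum_le_sum fun i _ => ?_
  have hlt := node_lt_succ (N := N) hab i
  have hd : node a b N (i + 1) - node a b N i = meshSize a b N := by
    rw [node_succ, add_sub_cancel_left]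
  calc ∫ x in (node a b N i)..(node a b N (i + 1)), ((P i).eval x - w x) ^ 2
      ≤ ∫ x in (node a b N i)..(node a b N (i + 1)), ((1 + projConst C) ^ 2
          * meshSize a b N ^ (2 * k + 1)
          * ∫ y in (node a b N i)..(node a b N (i + 1)), iteratedDeriv (k + 1) w y ^ 2) := by
        refine intervalIntegral.integral_mono_on hlt.le
          (Continuous.intervalIntegrable (by fun_prop) _ _) intervalIntegrable_const fun x hx => ?_
        rw [← hd]
        exact (hP i).sq_sub_le hC hlt hw hx
    _ = _ := by rw [intervalIntegral.integral_const, smul_eq_mul, hd]; ring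

lemma IsProjection.distSq_le_of_central (hab : a < b) {w : ℝ → ℝ} (hw : ContDiff ℝ k w)
    {P : PiecewisePoly N} (hP : IsProjection .central a b k w P) :
    distSq a b P w ≤ meshSize a b N ^ (2 * k) * sqInt a b (iteratedDeriv k w) := by
  have hc : Continuous (iteratedDeriv k w) := hw.continuous_iteratedDeriv k le_rfl
  rw [distSq, ← sum_integral_sq (N := N) hab hc.continuousOn, Finset.mul_sum]
  refine Finset.sum_le_sum fun i _ => ?_
  have := (hP i).integral_sq_sub_le (node_lt_succ hab i) hw
  rwa [node_succ, add_sub_cancel_left, ← node_succ] at this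

/-- The mesh size may exceed one, so `h^(k+1)` is not bounded by the central rate `h^k`. For the
central flux the estimate with one derivative less is used instead. -/
lemma IsProjection.distSq_le_rate (hab : a < b) (hC : AreInverseConstants k C C')
    {fl : Flux} {w : ℝ → ℝ} (hw : ContDiff ℝ (k + 1) w) {P : PiecewisePoly N}
    (hP : IsProjection fl a b k w P) :
    distSq a b P w ≤ (1 + projConst C) ^ 2 * fl.rate k (meshSize a b N) ^ 2
        * (sqInt a b (iteratedDeriv k w) + sqInt a b (iteratedDeriv (k + 1) w)) := by
  have h0 := sqInt_nonneg hab (iteratedDeriv k w)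
  have h1 := sqInt_nonneg hab (iteratedDeriv (k + 1) w)
  have hh := (meshSize_pos (N := N) hab).le
  have hK := one_le_projConst C
  by_cases hfl : fl = .central
  · subst hfl
    refine (hP.distSq_le_of_central hab (hw.of_le (by exact_mod_cast Nat.le_succ k))).trans ?_
    simp only [Flux.rate, ← pow_mul, mul_comm k 2]
    refine mul_le_mul ?_ (by linarith) h0 (by positivity)
    exact le_mul_of_one_le_left (by positivity) (one_le_pow₀ (by linarith))
  · refine (hP.distSq_le hab hC hw).trans ?_
    have : fl.rate k (meshSize a b N) = meshSize a b N ^ (k + 1) := by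
      cases fl <;> first | rfl | exact absurd rfl hfl
    rw [this, ← pow_mul, mul_comm (k + 1) 2]
    refine mul_le_mul_of_nonneg_left (by linarith) (by positivity)

lemma pint_sub_ip (hab : a < b) {w : ℝ → ℝ} (hw : Continuous w) (P ψ : PiecewisePoly N) :
    ip a b P ψ - pint a b w ψ = ∑ i : Fin N, ∫ x in (node a b N i)..(node a b N (i + 1)),
      ((P i).eval x - w x) * (ψ i).eval x := by
  simp only [ip, pint, ← Finset.sum_sub_distrib]
  refine Finset.sum_congr rfl fun i _ => ?_
  rw [← intervalIntegral.integral_sub (intervalIntegrable_eval_mul _ _ _ _)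
    (intervalIntegrable_mul_eval hab hw.continuousOn _ i)]
  simp only [sub_mul]

lemma abs_ip_sub_pint_le (hab : a < b) {w : ℝ → ℝ} (hw : Continuous w) (P ψ : PiecewisePoly N) :
    |ip a b P ψ - pint a b w ψ| ≤ √(distSq a b P w) * nrm a b ψ := by
  rw [pint_sub_ip hab hw]
  exact abs_sum_integral_le (f := fun i x => (P i).eval x - w x) hab
    (fun i => ((P i).continuous.sub hw).continuousOn) ψ

lemma errConst_ge (hC : AreInverseConstants k C C') : 1 + projConst C ≤ errConst C := by
  have := hC.one_le
  have := one_le_projConst C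
  simp only [errConst]; nlinarith

lemma errConst_nonneg (hC : AreInverseConstants k C C') : 0 ≤ errConst C := by
  linarith [errConst_ge hC, one_le_projConst C]

lemma IsProjection.abs_ip_sub_pint_le (hab : a < b) (hC : AreInverseConstants k C C')
    {fl : Flux} {w : ℝ → ℝ} (hw : ContDiff ℝ (k + 1) w) {P : PiecewisePoly N}
    (hP : IsProjection fl a b k w P) (ψ : PiecewisePoly N) :
    |ip a b P ψ - pint a b w ψ| ≤ errConst C * meshSize a b N ^ (k + 1)
      * √(sqInt a b (iteratedDeriv (k + 1) w)) * nrm a b ψ := by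
  have hh := (meshSize_pos (N := N) hab).le
  have hK := one_le_projConst C
  refine (DGIMEX.abs_ip_sub_pint_le hab hw.continuous P ψ).trans
    (mul_le_mul_of_nonneg_right ?_ (nrm_nonneg ψ))
  calc √(distSq a b P w) ≤ √(((1 + projConst C) * meshSize a b N ^ (k + 1)) ^ 2
        * sqInt a b (iteratedDeriv (k + 1) w)) :=
        Real.sqrt_le_sqrt ((hP.distSq_le hab hC hw).trans_eq (by ring))
    _ = (1 + projConst C) * meshSize a b N ^ (k + 1)
        * √(sqInt a b (iteratedDeriv (k + 1) w)) := by
        rw [Real.sqrt_mul (sq_nonneg _), Real.sqrt_sq (by positivity)]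
    _ ≤ _ := by gcongr; exact errConst_ge hC

/-- For the central flux the left-hand side vanishes by orthogonality, so `h^(k+1)` need not be
compared with `h^k`. -/
lemma IsProjection.abs_ip_sub_pint_le_rate (hab : a < b) (hC : AreInverseConstants k C C')
    {fl : Flux} {w : ℝ → ℝ} (hw : ContDiff ℝ (k + 1) w) {P : PiecewisePoly N}
    (hP : IsProjection fl a b k w P) {ψ : PiecewisePoly N} (hψ : InDG k ψ) :
    |ip a b P ψ - pint a b w ψ| ≤ errConst C * fl.rate k (meshSize a b N)
      * √(sqInt a b (iteratedDeriv (k + 1) w)) * nrm a b ψ := by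
  by_cases hfl : fl = .central
  · subst hfl
    have h0 : ip a b P ψ - pint a b w ψ = 0 := by
      rw [pint_sub_ip hab hw.continuous]
      exact Finset.sum_eq_zero fun i _ => (hP i).orth _ (Or.inr ⟨rfl, hψ i⟩)
    rw [h0, abs_zero]
    have := errConst_nonneg hC
    have := Flux.rate_nonneg .central k (meshSize_pos (N := N) hab).le
    have := nrm_nonneg (a := a) (b := b) ψ
    positivity
  · have : fl.rate k (meshSize a b N) = meshSize a b N ^ (k + 1) := by
      cases fl <;> first | rfl | exact absurd rfl hfl
    rw [this]
    exact hP.abs_ip_sub_pint_le hab hC hw ψ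

/-- The jump terms of a consistency error with traces `e`. -/
lemma abs_sum_mul_jump_le (hab : a < b) (hC : AreInverseConstants k C C') {e : Fin N → ℝ} {X : ℝ}
    (he : ∑ i, e i ^ 2 ≤ (1 + projConst C) ^ 2 * meshSize a b N ^ (2 * k + 1) * X)
    {ψ : PiecewisePoly N} (hψ : InDG k ψ) :
    |∑ i, e i * jump a b ψ i| ≤ errConst C * meshSize a b N ^ k * √X * nrm a b ψ := by
  have hh := meshSize_pos (N := N) hab
  have hK := one_le_projConst C
  have hC1 := hC.one_le
  refine (abs_sum_mul_le Finset.univ e (jump a b ψ)).trans ?_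
  -- The traces are of order `h^(k + 1/2)`; bounding the jumps by the norm costs `h^(-1/2)` and
  -- leaves `h^k`.
  calc √(∑ i, e i ^ 2) * √(jumpSq a b ψ)
      ≤ √((1 + projConst C) ^ 2 * meshSize a b N ^ (2 * k + 1) * X)
        * √(4 * C / meshSize a b N * ip a b ψ ψ) := by
        gcongr
        exact jumpSq_le hab hC hψ
    _ = √((1 + projConst C) ^ 2 * meshSize a b N ^ (2 * k + 1)) * √X
        * (√(4 * C / meshSize a b N) * nrm a b ψ) := by
        rw [Real.sqrt_mul (by positivity) X, Real.sqrt_mul (by positivity) (ip a b ψ ψ), nrm]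
    _ = √((1 + projConst C) ^ 2 * meshSize a b N ^ (2 * k + 1) * (4 * C / meshSize a b N)) * √X
        * nrm a b ψ := by
        rw [Real.sqrt_mul (by positivity) (4 * C / meshSize a b N)]; ring
    _ ≤ √((errConst C * meshSize a b N ^ k) ^ 2) * √X * nrm a b ψ := by
        have := nrm_nonneg (a := a) (b := b) ψ
        gcongr
        calc (1 + projConst C) ^ 2 * meshSize a b N ^ (2 * k + 1) * (4 * C / meshSize a b N)
            = C * (4 * (1 + projConst C) ^ 2 * meshSize a b N ^ (2 * k)) := by
              field_simp; ring
          _ ≤ (C * C) * (4 * (1 + projConst C) ^ 2 * meshSize a b N ^ (2 * k)) := by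
              gcongr; nlinarith
          _ = _ := by simp only [errConst]; ring
    _ = _ := by
        have := errConst_nonneg hC
        rw [Real.sqrt_sq (by positivity)]

lemma IsProjection.sum_hatRho_sub_sq_le (hab : a < b) (hC : AreInverseConstants k C C')
    {fl' : Flux} (fl : Flux) {w : ℝ → ℝ} (hw : ContDiff ℝ (k + 1) w) (hper : w b = w a)
    {P : PiecewisePoly N} (hP : IsProjection fl' a b k w P) :
    ∑ i, (fl.hatRho (traceMinus a b P i) (tracePlus a b P i) - w (node a b N i)) ^ 2
      ≤ (1 + projConst C) ^ 2 * meshSize a b N ^ (2 * k + 1)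
        * sqInt a b (iteratedDeriv (k + 1) w) := by
  have h := sum_hat_sq_le fl _ _ (hP.sum_traceMinus_sub_sq_le hab hC hw hper)
    (hP.sum_tracePlus_sub_sq_le hab hC hw)
  refine (Finset.sum_congr rfl fun i _ => ?_).trans_le h
  congr 1
  cases fl <;> simp only [Flux.hatRho]
  ring

/-- The consistency error of `d_h` at the adapted projection. -/
lemma IsProjection.abs_dForm_add_pint_le (hab : a < b) (hC : AreInverseConstants k C C')
    {fl : Flux} {w : ℝ → ℝ} (hw : ContDiff ℝ (k + 1) w) (hper : w b = w a)
    {P : PiecewisePoly N} (hP : IsProjection fl a b k w P) {ψ : PiecewisePoly N}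
    (hψ : InDG k ψ) :
    |dForm fl a b P ψ + pint a b (deriv w) ψ| ≤ errConst C * fl.rate k (meshSize a b N)
      * √(sqInt a b (iteratedDeriv (k + 1) w)) * nrm a b ψ := by
  have hw1 : ContDiff ℝ 1 w := hw.of_le (by exact_mod_cast Nat.le_add_left 1 k)
  rw [dForm_add_pint hab fl (fun x => (hw1.differentiable one_ne_zero x).hasDerivAt)
    (hw1.continuous_deriv le_rfl) hper hP hψ]
  by_cases hfl : fl = .central
  · subst hfl
    exact abs_sum_mul_jump_le hab hC (hP.sum_hatRho_sub_sq_le hab hC _ hw hper) hψ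
  · rw [Finset.sum_eq_zero fun i _ => by rw [hP.hatRho_eq hfl hper, sub_self, zero_mul], abs_zero]
    have := errConst_nonneg hC
    have := Flux.rate_nonneg fl k (meshSize_pos (N := N) hab).le
    have := nrm_nonneg (a := a) (b := b) ψ
    positivity

/-- The consistency error of the upwind form. -/
lemma IsProjection.abs_upwindForm_sub_le (hab : a < b) (hC : AreInverseConstants k C C')
    {fl : Flux} {w : ℝ → ℝ} (hw : ContDiff ℝ (k + 1) w) (hper : w b = w a)
    {P : PiecewisePoly N} (hP : IsProjection fl a b k w P) {ψ : PiecewisePoly N}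
    (hψ : InDG k ψ) {v : ℝ} (hv : |v| ≤ 1) :
    |upwindForm a b v P ψ - v * pint a b (deriv w) ψ|
      ≤ errConst C * √(meshSize a b N ^ (2 * k + 1))
      * √(sqInt a b (iteratedDeriv (k + 1) w)) * √(|v| * jumpSq a b ψ) := by
  have hw1 : ContDiff ℝ 1 w := hw.of_le (by exact_mod_cast Nat.le_add_left 1 k)
  have hh := meshSize_pos (N := N) hab
  have hK := one_le_projConst C
  -- Both alternating traces are needed, one for each sign of `v`, while the projection stays fixed.
  -- The jumps are kept here, which saves half an order.
  have key : ∀ fl' : Flux, |dForm fl' a b P ψ + pint a b (deriv w) ψ|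
      ≤ errConst C * √(meshSize a b N ^ (2 * k + 1))
      * √(sqInt a b (iteratedDeriv (k + 1) w)) * √(jumpSq a b ψ) := by
    intro fl'
    rw [dForm_add_pint hab fl' (fun x => (hw1.differentiable one_ne_zero x).hasDerivAt)
      (hw1.continuous_deriv le_rfl) hper hP hψ]
    refine (abs_sum_mul_le Finset.univ _ (jump a b ψ)).trans
      (mul_le_mul_of_nonneg_right ?_ (Real.sqrt_nonneg _))
    refine (Real.sqrt_le_sqrt (hP.sum_hatRho_sub_sq_le hab hC fl' hw hper)).trans ?_
    rw [Real.sqrt_mul (by positivity), Real.sqrt_mul (by positivity), Real.sqrt_sq (by linarith)]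
    gcongr
    exact errConst_ge hC
  -- One factor `√|v|` is given away; the other stays with the jumps, so that the bound matches the
  -- upwind dissipation.
  have hv2 : |v| * √(jumpSq a b ψ) ≤ √(|v| * jumpSq a b ψ) := by
    rw [Real.sqrt_mul (abs_nonneg v)]
    refine mul_le_mul_of_nonneg_right ?_ (Real.sqrt_nonneg _)
    refine Real.le_sqrt_of_sq_le ?_
    nlinarith [abs_nonneg v]
  have hfin : ∀ fl', |v| * |dForm fl' a b P ψ + pint a b (deriv w) ψ|
      ≤ errConst C * √(meshSize a b N ^ (2 * k + 1))
      * √(sqInt a b (iteratedDeriv (k + 1) w)) * √(|v| * jumpSq a b ψ) := fun fl' => by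
    have := errConst_nonneg hC
    calc |v| * |dForm fl' a b P ψ + pint a b (deriv w) ψ|
        ≤ |v| * (errConst C * √(meshSize a b N ^ (2 * k + 1))
          * √(sqInt a b (iteratedDeriv (k + 1) w)) * √(jumpSq a b ψ)) :=
          mul_le_mul_of_nonneg_left (key fl') (abs_nonneg v)
      _ = errConst C * √(meshSize a b N ^ (2 * k + 1))
          * √(sqInt a b (iteratedDeriv (k + 1) w)) * (|v| * √(jumpSq a b ψ)) := by ring
      _ ≤ _ := by gcongr
  rw [upwindForm_eq]
  rcases le_total 0 v with h | h
  · rw [max_eq_left h, min_eq_right h]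
    refine le_trans (le_of_eq ?_) (hfin .rightLeft)
    rw [← abs_mul, ← abs_neg]; congr 1; ring
  · rw [max_eq_right h, min_eq_left h]
    refine le_trans (le_of_eq ?_) (hfin .leftRight)
    rw [← abs_mul, ← abs_neg]; congr 1; ring

/-- Two projections of the same function. -/
lemma nrm_sub_le (hab : a < b) {w : ℝ → ℝ} (hw : Continuous w) (P Q : PiecewisePoly N) :
    nrm a b (P - Q) ≤ √(distSq a b P w) + √(distSq a b Q w) := by
  have h1 := abs_ip_sub_pint_le hab hw P (P - Q)
  have h2 := abs_ip_sub_pint_le hab hw Q (P - Q)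
  have h3 : nrm a b (P - Q) * nrm a b (P - Q)
      ≤ (√(distSq a b P w) + √(distSq a b Q w)) * nrm a b (P - Q) := by
    have e : ip a b (P - Q) (P - Q) = ip a b P (P - Q) - ip a b Q (P - Q) := by
      simpa only [ipL_apply] using LinearMap.map_sub₂ (ipL a b) P Q (P - Q)
    rw [← sq, nrm_sq hab, e]
    linarith [(abs_le.1 h1).2, (abs_le.1 h2).1]
  rcases (nrm_nonneg (a := a) (b := b) (P - Q)).eq_or_lt with h | h
  · rw [← h]; positivity
  · exact le_of_mul_le_mul_right h3 h

end

/-! ### The energy estimate -/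

/-- `⟨‖Z‖²⟩`. -/
noncomputable def energyG (m : Model) (a b : ℝ) {N : ℕ} (Z : ℝ → PiecewisePoly N) : ℝ :=
  ∫ v, ip a b (Z v) (Z v) ∂m.measure

/-- `⟨|v| ∑ᵢ [Z]ᵢ²⟩`. -/
noncomputable def energyJ (m : Model) (a b : ℝ) {N : ℕ} [NeZero N] (Z : ℝ → PiecewisePoly N) : ℝ :=
  ∫ v, |v| * jumpSq a b (Z v) ∂m.measure

/-- The constant of the inverse inequality for derivatives, set to `0` for piecewise constants. -/
noncomputable def derivConst (k : ℕ) (C' : ℝ) : ℝ := if k = 0 then 0 else C'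

/-- `(x + y)² ≤ κ (x² + y²)`, where `x = 0` if `k = 0`. -/
noncomputable def sumConst (k : ℕ) : ℝ := if k = 0 then 1 else 2

section
variable {m : Model} {a b : ℝ} {N : ℕ} [NeZero N] {k : ℕ} {C C' : ℝ}

lemma L2DG.integrable_ip {Y Z : ℝ → PiecewisePoly N} (hY : L2DG m k Y) (hZ : L2DG m k Z) :
    Integrable (fun v => ip a b (Y v) (Z v)) m.measure :=
  hY.integrable_bilin hZ (ipL a b)

lemma L2DG.integrable_jumpSq {Z : ℝ → PiecewisePoly N} (hZ : L2DG m k Z) :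
    Integrable (fun v => |v| * jumpSq a b (Z v)) m.measure := by
  simpa only [jumpBilin_self] using hZ.integrable_mul_bilin hZ (jumpBilin a b)
    (f := fun v => |v|) (by fun_prop) fun v hv => by rwa [abs_abs]

lemma L2DG.integrable_upwindForm {Y Z : ℝ → PiecewisePoly N} (hY : L2DG m k Y)
    (hZ : L2DG m k Z) : Integrable (fun v => upwindForm a b v (Y v) (Z v)) m.measure := by
  have h1 := hY.integrable_mul_bilin hZ (dL a b .rightLeft) (f := fun v => max v 0)
    (by fun_prop) fun v hv => by
      rw [abs_of_nonneg (le_max_right _ _)]; exact max_le ((abs_le.1 hv).2) zero_le_one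
  have h2 := hY.integrable_mul_bilin hZ (dL a b .leftRight) (f := fun v => min v 0)
    (by fun_prop) fun v hv => by
      rw [abs_of_nonpos (min_le_right _ _), neg_le]
      exact le_min ((abs_le.1 hv).1) (by norm_num)
  simp only [dL_apply] at h1 h2
  simp only [upwindForm_eq]
  exact (h1.add h2).neg

lemma energyG_nonneg (hab : a < b) (Z : ℝ → PiecewisePoly N) : 0 ≤ energyG m a b Z :=
  integral_nonneg fun v => ip_self_nonneg hab (Z v)

lemma energyJ_nonneg (Z : ℝ → PiecewisePoly N) : 0 ≤ energyJ m a b Z :=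
  integral_nonneg fun v => mul_nonneg (abs_nonneg v) (jumpSq_nonneg a b (Z v))

lemma memLp_id : MemLp (fun v : ℝ => v) 2 m.measure :=
  memLp_of_abs_le_one measurable_id fun _ h => h

/-! ### Bounds of the averaged flux `⟨vZ⟩` by the two damping terms. -/

lemma ip_avg_self_le (hab : a < b) {Z : ℝ → PiecewisePoly N} (hZ : L2DG m k Z) :
    ip a b (avg m k (fun v => v) Z) (avg m k (fun v => v) Z)
      ≤ (∫ v, v ^ 2 ∂m.measure) * energyG m a b Z := by
  set q := avg m k (fun v => v) Z with hq
  have h1 : ip a b q q = ∫ v, v * ip a b (Z v) q ∂m.measure :=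
    (hZ.integral_map memLp_id ((ipL a b).flip q)).symm
  have hL : MemLp (fun v => ip a b (Z v) q) 2 m.measure := hZ.memLp_map ((ipL a b).flip q)
  have h2 := sq_integral_mul_le (memLp_id (m := m)) hL
  rw [← h1] at h2
  have h3 : ∫ v, ip a b (Z v) q ^ 2 ∂m.measure ≤ energyG m a b Z * ip a b q q := by
    rw [energyG, ← integral_mul_const]
    exact integral_mono hL.integrable_sq ((hZ.integrable_ip hZ).mul_const _) fun v =>
      ip_sq_le hab _ _
  have h4 := m.integral_sq_nonneg
  rcases (ip_self_nonneg hab q).eq_or_lt with h0 | h0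
  · rw [← h0]; exact mul_nonneg h4 (energyG_nonneg hab Z)
  · refine le_of_mul_le_mul_right ?_ h0
    calc ip a b q q * ip a b q q = ip a b q q ^ 2 := (sq _).symm
      _ ≤ _ := h2
      _ ≤ (∫ v, v ^ 2 ∂m.measure) * (energyG m a b Z * ip a b q q) := by gcongr
      _ = _ := by ring

/-- Cauchy–Schwarz for the factors `√|v|` and `(v / √|v|) f`. The weight `|v|` stays with `f²`, so
that the jumps of `⟨vZ⟩` are controlled by the upwind dissipation; the other factor is the `⟨|v|⟩`
in `α₂`. -/
lemma sq_integral_id_mul_le {f : ℝ → ℝ} (hf : MemLp f 2 m.measure) :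
    (∫ v, v * f v ∂m.measure) ^ 2
      ≤ (∫ v, |v| ∂m.measure) * ∫ v, |v| * f v ^ 2 ∂m.measure := by
  have e1 : ∀ v : ℝ, √|v| * (v / √|v| * f v) = v * f v := fun v => by
    rcases eq_or_ne v 0 with rfl | hv
    · simp
    · have : √|v| ≠ 0 := (Real.sqrt_pos.2 (abs_pos.2 hv)).ne'
      field_simp
  have e2 : ∀ v : ℝ, (v / √|v| * f v) ^ 2 = |v| * f v ^ 2 := fun v => by
    rcases eq_or_ne v 0 with rfl | hv
    · simp
    · have : |v| ≠ 0 := abs_ne_zero.2 hv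
      rw [mul_pow, div_pow, Real.sq_sqrt (abs_nonneg v), ← sq_abs v]
      field_simp
  have h1 : MemLp (fun v : ℝ => √|v|) 2 m.measure :=
    memLp_of_abs_le_one (by fun_prop) fun v hv => by
      rw [abs_of_nonneg (Real.sqrt_nonneg _)]; exact Real.sqrt_le_one.2 hv
  have hm : Measurable fun v : ℝ => v / √|v| := by fun_prop
  have h2 : MemLp (fun v : ℝ => v / √|v| * f v) 2 m.measure := by
    refine (memLp_two_iff_integrable_sq (hm.aestronglyMeasurable.mul hf.1)).2 ?_
    simp only [Pi.mul_apply, e2]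
    exact hf.integrable_sq.bdd_mul (c := 1) (by fun_prop : Measurable fun v : ℝ =>
      |v|).aestronglyMeasurable (m.ae_abs_le_one.mono fun v hv => by simpa using hv)
  have := sq_integral_mul_le h1 h2
  simpa only [e1, e2, Real.sq_sqrt (abs_nonneg _)] using this

lemma jumpSq_avg_le {Z : ℝ → PiecewisePoly N} (hZ : L2DG m k Z) :
    jumpSq a b (avg m k (fun v => v) Z) ≤ (∫ v, |v| ∂m.measure) * energyJ m a b Z := by
  have hL : ∀ i, MemLp (fun v => jump a b (Z v) i) 2 m.measure := fun i =>
    hZ.memLp_map (jumpL a b i)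
  have hi : ∀ i, Integrable (fun v => |v| * jump a b (Z v) i ^ 2) m.measure := fun i =>
    (hL i).integrable_sq.bdd_mul (c := 1) (by fun_prop : Measurable fun v : ℝ =>
      |v|).aestronglyMeasurable (m.ae_abs_le_one.mono fun v hv => by simpa using hv)
  simp only [energyJ, jumpSq, Finset.mul_sum]
  rw [integral_finsetSum _ fun i _ => hi i, Finset.mul_sum]
  refine Finset.sum_le_sum fun i _ => ?_
  have h1 : jump a b (avg m k (fun v => v) Z) i = ∫ v, v * jump a b (Z v) i ∂m.measure :=
    (hZ.integral_map memLp_id (jumpL a b i)).symm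
  rw [h1]
  exact sq_integral_id_mul_le (hL i)

lemma energyJ_le (hab : a < b) (hC : AreInverseConstants k C C') {Z : ℝ → PiecewisePoly N}
    (hZ : L2DG m k Z) : energyJ m a b Z ≤ 4 * C / meshSize a b N * energyG m a b Z := by
  rw [energyJ, energyG, ← integral_const_mul]
  refine integral_mono_ae hZ.integrable_jumpSq ((hZ.integrable_ip hZ).const_mul _) ?_
  filter_upwards [hZ.inDG, m.ae_abs_le_one] with v h1 h2
  calc |v| * jumpSq a b (Z v) ≤ 1 * jumpSq a b (Z v) :=
        mul_le_mul_of_nonneg_right h2 (jumpSq_nonneg a b _)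
    _ ≤ _ := by rw [one_mul]; exact jumpSq_le hab hC h1

lemma ip_pderiv_self_le' (hab : a < b) (hC : AreInverseConstants k C C') {u : PiecewisePoly N}
    (hu : InDG k u) :
    ip a b (pderiv u) (pderiv u) ≤ derivConst k C' / meshSize a b N ^ 2 * ip a b u u := by
  by_cases hk : k = 0
  · subst hk
    rw [pderiv_eq_zero hu]
    simp [ip, derivConst]
  · simpa [derivConst, hk] using ip_pderiv_self_le hab hC hu

lemma derivConst_nonneg (hC : AreInverseConstants k C C') : 0 ≤ derivConst k C' := by
  by_cases hk : k = 0
  · simp [derivConst, hk]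
  · simpa [derivConst, hk] using (hC.pos hk).le

/-- The square of the factor in the estimates of the forms. -/
lemma sq_factor_le (hab : a < b) (hC : AreInverseConstants k C C') {u : PiecewisePoly N}
    (hu : InDG k u) :
    (nrm a b (pderiv u) + √(C / meshSize a b N) * √(jumpSq a b u)) ^ 2
      ≤ sumConst k * (derivConst k C' / meshSize a b N ^ 2 * ip a b u u
        + C / meshSize a b N * jumpSq a b u) := by
  have hh := meshSize_pos (N := N) hab
  have hC0 : 0 ≤ C / meshSize a b N := div_nonneg (zero_le_one.trans hC.one_le) hh.le
  have h1 : nrm a b (pderiv u) ^ 2 ≤ derivConst k C' / meshSize a b N ^ 2 * ip a b u u := by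
    rw [nrm_sq hab]; exact ip_pderiv_self_le' hab hC hu
  have h2 : (√(C / meshSize a b N) * √(jumpSq a b u)) ^ 2
      = C / meshSize a b N * jumpSq a b u := by
    rw [mul_pow, Real.sq_sqrt hC0, Real.sq_sqrt (jumpSq_nonneg a b u)]
  by_cases hk : k = 0
  · have h0 : nrm a b (pderiv u) = 0 := by
      have : nrm a b (pderiv u) ^ 2 ≤ 0 := by simpa [derivConst, hk] using h1
      exact pow_eq_zero_iff two_ne_zero |>.1 (le_antisymm this (sq_nonneg _))
    rw [h0, zero_add, h2]
    simp [sumConst, derivConst, hk]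
  · simp only [sumConst, hk, if_false]
    nlinarith [sq_nonneg (nrm a b (pderiv u) - √(C / meshSize a b N) * √(jumpSq a b u))]

lemma sumConst_pos (k : ℕ) : 0 < sumConst k := by
  unfold sumConst; split_ifs <;> norm_num

lemma sq_factor_avg_le (hab : a < b) (hC : AreInverseConstants k C C')
    {Z : ℝ → PiecewisePoly N} (hZ : L2DG m k Z) :
    (nrm a b (pderiv (avg m k (fun v => v) Z))
        + √(C / meshSize a b N) * √(jumpSq a b (avg m k (fun v => v) Z))) ^ 2
      ≤ sumConst k * (derivConst k C' / meshSize a b N ^ 2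
          * ((∫ v, v ^ 2 ∂m.measure) * energyG m a b Z)
        + C / meshSize a b N * ((∫ v, |v| ∂m.measure) * energyJ m a b Z)) := by
  have hh := meshSize_pos (N := N) hab
  have hC0 : 0 ≤ C / meshSize a b N := div_nonneg (zero_le_one.trans hC.one_le) hh.le
  have hC1 := derivConst_nonneg hC
  have := sumConst_pos k
  refine (sq_factor_le hab hC (avg_inDG _ _ _ _)).trans ?_
  have h1 := ip_avg_self_le hab hZ
  have h2 := jumpSq_avg_le (a := a) (b := b) hZ
  gcongr

/-- The part of the energy balance that comes from the equation for `g`. -/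
lemma energy_lower_bound (hab : a < b) (hC : AreInverseConstants k C C') {ε τ : ℝ}
    {Y Z : ℝ → PiecewisePoly N} (hY : L2DG m k Y) (hZ : L2DG m k Z) :
    ε ^ 2 / 2 * (energyG m a b Z - energyG m a b Y) + τ * ε / 2 * energyJ m a b Z
        - τ ^ 2 / 2 * (sumConst k * (derivConst k C' / meshSize a b N ^ 2 * energyG m a b Z
          + C / meshSize a b N * energyJ m a b Z))
      ≤ ε ^ 2 * ∫ v, ip a b (Z v - Y v) (Z v) ∂m.measure
        + τ * ε * ∫ v, upwindForm a b v (Y v) (Z v) ∂m.measure := by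
  have hh := meshSize_pos (N := N) hab
  have hC0 : 0 ≤ C / meshSize a b N := div_nonneg (zero_le_one.trans hC.one_le) hh.le
  have hC1 := derivConst_nonneg hC
  have hκ := sumConst_pos k
  have iZ : Integrable (fun v => ip a b (Z v) (Z v)) m.measure := hZ.integrable_ip hZ
  have iY : Integrable (fun v => ip a b (Y v) (Y v)) m.measure := hY.integrable_ip hY
  have iJ : Integrable (fun v => |v| * jumpSq a b (Z v)) m.measure := hZ.integrable_jumpSq
  have iD : Integrable (fun v => ip a b (Z v - Y v) (Z v)) m.measure :=
    (hZ.sub hY).integrable_ip hZ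
  have iU : Integrable (fun v => upwindForm a b v (Y v) (Z v)) m.measure :=
    hY.integrable_upwindForm hZ
  set dh := derivConst k C' / meshSize a b N ^ 2 with hdh
  set ch := C / meshSize a b N with hch
  have i1 : Integrable (fun v => (ε ^ 2 / 2 - τ ^ 2 / 2 * (sumConst k * dh)) * ip a b (Z v) (Z v)
      - ε ^ 2 / 2 * ip a b (Y v) (Y v)) m.measure := (iZ.const_mul _).sub (iY.const_mul _)
  have i2 : Integrable (fun v => (τ * ε / 2 - τ ^ 2 / 2 * (sumConst k * ch))
      * (|v| * jumpSq a b (Z v))) m.measure := iJ.const_mul _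
  have i3 : Integrable (fun v => ε ^ 2 * ip a b (Z v - Y v) (Z v)) m.measure := iD.const_mul _
  have i4 : Integrable (fun v => τ * ε * upwindForm a b v (Y v) (Z v)) m.measure :=
    iU.const_mul _
  have key := integral_mono_ae (i1.add i2) (i3.add i4) ?_
  · rw [integral_add' i1 i2, integral_add' i3 i4, integral_sub (iZ.const_mul _) (iY.const_mul _)] at key
    simp only [integral_const_mul] at key
    simp only [energyG, energyJ]
    linarith
  filter_upwards [hZ.inDG, hY.inDG, m.ae_abs_le_one] with v hz hy hv
  set w := Y v - Z v with hw
  have hwDG : InDG k w := hy.sub hz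
  -- The transport term takes the old `Y`. Splitting off the new `Z` produces the dissipation; the
  -- rest is linear in `Y - Z` and is paid for by the square of the increment in `e2`.
  have e1 : upwindForm a b v (Y v) (Z v)
      = upwindForm a b v w (Z v) + |v| * jumpSq a b (Z v) / 2 := by
    rw [← upwindForm_self, ← upwindL_apply, ← upwindL_apply, ← upwindL_apply, hw,
      LinearMap.map_sub₂]
    ring
  have e2 : ip a b (Z v - Y v) (Z v)
      = (ip a b (Z v) (Z v) - ip a b (Y v) (Y v) + ip a b w w) / 2 := by
    have h := ip_comm a b (Y v) (Z v)
    simp only [← ipL_apply, hw, map_sub, LinearMap.sub_apply] at h ⊢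
    linarith
  have h1 := (abs_le.1 (abs_upwindForm_le hab hC v hwDG (Z v))).1
  have h2 := sq_factor_le hab hC hz
  have h3 := nrm_sq hab w
  set x := nrm a b (pderiv (Z v)) + √(C / meshSize a b N) * √(jumpSq a b (Z v)) with hx
  have hJ := jumpSq_nonneg a b (Z v)
  have hG := ip_self_nonneg hab (Z v)
  -- As `|v| ≤ 1`, the weight `|v|²` is replaced by `1` on the norm but only by `|v|` on the jumps,
  -- to match the dissipation.
  have h4 : (|v| * x) ^ 2 ≤ sumConst k * (derivConst k C' / meshSize a b N ^ 2
      * ip a b (Z v) (Z v) + C / meshSize a b N * (|v| * jumpSq a b (Z v))) := by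
    have hv2 : |v| ^ 2 ≤ |v| := by nlinarith [abs_nonneg v]
    have hv3 : |v| ^ 2 ≤ 1 := hv2.trans hv
    calc (|v| * x) ^ 2 = |v| ^ 2 * x ^ 2 := by ring
      _ ≤ |v| ^ 2 * (sumConst k * (derivConst k C' / meshSize a b N ^ 2
          * ip a b (Z v) (Z v) + C / meshSize a b N * jumpSq a b (Z v))) := by gcongr
      _ = sumConst k * (|v| ^ 2 * (derivConst k C' / meshSize a b N ^ 2
          * ip a b (Z v) (Z v)) + C / meshSize a b N * (|v| ^ 2 * jumpSq a b (Z v))) := by ring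
      _ ≤ sumConst k * (1 * (derivConst k C' / meshSize a b N ^ 2
          * ip a b (Z v) (Z v)) + C / meshSize a b N * (|v| * jumpSq a b (Z v))) := by gcongr
      _ = _ := by rw [one_mul]
  have h5 := mul_nonneg (sq_nonneg τ) (sub_nonneg.2 h4)
  -- Completing the square in the norm of the increment; the sign of `τ ε` is not assumed.
  rcases le_total 0 (τ * ε) with hte | hte
  · simp only [Pi.add_apply, e1, e2, ← h3]
    linarith [sq_nonneg (ε * nrm a b w - τ * (|v| * x)), mul_le_mul_of_nonneg_left h1 hte]
  · have h1' := (abs_le.1 (abs_upwindForm_le hab hC v hwDG (Z v))).2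
    simp only [Pi.add_apply, e1, e2, ← h3]
    linarith [sq_nonneg (ε * nrm a b w + τ * (|v| * x)), mul_le_mul_of_nonpos_left h1' hte]

/-- The time step restriction absorbs the terms of the wrong sign. -/
lemma stability_condition (hC : AreInverseConstants k C C') {ε τ σ h G J : ℝ} (hh : 0 < h)
    (hε : 0 < ε) (hσ : 0 < σ) (hτ : τ ≤ σ * dtStab m k C C' ε h) (hJ : 0 ≤ J)
    (hJG : J ≤ 4 * C / h * G) :
    τ / 2 * (sumConst k * (derivConst k C' / h ^ 2 * ((1 + ∫ v, v ^ 2 ∂m.measure) * G)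
      + C / h * ((1 + ∫ v, |v| ∂m.measure) * J))) ≤ σ * (G + ε / 2 * J) := by
  have hC1 := hC.one_le
  have hv1 := m.integral_sq_nonneg
  have hv2 := m.integral_abs_nonneg
  set V2 := ∫ v, v ^ 2 ∂m.measure
  set V1 := ∫ v, |v| ∂m.measure
  have ha2 : alpha2 m C = 2 * (1 + V1) * C := by rw [alpha2, m.vSup_eq]
  have ha3 : alpha3 m C = 2 * C := by rw [alpha3, m.vSup_eq]; ring
  have ha1 : alpha1 m C' = (1 + V2) * C' := by rw [alpha1, m.vSup_eq]; ring
  have hJG' : J * h ≤ 4 * C * G := by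
    rw [div_mul_eq_mul_div, le_div_iff₀ hh] at hJG; exact hJG
  by_cases hk : k = 0
  · simp only [sumConst, derivConst, dtStab, hk, if_true, ha2, ha3] at hτ ⊢
    have hp : 0 < (1 + V1) * C := by positivity
    -- For `k = 0` only the jumps are to be absorbed: the part with `h` goes to `G` through `J h ≤ 4
    -- C G`, the part with `ε` to the dissipation.
    have h1 : τ * ((1 + V1) * C) ≤ σ * (h / (2 * C) * (h + 2 * C * ε)) := by
      calc τ * ((1 + V1) * C) ≤ σ * (2 * h / (2 * (1 + V1) * C * (2 * C)) * (h + 2 * C * ε))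
            * ((1 + V1) * C) := by gcongr
        _ = _ := by field_simp
    calc τ / 2 * (1 * (0 / h ^ 2 * ((1 + V2) * G) + C / h * ((1 + V1) * J)))
        = τ * ((1 + V1) * C) * (J / (2 * h)) := by field_simp; ring
      _ ≤ σ * (h / (2 * C) * (h + 2 * C * ε)) * (J / (2 * h)) := by gcongr
      _ = σ * (J * h / (4 * C) + ε / 2 * J) := by field_simp; ring
      _ ≤ σ * (G + ε / 2 * J) := by
          gcongr
          rw [div_le_iff₀ (by positivity)]; linarith
  · have hC' := hC.pos hk
    simp only [sumConst, derivConst, dtStab, hk, if_false] at hτ ⊢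
    set α1 := alpha1 m C'
    set α2 := alpha2 m C
    set α3 := alpha3 m C
    have p1 : 0 < α1 := by rw [ha1]; positivity
    have p2 : 0 < α2 := by rw [ha2]; positivity
    have p3 : 0 < α3 := by rw [ha3]; positivity
    -- The two arguments of the minimum in the step bound give two consequences: `α₂ h / α₁` bounds
    -- `τ α₁`, and `ε` bounds `τ (α₁ + α₂ α₃)`.
    have b1 : τ * α1 ≤ σ * h ^ 2 := by
      calc τ * α1 ≤ σ * (h / (α1 + α2 * α3) * (h + min ε (α2 * h / α1) * α3)) * α1 := by gcongr
        _ ≤ σ * (h / (α1 + α2 * α3) * (h + (α2 * h / α1) * α3)) * α1 := by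
            gcongr; exact min_le_right _ _
        _ = σ * h ^ 2 := by field_simp
    have b2 : τ * (α1 + α2 * α3) ≤ σ * (h * (h + ε * α3)) := by
      calc τ * (α1 + α2 * α3)
          ≤ σ * (h / (α1 + α2 * α3) * (h + min ε (α2 * h / α1) * α3)) * (α1 + α2 * α3) := by
            gcongr
        _ ≤ σ * (h / (α1 + α2 * α3) * (h + ε * α3)) * (α1 + α2 * α3) := by
            gcongr; exact min_le_left _ _
        _ = _ := by field_simp
    have e : τ / 2 * (2 * (C' / h ^ 2 * ((1 + V2) * G) + C / h * ((1 + V1) * J)))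
        = (τ * α1 * G + τ * α2 * (J * h) / 2) / h ^ 2 := by
      rw [ha1, ha2]; field_simp
    rw [e, div_le_iff₀ (by positivity)]
    have hJ3 : J * h ≤ 2 * α3 * G := by rw [ha3]; linarith
    -- With the nonnegative multipliers `2 α₃ G - J h` and `J h`, the sum of the two bounds is
    -- exactly the claim multiplied by `2 α₃ h²`.
    have f1 := mul_le_mul_of_nonneg_right b1 (sub_nonneg.2 hJ3)
    have f2 := mul_le_mul_of_nonneg_right b2 (mul_nonneg hJ hh.le)
    have key : 2 * α3 * (τ * α1 * G + τ * α2 * (J * h) / 2)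
        ≤ 2 * α3 * (σ * (G + ε / 2 * J) * h ^ 2) := by nlinarith
    exact le_of_mul_le_mul_left key (by positivity)

/-! ### One step of the energy balance. -/

lemma le_of_sub_le_mul {τ E₀ E₁ Q : ℝ} (hτ0 : 0 ≤ τ) (hτ1 : τ ≤ 1 / 2) (hE : 0 ≤ E₀) (hQ : 0 ≤ Q)
    (h : E₁ - E₀ ≤ τ * (E₁ + E₀ + Q)) : E₁ ≤ (1 + 4 * τ) * E₀ + 2 * τ * Q := by
  -- The slacks `2 - 4 τ` and `1 - 2 τ` left after division by `1 - τ` are where `τ ≤ 1/2` enters.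
  have h1 := mul_nonneg hE (mul_nonneg hτ0 (by linarith : 0 ≤ 2 - 4 * τ))
  have h2 := mul_nonneg hQ (mul_nonneg hτ0 (by linarith : 0 ≤ 1 - 2 * τ))
  have h3 : (1 - τ) * E₁ ≤ (1 - τ) * ((1 + 4 * τ) * E₀ + 2 * τ * Q) := by linarith
  exact le_of_mul_le_mul_left h3 (by linarith)

/-- Scalar core of `energy_step`. In the sum of twice `hA` and twice `hB` the coupling `F` cancels.
The square of the increment is split with weight `1 + (1 - σ)/2` on `A²`, small enough that this
weight times `σ` is at most `(1 + σ)/2`. The damping left over, `(1 - σ)/2` times `G + (ε/2) J`, is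
exactly what the right-hand side of `hB` consumes; the other weight, `3 / (1 - σ)` on `R²`, is the
price. -/
lemma energy_algebra {τ ε σ R S A G J GY U F x₀ n₀ dξ dd : ℝ} (hτ0 : 0 < τ) (hτ1 : τ < 1 / 2)
    (hσ0 : 0 < σ) (hσ1 : σ < 1) (hS : 0 ≤ S) (hGY : 0 ≤ GY) (hx₀ : 0 ≤ x₀)
    (hx₁ : 0 ≤ x₀ + 2 * dξ + dd) (hn : n₀ ^ 2 = x₀) (hU : 0 ≤ U)
    (hUA : U + τ / 2 * A ^ 2 ≤ σ * (G + ε / 2 * J)) (hDD : dd ≤ (τ * A + τ * R) ^ 2)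
    (hA : dξ + τ * F ≤ τ * R * n₀)
    (hB : ε ^ 2 / 2 * (G - GY) + τ * (ε / 2 * J) - τ * U - τ * F + τ * G
      ≤ τ * (ε ^ 2 / 2 * G + (1 - σ) / 2 * G + (1 - σ) / 4 * (ε * J) + S))
    (hW : 0 ≤ G + ε / 2 * J) :
    x₀ + 2 * dξ + dd + ε ^ 2 * G ≤ (1 + 4 * τ) * (x₀ + ε ^ 2 * GY)
      + 2 * τ * (R ^ 2 + 3 * τ * R ^ 2 / (1 - σ) + 2 * S) := by
  have hσ' : 0 < 1 - σ := by linarith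
  have h1 : (A + R) ^ 2 ≤ (1 + (1 - σ) / 2) * A ^ 2 + 3 / (1 - σ) * R ^ 2 := by
    have h2 : (1 - σ) / 2 * A ^ 2 + 2 / (1 - σ) * R ^ 2 - 2 * A * R
        = ((1 - σ) * A - 2 * R) ^ 2 / (2 * (1 - σ)) := by field_simp; ring
    have h3 : 0 ≤ ((1 - σ) * A - 2 * R) ^ 2 / (2 * (1 - σ)) := by positivity
    have h4 : 1 ≤ 1 / (1 - σ) := by rw [le_div_iff₀ hσ']; linarith
    have h5 : 3 / (1 - σ) = 2 / (1 - σ) + 1 / (1 - σ) := by ring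
    have h6 := mul_le_mul_of_nonneg_right h4 (sq_nonneg R)
    rw [h5]
    linarith
  have hdd : dd ≤ τ * (τ * ((1 + (1 - σ) / 2) * A ^ 2)) + τ * (τ * (3 / (1 - σ) * R ^ 2)) := by
    have := mul_le_mul_of_nonneg_left h1 (sq_nonneg τ)
    linarith
  have hUAW : U + (1 + (1 - σ) / 2) * (τ / 2 * A ^ 2) ≤ (1 + σ) / 2 * (G + ε / 2 * J) := by
    have h1 : (1 + (1 - σ) / 2) * (U + τ / 2 * A ^ 2)
        ≤ (1 + (1 - σ) / 2) * (σ * (G + ε / 2 * J)) :=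
      mul_le_mul_of_nonneg_left hUA (by linarith)
    have h2 : 0 ≤ (1 - σ) / 2 * U := by positivity
    have h3 : 0 ≤ (1 - σ) / 2 * ((1 - σ) * (G + ε / 2 * J)) := by positivity
    linarith
  have hRn : 2 * (R * n₀) ≤ R ^ 2 + x₀ := by
    rw [← hn]; linarith [sq_nonneg (R - n₀)]
  have h4 := mul_le_mul_of_nonneg_left hUAW (by positivity : 0 ≤ 2 * τ)
  have h5 := mul_le_mul_of_nonneg_left hRn hτ0.le
  have hY0 : 0 ≤ ε ^ 2 * GY := mul_nonneg (sq_nonneg _) hGY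
  have hX : 3 * τ * R ^ 2 / (1 - σ) = τ * (3 / (1 - σ) * R ^ 2) := by ring
  have hX0 : 0 ≤ 3 / (1 - σ) * R ^ 2 := by positivity
  rw [hX]
  generalize 3 / (1 - σ) * R ^ 2 = X at hdd hX0 ⊢
  refine le_of_sub_le_mul hτ0.le hτ1.le (by positivity) (by positivity) ?_
  have h6 : x₀ + 2 * dξ + dd + ε ^ 2 * G - (x₀ + ε ^ 2 * GY)
      ≤ τ * (ε ^ 2 * G + x₀ + (R ^ 2 + τ * X + 2 * S)) := by linarith
  refine h6.trans (mul_le_mul_of_nonneg_left ?_ hτ0.le)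
  linarith

/-- One step of the energy estimate. -/
theorem energy_step (hab : a < b) (hC : AreInverseConstants k C C') (fl : Flux) {ε τ σ R S : ℝ}
    (hε : 0 < ε) (hτ0 : 0 < τ) (hτ1 : τ < 1 / 2) (hσ0 : 0 < σ) (hσ1 : σ < 1)
    (hτ : τ ≤ σ * dtStab m k C C' ε (meshSize a b N)) (hR : 0 ≤ R) (hS : 0 ≤ S)
    {ξ₀ ξ₁ : PiecewisePoly N} {Y Z : ℝ → PiecewisePoly N} (hξ₀ : InDG k ξ₀) (hξ₁ : InDG k ξ₁)
    (hY : L2DG m k Y) (hZ : L2DG m k Z)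
    (hA : ∀ φ : PiecewisePoly N, InDG k φ →
      |ip a b (ξ₁ - ξ₀) φ - τ * dForm fl.swap a b (avg m k (fun v => v) Z) φ|
        ≤ τ * R * nrm a b φ)
    (hB : ε ^ 2 * ∫ v, ip a b (Z v - Y v) (Z v) ∂m.measure
        + τ * ε * ∫ v, upwindForm a b v (Y v) (Z v) ∂m.measure
        - τ * dForm fl a b ξ₀ (avg m k (fun v => v) Z) + τ * energyG m a b Z
      ≤ τ * (ε ^ 2 / 2 * energyG m a b Z + (1 - σ) / 2 * energyG m a b Z
        + (1 - σ) / 4 * (ε * energyJ m a b Z) + S)) :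
    ip a b ξ₁ ξ₁ + ε ^ 2 * energyG m a b Z
      ≤ (1 + 4 * τ) * (ip a b ξ₀ ξ₀ + ε ^ 2 * energyG m a b Y)
        + 2 * τ * (R ^ 2 + 3 * τ * R ^ 2 / (1 - σ) + 2 * S) := by
  have hh := meshSize_pos (N := N) hab
  set q := avg m k (fun v => v) Z with hq
  set D := ξ₁ - ξ₀ with hD
  have hDDG : InDG k D := hξ₁.sub hξ₀
  have hG0 := energyG_nonneg (m := m) hab Z
  have hJ0 := energyJ_nonneg (m := m) (a := a) (b := b) Z
  have hA2 := sq_factor_avg_le hab hC hZ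
  rw [← hq] at hA2
  have hA0 : 0 ≤ nrm a b (pderiv q) + √(C / meshSize a b N) * √(jumpSq a b q) :=
    add_nonneg (nrm_nonneg _) (by positivity)
  have hfac : ∀ u : PiecewisePoly N, InDG k u → |dForm fl a b u q| ≤ nrm a b u *
      (nrm a b (pderiv q) + √(C / meshSize a b N) * √(jumpSq a b q)) := fun u hu =>
    abs_dForm_le hab hC fl hu q
  generalize nrm a b (pderiv q) + √(C / meshSize a b N) * √(jumpSq a b q) = A at hA2 hA0 hfac
  -- The equation for `ρ` tested with the increment itself, after `d_h` has been shifted onto the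
  -- averaged flux by skewness.
  have hDnrm : nrm a b D ≤ τ * A + τ * R := by
    have h1 := (abs_le.1 (hA D hDDG)).2
    have h2 : dForm fl.swap a b q D ≤ nrm a b D * A := by
      rw [dForm_swap]
      have := (abs_le.1 (hfac D hDDG)).1
      linarith
    have h3 : nrm a b D * nrm a b D ≤ (τ * A + τ * R) * nrm a b D := by
      rw [← sq, nrm_sq hab]
      nlinarith
    rcases (nrm_nonneg (a := a) (b := b) D).eq_or_lt with h | h
    · rw [← h]; positivity
    · exact le_of_mul_le_mul_right h3 h
  have hDD : ip a b D D ≤ (τ * A + τ * R) ^ 2 := by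
    rw [← nrm_sq hab]; exact pow_le_pow_left₀ (nrm_nonneg _) hDnrm 2
  have hlow := energy_lower_bound (ε := ε) (τ := τ) hab hC hY hZ
  have hstab := stability_condition (m := m) hC hh hε hσ0 hτ hJ0 (energyJ_le hab hC hZ)
  have hAξ := (abs_le.1 (hA ξ₀ hξ₀)).2
  rw [dForm_swap] at hAξ
  have hexp : ip a b ξ₁ ξ₁ = ip a b ξ₀ ξ₀ + 2 * ip a b D ξ₀ + ip a b D D := by
    have h := ip_comm a b ξ₀ ξ₁
    simp only [← ipL_apply, hD, map_sub, LinearMap.sub_apply] at h ⊢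
    linarith
  have hκ := sumConst_pos k
  have hd0 : 0 ≤ derivConst k C' / meshSize a b N ^ 2 :=
    div_nonneg (derivConst_nonneg hC) (by positivity)
  have hc0 : 0 ≤ C / meshSize a b N := div_nonneg (zero_le_one.trans hC.one_le) hh.le
  have hUA := mul_le_mul_of_nonneg_left hA2 (by linarith : 0 ≤ τ / 2)
  have h1 : 0 ≤ ip a b ξ₁ ξ₁ := ip_self_nonneg hab ξ₁
  rw [hexp] at h1 ⊢
  refine energy_algebra (U := τ / 2 * (sumConst k * (derivConst k C' / meshSize a b N ^ 2
    * energyG m a b Z + C / meshSize a b N * energyJ m a b Z)))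
    hτ0 hτ1 hσ0 hσ1 hS (energyG_nonneg hab Y) (ip_self_nonneg hab ξ₀) h1
    (nrm_sq hab ξ₀) (mul_nonneg (by linarith) (mul_nonneg hκ.le (add_nonneg
      (mul_nonneg hd0 hG0) (mul_nonneg hc0 hJ0)))) ?_ hDD (by linarith) ?_ (by positivity)
      (F := dForm fl a b ξ₀ q) (J := energyJ m a b Z)
  · linarith
  · linarith

/-- A discrete Gronwall inequality. -/
lemma discrete_gronwall {E : ℕ → ℝ} {τ Q : ℝ} (hτ : 0 ≤ τ) (hQ : 0 ≤ Q) (hE : 0 ≤ E 0)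
    {n : ℕ} (h : ∀ j < n, E (j + 1) ≤ (1 + 4 * τ) * E j + 2 * τ * Q) :
    E n ≤ Real.exp (4 * (n * τ)) * (E 0 + 2 * (n * τ) * Q) := by
  have key : ∀ j ≤ n, E j ≤ (1 + 4 * τ) ^ j * (E 0 + 2 * (j * τ) * Q) := by
    intro j
    induction j with
    | zero => intro _; simp
    | succ j ih =>
      intro hj
      have h1 := ih (by omega)
      have h2 := h j (by omega)
      have h3 : 1 ≤ (1 + 4 * τ) ^ (j + 1) := one_le_pow₀ (by linarith)
      calc E (j + 1) ≤ (1 + 4 * τ) * E j + 2 * τ * Q := h2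
        _ ≤ (1 + 4 * τ) * ((1 + 4 * τ) ^ j * (E 0 + 2 * (j * τ) * Q))
            + (1 + 4 * τ) ^ (j + 1) * (2 * τ * Q) := by
            have := le_mul_of_one_le_left (by positivity : 0 ≤ 2 * τ * Q) h3
            gcongr
        _ = _ := by push_cast; ring
  have h1 : (1 + 4 * τ) ^ n ≤ Real.exp (4 * (n * τ)) := by
    calc (1 + 4 * τ) ^ n ≤ Real.exp (4 * τ) ^ n :=
          pow_le_pow_left₀ (by linarith) (by linarith [Real.add_one_le_exp (4 * τ)]) n
      _ = Real.exp (4 * (n * τ)) := by rw [← Real.exp_nat_mul]; ring_nf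
  refine (key n le_rfl).trans (mul_le_mul_of_nonneg_right h1 ?_)
  positivity

end

/-! ### Norms as integrals -/

lemma l2Norm_sq (a b : ℝ) (w : ℝ → ℝ) :
    l2Norm a b w ^ 2 = ∫⁻ x in Set.Icc a b, ENNReal.ofReal (w x ^ 2) := by
  rw [l2Norm, eLpNorm_eq_lintegral_rpow_enorm_toReal two_ne_zero ENNReal.ofNat_ne_top,
    ← ENNReal.rpow_natCast, ← ENNReal.rpow_mul]
  simp only [ENNReal.toReal_ofNat, Nat.cast_ofNat, one_div, isUnit_iff_ne_zero, ne_eq,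
    OfNat.ofNat_ne_zero, not_false_eq_true, IsUnit.inv_mul_cancel, ENNReal.rpow_one]
  refine lintegral_congr fun x => ?_
  rw [← sq_abs, ENNReal.ofReal_pow (abs_nonneg _), ← Real.enorm_eq_ofReal_abs,
    ← ENNReal.rpow_natCast]
  norm_num

lemma lintegral_Icc_eq_ofReal {a b : ℝ} (hab : a ≤ b) {f : ℝ → ℝ}
    (hf : ContinuousOn f (Set.Icc a b)) (hf0 : ∀ x, 0 ≤ f x) :
    ∫⁻ x in Set.Icc a b, ENNReal.ofReal (f x) = ENNReal.ofReal (∫ x in a..b, f x) := by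
  rw [intervalIntegral.integral_of_le hab, ← integral_Icc_eq_integral_Ioc,
    ofReal_integral_eq_lintegral_ofReal (hf.integrableOn_compact isCompact_Icc)
      (Filter.Eventually.of_forall hf0)]

lemma l2Norm_sq_eq_ofReal {a b : ℝ} (hab : a < b) {w : ℝ → ℝ}
    (hw : ContinuousOn w (Set.Icc a b)) :
    l2Norm a b w ^ 2 = ENNReal.ofReal (sqInt a b w) := by
  rw [l2Norm_sq, sqInt, lintegral_Icc_eq_ofReal (f := fun x => w x ^ 2) hab.le (hw.pow 2) fun x => sq_nonneg _]

/-! ### Fields that are smooth in `(x, t)` and measurable in `v` -/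

/-- The time derivative of a field. -/
noncomputable def dtF (T : ℝ) (u : ℝ → ℝ → ℝ → ℝ) (x v t : ℝ) : ℝ := dt T (fun y s => u y v s) x t

/-- The space derivative of a field. -/
noncomputable def dxF (u : ℝ → ℝ → ℝ → ℝ) (x v t : ℝ) : ℝ := dx (fun y s => u y v s) x t

/-- `u(x, v, t)` is of class `C^r` in `(x, t)` for `v ∈ S`, `t ∈ [0, T]`, and measurable there. -/
structure SmoothField (S : Set ℝ) (T : ℝ) (r : ℕ) (u : ℝ → ℝ → ℝ → ℝ) : Prop where
  measurable : Measurable ({p : ℝ × ℝ × ℝ | p.2.1 ∈ S ∧ p.2.2 ∈ Set.Icc 0 T}.indicator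
    fun p => u p.1 p.2.1 p.2.2)
  contDiffOn : ∀ v ∈ S,
    ContDiffOn ℝ r (fun p : ℝ × ℝ => u p.1 v p.2) (Set.univ ×ˢ Set.Icc 0 T)

section fields
variable {S : Set ℝ} {T : ℝ} {r : ℕ} {u : ℝ → ℝ → ℝ → ℝ}

lemma uniqueDiffOn_strip (hT : 0 < T) :
    UniqueDiffOn ℝ ((Set.univ : Set ℝ) ×ˢ Set.Icc 0 T) :=
  uniqueDiffOn_univ.prod (uniqueDiffOn_Icc hT)

lemma hasDerivWithinAt_time {f : ℝ × ℝ → ℝ} {f' : ℝ × ℝ →L[ℝ] ℝ} {x t : ℝ}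
    (h : HasFDerivWithinAt f f' (Set.univ ×ˢ Set.Icc 0 T) (x, t)) :
    HasDerivWithinAt (fun s => f (x, s)) (f' (0, 1)) (Set.Icc 0 T) t :=
  h.comp_hasDerivWithinAt t
    (((hasDerivAt_const t x).prodMk (hasDerivAt_id t)).hasDerivWithinAt)
    fun _ hs => ⟨Set.mem_univ _, hs⟩

lemma hasDerivAt_space {f : ℝ × ℝ → ℝ} {f' : ℝ × ℝ →L[ℝ] ℝ} {x t : ℝ} (ht : t ∈ Set.Icc 0 T)
    (h : HasFDerivWithinAt f f' (Set.univ ×ˢ Set.Icc 0 T) (x, t)) :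
    HasDerivAt (fun y => f (y, t)) (f' (1, 0)) x := by
  have hm : Set.MapsTo (fun y : ℝ => (y, t)) Set.univ (Set.univ ×ˢ Set.Icc 0 T) :=
    fun _ _ => ⟨Set.mem_univ _, ht⟩
  rw [← hasDerivWithinAt_univ]
  exact h.comp_hasDerivWithinAt x
    (((hasDerivAt_id x).prodMk (hasDerivAt_const x t)).hasDerivWithinAt) hm

lemma SmoothField.hasFDerivWithinAt (h : SmoothField S T (r + 1) u) {v : ℝ} (hv : v ∈ S) {x t : ℝ}
    (ht : t ∈ Set.Icc 0 T) :
    HasFDerivWithinAt (fun p : ℝ × ℝ => u p.1 v p.2)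
      (fderivWithin ℝ (fun p : ℝ × ℝ => u p.1 v p.2) (Set.univ ×ˢ Set.Icc 0 T) (x, t))
      (Set.univ ×ˢ Set.Icc 0 T) (x, t) :=
  ((h.contDiffOn v hv).differentiableOn (by simp) (x, t) ⟨Set.mem_univ _, ht⟩).hasFDerivWithinAt

lemma SmoothField.dtF_eq (hT : 0 < T) (h : SmoothField S T (r + 1) u) {v : ℝ} (hv : v ∈ S)
    {x t : ℝ} (ht : t ∈ Set.Icc 0 T) :
    dtF T u x v t = fderivWithin ℝ (fun p : ℝ × ℝ => u p.1 v p.2)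
      (Set.univ ×ˢ Set.Icc 0 T) (x, t) (0, 1) :=
  (hasDerivWithinAt_time (h.hasFDerivWithinAt hv ht)).derivWithin (uniqueDiffOn_Icc hT t ht)

lemma SmoothField.dxF_eq (h : SmoothField S T (r + 1) u) {v : ℝ} (hv : v ∈ S)
    {x t : ℝ} (ht : t ∈ Set.Icc 0 T) :
    dxF u x v t = fderivWithin ℝ (fun p : ℝ × ℝ => u p.1 v p.2)
      (Set.univ ×ˢ Set.Icc 0 T) (x, t) (1, 0) :=
  (hasDerivAt_space ht (h.hasFDerivWithinAt hv ht)).deriv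

lemma SmoothField.hasDerivWithinAt_dtF (hT : 0 < T) (h : SmoothField S T (r + 1) u) {v : ℝ}
    (hv : v ∈ S) {x t : ℝ} (ht : t ∈ Set.Icc 0 T) :
    HasDerivWithinAt (fun s => u x v s) (dtF T u x v t) (Set.Icc 0 T) t := by
  rw [h.dtF_eq hT hv ht]
  exact hasDerivWithinAt_time (h.hasFDerivWithinAt hv ht)

lemma SmoothField.hasDerivAt_dxF (h : SmoothField S T (r + 1) u) {v : ℝ}
    (hv : v ∈ S) {x t : ℝ} (ht : t ∈ Set.Icc 0 T) :
    HasDerivAt (fun y => u y v t) (dxF u x v t) x := by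
  rw [h.dxF_eq hv ht]
  exact hasDerivAt_space ht (h.hasFDerivWithinAt hv ht)

lemma SmoothField.of_le (h : SmoothField S T r u) {r' : ℕ} (hr : r' ≤ r) :
    SmoothField S T r' u :=
  ⟨h.measurable, fun v hv => (h.contDiffOn v hv).of_le (by exact_mod_cast hr)⟩

lemma SmoothField.contDiff_slice (h : SmoothField S T r u) {v : ℝ} (hv : v ∈ S) {t : ℝ}
    (ht : t ∈ Set.Icc 0 T) : ContDiff ℝ r (fun x => u x v t) := by
  rw [← contDiffOn_univ]
  exact (h.contDiffOn v hv).comp (f := fun x : ℝ => (x, t)) (by fun_prop)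
    fun x _ => ⟨Set.mem_univ _, ht⟩

lemma SmoothField.continuousOn_time (h : SmoothField S T r u) {v : ℝ} (hv : v ∈ S) (x : ℝ) :
    ContinuousOn (fun t => u x v t) (Set.Icc 0 T) :=
  (h.contDiffOn v hv).continuousOn.comp (f := fun t : ℝ => (x, t)) (by fun_prop)
    fun t ht => ⟨Set.mem_univ _, ht⟩

lemma SmoothField.dxF (hT : 0 < T) (h : SmoothField S T (r + 1) u) :
    SmoothField S T r (dxF u) where
  measurable := by
    -- The derivative is a limit of difference quotients of the cut-off field along the steps `1 /
    -- (n + 1)`.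
    refine measurable_of_tendsto_metrizable (f := fun (n : ℕ) p =>
      ((1 : ℝ) / (n + 1))⁻¹ * ({p : ℝ × ℝ × ℝ | p.2.1 ∈ S ∧ p.2.2 ∈ Set.Icc 0 T}.indicator
        (fun p => u p.1 p.2.1 p.2.2) (p.1 + (1 : ℝ) / (n + 1), p.2)
      - {p : ℝ × ℝ × ℝ | p.2.1 ∈ S ∧ p.2.2 ∈ Set.Icc 0 T}.indicator
        (fun p => u p.1 p.2.1 p.2.2) p)) (fun n => ?_) ?_
    · exact ((h.measurable.comp (by fun_prop)).sub h.measurable).const_mul _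
    · rw [tendsto_pi_nhds]
      rintro ⟨x, v, t⟩
      by_cases hp : v ∈ S ∧ t ∈ Set.Icc 0 T
      · have h1 := hasDerivAt_iff_tendsto_slope_zero.1 (h.hasDerivAt_dxF (x := x) hp.1 hp.2)
        have h2 : Filter.Tendsto (fun n : ℕ => (1 : ℝ) / (n + 1)) Filter.atTop
            (nhdsWithin 0 {0}ᶜ) :=
          tendsto_nhdsWithin_iff.2 ⟨tendsto_one_div_add_atTop_nhds_zero_nat,
            Filter.Eventually.of_forall fun n => by
              simp only [Set.mem_compl_iff, Set.mem_singleton_iff]; positivity⟩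
        have m : ∀ y, (y, v, t) ∈ {p : ℝ × ℝ × ℝ | p.2.1 ∈ S ∧ p.2.2 ∈ Set.Icc 0 T} := fun _ => hp
        simp only [Set.indicator_of_mem (m _)]
        exact h1.comp h2
      · have : ∀ y, (y, v, t) ∉ {p : ℝ × ℝ × ℝ | p.2.1 ∈ S ∧ p.2.2 ∈ Set.Icc 0 T} := fun y => hp
        simp only [Set.indicator_of_notMem (this _), sub_zero, mul_zero, tendsto_const_nhds_iff]
  contDiffOn v hv := by
    have h1 := (h.contDiffOn v hv).fderivWithin (m := r) (uniqueDiffOn_strip hT)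
      (by exact_mod_cast le_rfl)
    exact (h1.clm_apply (contDiffOn_const (c := ((1 : ℝ), (0 : ℝ))))).congr fun p hp =>
      h.dxF_eq hv hp.2

lemma SmoothField.dtF (hS : MeasurableSet S) (hT : 0 < T) (h : SmoothField S T (r + 1) u) :
    SmoothField S T r (dtF T u) where
  measurable := by
    -- Difference quotients are taken towards the end of `[0, T]` that lies farther away: the points
    -- stay in the interval and never coincide with `t`.
    let c : ℝ → ℝ := fun t => if t ≤ T / 2 then T else 0
    have hc : Measurable c := Measurable.ite measurableSet_Iic measurable_const measurable_const
    refine measurable_of_tendsto_metrizable (f := fun (n : ℕ) p =>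
      ((c p.2.2 - p.2.2) * (1 / ((n : ℝ) + 1)))⁻¹
        * ({p : ℝ × ℝ × ℝ | p.2.1 ∈ S ∧ p.2.2 ∈ Set.Icc 0 T}.indicator
        (fun p => u p.1 p.2.1 p.2.2)
          (p.1, p.2.1, p.2.2 + (c p.2.2 - p.2.2) * (1 / ((n : ℝ) + 1)))
      - {p : ℝ × ℝ × ℝ | p.2.1 ∈ S ∧ p.2.2 ∈ Set.Icc 0 T}.indicator
        (fun p => u p.1 p.2.1 p.2.2) p)
        * {p : ℝ × ℝ × ℝ | p.2.1 ∈ S ∧ p.2.2 ∈ Set.Icc 0 T}.indicator 1 p) (fun n => ?_) ?_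
    · have hE : MeasurableSet {p : ℝ × ℝ × ℝ | p.2.1 ∈ S ∧ p.2.2 ∈ Set.Icc 0 T} :=
        (measurable_fst.comp measurable_snd hS).inter
          (measurable_snd.comp measurable_snd measurableSet_Icc)
      have h1 : Measurable fun p : ℝ × ℝ × ℝ => (c p.2.2 - p.2.2) * (1 / ((n : ℝ) + 1)) := by
        fun_prop
      exact (h1.inv.mul ((h.measurable.comp (by fun_prop)).sub h.measurable)).mul
        (measurable_one.indicator hE)
    · rw [tendsto_pi_nhds]
      rintro ⟨x, v, t⟩
      by_cases hp : v ∈ S ∧ t ∈ Set.Icc 0 T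
      · have h1 := hasDerivWithinAt_iff_tendsto_slope.1
          (h.hasDerivWithinAt_dtF (x := x) hT hp.1 hp.2)
        have hcne : c t - t ≠ 0 := by
          simp only [c]; split_ifs with h3
          · intro h4; linarith
          · intro h4; linarith
        have hmem : ∀ n : ℕ, t + (c t - t) * (1 / ((n : ℝ) + 1)) ∈ Set.Icc 0 T := fun n => by
          have hl0 : 0 ≤ 1 / ((n : ℝ) + 1) := by positivity
          have hl1 : 1 / ((n : ℝ) + 1) ≤ 1 := by
            rw [div_le_one (by positivity)]; linarith [(Nat.cast_nonneg n : (0 : ℝ) ≤ n)]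
          have hcm : c t ∈ Set.Icc 0 T := by
            simp only [c]; split_ifs
            · exact ⟨hT.le, le_rfl⟩
            · exact ⟨le_rfl, hT.le⟩
          have := (convex_Icc 0 T) hp.2 hcm (sub_nonneg.2 hl1) hl0 (by ring)
          simp only [smul_eq_mul] at this
          convert this using 1; ring
        have h2 : Filter.Tendsto (fun n : ℕ => t + (c t - t) * (1 / ((n : ℝ) + 1))) Filter.atTop
            (nhdsWithin t (Set.Icc 0 T \ {t})) := by
          refine tendsto_nhdsWithin_iff.2 ⟨?_, Filter.Eventually.of_forall fun n => ⟨hmem n, ?_⟩⟩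
          · simpa using (tendsto_one_div_add_atTop_nhds_zero_nat.const_mul (c t - t)).const_add t
          · simp only [Set.mem_singleton_iff, add_eq_left, mul_eq_zero, hcne, false_or]
            positivity
        have h3 := h1.comp h2
        refine Filter.Tendsto.congr (fun n => ?_) (h3.trans_eq ?_)
        · have m1 : (x, v, t + (c t - t) * (1 / ((n : ℝ) + 1)))
              ∈ {p : ℝ × ℝ × ℝ | p.2.1 ∈ S ∧ p.2.2 ∈ Set.Icc 0 T} := ⟨hp.1, hmem n⟩
          have m2 : (x, v, t) ∈ {p : ℝ × ℝ × ℝ | p.2.1 ∈ S ∧ p.2.2 ∈ Set.Icc 0 T} := hp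
          rw [Set.indicator_of_mem m1, Set.indicator_of_mem m2, Set.indicator_of_mem m2]
          simp [slope]
        · rw [Set.indicator_of_mem]; exact hp
      · have : (x, v, t) ∉ {p : ℝ × ℝ × ℝ | p.2.1 ∈ S ∧ p.2.2 ∈ Set.Icc 0 T} := hp
        simp only [Set.indicator_of_notMem this, mul_zero, tendsto_const_nhds_iff]
  contDiffOn v hv := by
    have h1 := (h.contDiffOn v hv).fderivWithin (m := r) (uniqueDiffOn_strip hT)
      (by exact_mod_cast le_rfl)
    exact (h1.clm_apply (contDiffOn_const (c := ((0 : ℝ), (1 : ℝ))))).congr fun p hp =>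
      h.dtF_eq hT hv hp.2

lemma iteratedDeriv_eq_iterate_dxF (u : ℝ → ℝ → ℝ → ℝ) (j : ℕ) (v t : ℝ) :
    iteratedDeriv j (fun x => u x v t) = fun x => (DGIMEX.dxF^[j] u) x v t := by
  induction j with
  | zero => simp
  | succ j ih => rw [iteratedDeriv_succ, ih, Function.iterate_succ_apply']; rfl

lemma SmoothField.iterate_dxF (hT : 0 < T) {j : ℕ}
    (h : SmoothField S T (r + j) u) : SmoothField S T r (DGIMEX.dxF^[j] u) := by
  induction j generalizing r with
  | zero => exact h
  | succ j ih =>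
    rw [Function.iterate_succ_apply']
    exact (ih (r := r + 1) (by rwa [add_assoc, add_comm 1 j])).dxF hT

/-- The mixed derivatives commute. -/
lemma SmoothField.dtF_dxF (hT : 0 < T) (h : SmoothField S T 2 u) {v : ℝ} (hv : v ∈ S) (x : ℝ)
    {t : ℝ} (ht : t ∈ Set.Ioo 0 T) :
    DGIMEX.dtF T (DGIMEX.dxF u) x v t = DGIMEX.dxF (DGIMEX.dtF T u) x v t := by
  set f : ℝ × ℝ → ℝ := fun p => u p.1 v p.2 with hf
  have hmem : ∀ {y s : ℝ}, s ∈ Set.Ioo 0 T →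
      (Set.univ ×ˢ Set.Icc 0 T : Set (ℝ × ℝ)) ∈ nhds (y, s) := fun hs =>
    prod_mem_nhds Filter.univ_mem (Icc_mem_nhds hs.1 hs.2)
  have hfw : ∀ {y s : ℝ}, s ∈ Set.Ioo 0 T →
      fderivWithin ℝ f (Set.univ ×ˢ Set.Icc 0 T) (y, s) = fderiv ℝ f (y, s) := fun hs =>
    fderivWithin_of_mem_nhds (hmem hs)
  have hcd : ContDiffAt ℝ 2 f (x, t) :=
    (h.contDiffOn v hv).contDiffAt (hmem ht)
  have hsymm : IsSymmSndFDerivAt ℝ f (x, t) := hcd.isSymmSndFDerivAt (by simp)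
  have hd : HasFDerivAt (fderiv ℝ f) (fderiv ℝ (fderiv ℝ f) (x, t)) (x, t) :=
    ((hcd.fderiv_right (m := 1) (by norm_num)).differentiableAt (by simp)).hasFDerivAt
  have h1 : HasDerivAt (fun s => fderiv ℝ f (x, s) (1, 0))
      (fderiv ℝ (fderiv ℝ f) (x, t) (0, 1) (1, 0)) t := by
    have := hd.comp_hasDerivAt t ((hasDerivAt_const t x).prodMk (hasDerivAt_id t))
    simpa using this.clm_apply (hasDerivAt_const t ((1 : ℝ), (0 : ℝ)))
  have h2 : HasDerivAt (fun y => fderiv ℝ f (y, t) (0, 1))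
      (fderiv ℝ (fderiv ℝ f) (x, t) (1, 0) (0, 1)) x := by
    have := hd.comp_hasDerivAt x ((hasDerivAt_id x).prodMk (hasDerivAt_const x t))
    simpa using this.clm_apply (hasDerivAt_const x ((0 : ℝ), (1 : ℝ)))
  have e1 : (fun s => DGIMEX.dxF u x v s) =ᶠ[nhds t] fun s => fderiv ℝ f (x, s) (1, 0) := by
    filter_upwards [Ioo_mem_nhds ht.1 ht.2] with s hs
    rw [h.dxF_eq hv (Set.Ioo_subset_Icc_self hs), hfw hs]
  have e2 : (fun y => DGIMEX.dtF T u y v t) = fun y => fderiv ℝ f (y, t) (0, 1) := by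
    ext y
    rw [h.dtF_eq hT hv (Set.Ioo_subset_Icc_self ht), hfw ht]
  have l1 : DGIMEX.dtF T (DGIMEX.dxF u) x v t
      = fderiv ℝ (fderiv ℝ f) (x, t) (0, 1) (1, 0) := by
    simp only [DGIMEX.dtF, dt]
    rw [derivWithin_of_mem_nhds (Icc_mem_nhds ht.1 ht.2)]
    exact (h1.congr_of_eventuallyEq e1).deriv
  have l2 : DGIMEX.dxF (DGIMEX.dtF T u) x v t
      = fderiv ℝ (fderiv ℝ f) (x, t) (1, 0) (0, 1) := by
    simp only [DGIMEX.dxF, dx]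
    rw [e2]
    exact h2.deriv
  rw [l1, l2]
  exact hsymm.eq _ _

lemma SmoothField.dtF_iterate_dxF (hT : 0 < T) {j : ℕ}
    (h : SmoothField S T (j + 1) u) {v : ℝ} (hv : v ∈ S) (x : ℝ) {t : ℝ} (ht : t ∈ Set.Ioo 0 T) :
    DGIMEX.dtF T (DGIMEX.dxF^[j] u) x v t = DGIMEX.dxF^[j] (DGIMEX.dtF T u) x v t := by
  induction j generalizing x with
  | zero => rfl
  | succ j ih =>
    rw [Function.iterate_succ_apply', Function.iterate_succ_apply']
    have h2 : SmoothField S T 2 (DGIMEX.dxF^[j] u) :=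
      SmoothField.iterate_dxF hT (r := 2) (by rwa [show 2 + j = j + 1 + 1 by ring])
    rw [h2.dtF_dxF hT hv x ht]
    have e : (fun y => DGIMEX.dtF T (DGIMEX.dxF^[j] u) y v t)
        = fun y => DGIMEX.dxF^[j] (DGIMEX.dtF T u) y v t :=
      funext fun y => ih (h.of_le (Nat.le_succ _)) y
    exact congrArg (fun w => deriv w x) e

end fields

/-! ### Differences in time -/

/-- Cauchy–Schwarz in time for each `z`, then Tonelli: only a bound at each fixed time is needed,
not a supremum inside the norm. -/
lemma lintegral_sq_integral_le {Z : Type*} [MeasurableSpace Z] {ν : Measure Z} [SFinite ν]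
    {Φ : Z → ℝ → ℝ} (hΦ : Measurable (Function.uncurry Φ)) {s s' : ℝ} (hs : s ≤ s')
    (hc : ∀ z, ContinuousOn (Φ z) (Set.Icc s s')) {K : ℝ≥0∞}
    (hK : ∀ t ∈ Set.Icc s s', ∫⁻ z, ENNReal.ofReal (Φ z t ^ 2) ∂ν ≤ K) :
    ∫⁻ z, ENNReal.ofReal ((∫ t in s..s', Φ z t) ^ 2) ∂ν ≤ ENNReal.ofReal ((s' - s) ^ 2) * K := by
  have h0 : 0 ≤ s' - s := sub_nonneg.2 hs
  have h1 : ∀ z, ENNReal.ofReal ((∫ t in s..s', Φ z t) ^ 2)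
      ≤ ENNReal.ofReal (s' - s) * ∫⁻ t in Set.Icc s s', ENNReal.ofReal (Φ z t ^ 2) := by
    intro z
    rw [lintegral_Icc_eq_ofReal (f := fun t => Φ z t ^ 2) hs ((hc z).pow 2) fun x => sq_nonneg _,
      ← ENNReal.ofReal_mul h0]
    refine ENNReal.ofReal_le_ofReal ?_
    have := sq_integral_interval_le hs (hc z) (continuousOn_const (c := (1 : ℝ)))
    simpa [mul_comm] using this
  have hm : Measurable (fun p : Z × ℝ => ENNReal.ofReal (Φ p.1 p.2 ^ 2)) :=
    (hΦ.pow_const 2).ennreal_ofReal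
  calc ∫⁻ z, ENNReal.ofReal ((∫ t in s..s', Φ z t) ^ 2) ∂ν
      ≤ ∫⁻ z, (ENNReal.ofReal (s' - s) * ∫⁻ t in Set.Icc s s', ENNReal.ofReal (Φ z t ^ 2)) ∂ν :=
        lintegral_mono h1
    _ = ENNReal.ofReal (s' - s) * ∫⁻ z, (∫⁻ t in Set.Icc s s', ENNReal.ofReal (Φ z t ^ 2)) ∂ν := by
        rw [lintegral_const_mul]
        exact hm.lintegral_prod_right'
    _ = ENNReal.ofReal (s' - s) * ∫⁻ t in Set.Icc s s', ∫⁻ z, ENNReal.ofReal (Φ z t ^ 2) ∂ν := by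
        rw [lintegral_lintegral_swap hm.aemeasurable]
    _ ≤ ENNReal.ofReal (s' - s) * ∫⁻ t in Set.Icc s s', K := by
        gcongr ENNReal.ofReal (s' - s) * ?_
        exact setLIntegral_mono measurable_const fun t ht => hK t ht
    _ = ENNReal.ofReal ((s' - s) ^ 2) * K := by
        rw [lintegral_const, Measure.restrict_apply_univ, Real.volume_Icc, mul_comm K, ← mul_assoc,
          ← ENNReal.ofReal_mul h0, sq]

/-! ### Functions of `(x, v)` -/

/-- `D(x, v)` is continuous in `x` for `v ∈ S`, and measurable there. -/
structure SliceField (S : Set ℝ) (D : ℝ → ℝ → ℝ) : Prop where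
  measurable : Measurable fun p : ℝ × ℝ => S.indicator (fun v => D p.2 v) p.1
  continuous : ∀ v ∈ S, Continuous fun x => D x v

lemma tripleNormSq_eq (m : Model) (a b : ℝ) (D : ℝ → ℝ → ℝ) :
    tripleNormSq m a b D
      = ∫⁻ v, (∫⁻ x in Set.Icc a b, ENNReal.ofReal (D x v ^ 2)) ∂m.measure := by
  simp only [tripleNormSq, l2Norm_sq]

section slices
variable {m : Model} {S : Set ℝ} {a b : ℝ} {D E : ℝ → ℝ → ℝ}

lemma SliceField.sub (hD : SliceField S D) (hE : SliceField S E) :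
    SliceField S fun x v => D x v - E x v where
  measurable := by
    have := hD.measurable.sub hE.measurable
    convert this using 1
    ext p
    by_cases h : p.1 ∈ S <;> simp [h]
  continuous v hv := (hD.continuous v hv).sub (hE.continuous v hv)

lemma SliceField.const_mul (hD : SliceField S D) (c : ℝ) : SliceField S fun x v => c * D x v where
  measurable := by
    have := hD.measurable.const_mul c
    convert this using 1
    ext p
    by_cases h : p.1 ∈ S <;> simp [h]
  continuous v hv := continuous_const.mul (hD.continuous v hv)

/-- Passing from the product measure to iterated integrals in this direction requires no
measurability. -/
lemma SliceField.lintegral_eq (hS : ∀ᵐ v ∂m.measure, v ∈ S) (D : ℝ → ℝ → ℝ) :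
    ∫⁻ p, ENNReal.ofReal (S.indicator (fun v => D p.2 v) p.1 ^ 2)
      ∂(m.measure.prod (volume.restrict (Set.Icc a b))) ≤ tripleNormSq m a b D := by
  refine (lintegral_prod_le _).trans_eq ?_
  rw [tripleNormSq_eq]
  refine lintegral_congr_ae ?_
  filter_upwards [hS] with v hv
  simp [Set.indicator_of_mem hv]

lemma SliceField.integrable_sqInt (hab : a < b) (hS : ∀ᵐ v ∂m.measure, v ∈ S)
    (hD : SliceField S D) {K : ℝ} (hK : 0 ≤ K) (h : tripleNormSq m a b D ≤ ENNReal.ofReal K) :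
    Integrable (fun v => sqInt a b fun x => D x v) m.measure
      ∧ ∫ v, (sqInt a b fun x => D x v) ∂m.measure ≤ K := by
  have hm : AEStronglyMeasurable (fun v => sqInt a b fun x => D x v) m.measure := by
    have h1 : StronglyMeasurable fun v =>
        ∫ x in Set.Icc a b, S.indicator (fun v => D x v) v ^ 2 :=
      StronglyMeasurable.integral_prod_right
        (f := fun v x => S.indicator (fun v => D x v) v ^ 2)
        (hD.measurable.pow_const 2).stronglyMeasurable
    refine h1.aestronglyMeasurable.congr ?_
    filter_upwards [hS] with v hv
    simp only [sqInt, intervalIntegral.integral_of_le hab.le, ← integral_Icc_eq_integral_Ioc,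
      Set.indicator_of_mem hv]
  have hle : ∫⁻ v, ENNReal.ofReal (sqInt a b fun x => D x v) ∂m.measure ≤ ENNReal.ofReal K := by
    refine le_trans (le_of_eq ?_) h
    refine lintegral_congr_ae ?_
    filter_upwards [hS] with v hv
    rw [← l2Norm_sq_eq_ofReal hab (hD.continuous v hv).continuousOn]
  have h0 : 0 ≤ᵐ[m.measure] fun v => sqInt a b fun x => D x v :=
    Filter.Eventually.of_forall fun v => sqInt_nonneg hab _
  refine ⟨⟨hm, ?_⟩, ?_⟩
  · rw [hasFiniteIntegral_iff_ofReal h0]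
    exact hle.trans_lt ENNReal.ofReal_lt_top
  · rw [integral_eq_lintegral_of_nonneg_ae h0 hm]
    exact ENNReal.toReal_le_of_le_ofReal hK hle

/-- Moments in `x` are square integrable in `v`. -/
lemma SliceField.memLp_moment (hab : a < b) (hS : ∀ᵐ v ∂m.measure, v ∈ S)
    (hD : SliceField S D) (h : tripleNormSq m a b D ≠ ∞) {c d : ℝ} (hcd : c ≤ d)
    (hsub : Set.Icc c d ⊆ Set.Icc a b) {p : ℝ → ℝ} (hp : Continuous p) :
    MemLp (fun v => ∫ x in c..d, D x v * p x) 2 m.measure := by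
  have hm : AEStronglyMeasurable (fun v => ∫ x in c..d, D x v * p x) m.measure := by
    have h1 : StronglyMeasurable fun v =>
        ∫ x in Set.Icc c d, S.indicator (fun v => D x v) v * p x :=
      StronglyMeasurable.integral_prod_right
        (f := fun v x => S.indicator (fun v => D x v) v * p x)
        (hD.measurable.mul (hp.measurable.comp measurable_snd)).stronglyMeasurable
    refine h1.aestronglyMeasurable.congr ?_
    filter_upwards [hS] with v hv
    simp only [intervalIntegral.integral_of_le hcd, ← integral_Icc_eq_integral_Ioc,
      Set.indicator_of_mem hv]
  obtain ⟨h1, -⟩ := hD.integrable_sqInt hab hS ENNReal.toReal_nonneg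
    (ENNReal.ofReal_toReal h).ge
  rw [memLp_two_iff_integrable_sq hm]
  refine (h1.mul_const (∫ x in c..d, p x ^ 2)).mono' (hm.pow 2) ?_
  filter_upwards [hS] with v hv
  rw [Real.norm_eq_abs, abs_of_nonneg (sq_nonneg _)]
  refine (sq_integral_interval_le hcd (hD.continuous v hv).continuousOn hp.continuousOn).trans ?_
  refine mul_le_mul_of_nonneg_right ?_
    (intervalIntegral.integral_nonneg hcd fun x _ => sq_nonneg _)
  refine intervalIntegral.integral_mono_interval (hsub (Set.left_mem_Icc.2 hcd)).1 hcd
    (hsub (Set.right_mem_Icc.2 hcd)).2 (Filter.Eventually.of_forall fun x => sq_nonneg _)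
    (((hD.continuous v hv).pow 2).intervalIntegrable _ _)

/-- Averages in `v` commute with moments in `x`. -/
lemma SliceField.integral_moment (hS : ∀ᵐ v ∂m.measure, v ∈ S)
    (hD : SliceField S D) (h : tripleNormSq m a b D ≠ ∞) {c d : ℝ} (hcd : c ≤ d)
    (hsub : Set.Icc c d ⊆ Set.Icc a b) {p : ℝ → ℝ} (hp : Continuous p) {f : ℝ → ℝ}
    (hf : Measurable f) (hf1 : ∀ v, |v| ≤ 1 → |f v| ≤ 1) :
    ∫ v, f v * (∫ x in c..d, D x v * p x) ∂m.measure
      = ∫ x in c..d, (∫ v, f v * D x v ∂m.measure) * p x := by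
  have hi : MemLp (fun q : ℝ × ℝ => S.indicator (fun v => D q.2 v) q.1) 2
      (m.measure.prod (volume.restrict (Set.Icc a b))) := by
    rw [memLp_two_iff_integrable_sq hD.measurable.aestronglyMeasurable]
    refine ⟨(hD.measurable.pow_const 2).aestronglyMeasurable, ?_⟩
    rw [hasFiniteIntegral_iff_ofReal (Filter.Eventually.of_forall fun q => sq_nonneg _)]
    exact (SliceField.lintegral_eq hS D).trans_lt h.lt_top
  have hi2 : Integrable (fun q : ℝ × ℝ => S.indicator (fun v => D q.2 v) q.1)
      (m.measure.prod (volume.restrict (Set.Icc c d))) := by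
    refine (hi.integrable (by norm_num)).mono_measure ?_
    exact Measure.prod_mono le_rfl (Measure.restrict_mono hsub le_rfl)
  have hfb : ∀ᵐ q : ℝ × ℝ ∂(m.measure.prod (volume.restrict (Set.Icc c d))), |q.1| ≤ 1 :=
    Measure.quasiMeasurePreserving_fst.ae m.ae_abs_le_one
  obtain ⟨B, hB⟩ := (isCompact_Icc (a := c) (b := d)).exists_bound_of_continuousOn hp.continuousOn
  have hpb : ∀ᵐ q : ℝ × ℝ ∂(m.measure.prod (volume.restrict (Set.Icc c d))), ‖p q.2‖ ≤ B :=
    Measure.quasiMeasurePreserving_snd.ae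
      ((ae_restrict_mem measurableSet_Icc).mono fun x hx => hB x hx)
  have hi3 : Integrable (fun q : ℝ × ℝ => f q.1 * (S.indicator (fun v => D q.2 v) q.1 * p q.2))
      (m.measure.prod (volume.restrict (Set.Icc c d))) :=
    (hi2.mul_bdd (hp.measurable.comp measurable_snd).aestronglyMeasurable hpb).bdd_mul
      (hf.comp measurable_fst).aestronglyMeasurable (hfb.mono fun q hq => hf1 _ hq)
  simp only [intervalIntegral.integral_of_le hcd, ← integral_Icc_eq_integral_Ioc]
  have hsw := integral_integral_swap (f := fun v x =>
    f v * (S.indicator (fun v => D x v) v * p x)) hi3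
  have e1 : ∫ v, f v * (∫ x in Set.Icc c d, D x v * p x) ∂m.measure
      = ∫ v, (∫ x in Set.Icc c d, f v * (S.indicator (fun v => D x v) v * p x)) ∂m.measure := by
    refine integral_congr_ae ?_
    filter_upwards [hS] with v hv
    simp only [Set.indicator_of_mem hv, integral_const_mul]
  rw [e1, hsw]
  refine integral_congr_ae (Filter.Eventually.of_forall fun x => ?_)
  simp only [← mul_assoc, integral_mul_const]
  congr 1
  refine integral_congr_ae ?_
  filter_upwards [hS] with v hv
  simp only [Set.indicator_of_mem hv]

end slices

section fields
variable {m : Model} {S : Set ℝ} {T : ℝ} {r : ℕ} {u : ℝ → ℝ → ℝ → ℝ} {a b : ℝ}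

lemma SmoothField.slice (h : SmoothField S T r u) {t : ℝ} (ht : t ∈ Set.Icc 0 T) :
    SliceField S fun x v => u x v t where
  measurable := by
    have := h.measurable.comp (g := _) (f := fun p : ℝ × ℝ => (p.2, p.1, t)) (by fun_prop)
    convert this using 1
    ext p
    by_cases hp : p.1 ∈ S
    · rw [Set.indicator_of_mem hp, Function.comp_apply, Set.indicator_of_mem]
      exact ⟨hp, ht⟩
    · rw [Set.indicator_of_notMem hp, Function.comp_apply, Set.indicator_of_notMem]
      exact fun h => hp h.1
  continuous v hv := (h.contDiff_slice hv ht).continuous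

/-- The `L²` norm of a time integral. -/
lemma SmoothField.tripleNormSq_integral_le (hS : ∀ᵐ v ∂m.measure, v ∈ S)
    (h : SmoothField S T r u) {s s' : ℝ} (hs : s ≤ s') (hsub : Set.Icc s s' ⊆ Set.Icc 0 T)
    {K : ℝ≥0∞} (hK : ∀ t ∈ Set.Icc s s', tripleNormSq m a b (fun x v => u x v t) ≤ K)
    {D : ℝ → ℝ → ℝ}
    (hDu : ∀ v ∈ S, ∀ x, D x v = ∫ t in s..s', u x v t) :
    tripleNormSq m a b D ≤ ENNReal.ofReal ((s' - s) ^ 2) * K := by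
  let Φ : ℝ × ℝ → ℝ → ℝ := fun z t =>
    {p : ℝ × ℝ × ℝ | p.2.1 ∈ S ∧ p.2.2 ∈ Set.Icc 0 T}.indicator
      (fun p => u p.1 p.2.1 p.2.2) (z.2, z.1, t)
  have hΦ : Measurable (Function.uncurry Φ) := h.measurable.comp (by fun_prop)
  have hΦS : ∀ z : ℝ × ℝ, z.1 ∈ S → ∀ t ∈ Set.Icc 0 T, Φ z t = u z.2 z.1 t := fun z hz t ht =>
    Set.indicator_of_mem (show (z.2, z.1, t) ∈ {p : ℝ × ℝ × ℝ | p.2.1 ∈ S ∧ p.2.2 ∈ Set.Icc 0 T}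
      from ⟨hz, ht⟩) _
  have hΦS' : ∀ z : ℝ × ℝ, z.1 ∉ S → ∀ t, Φ z t = 0 := fun z hz t =>
    Set.indicator_of_notMem (fun h => hz h.1) _
  have hc : ∀ z, ContinuousOn (Φ z) (Set.Icc s s') := by
    intro z
    by_cases hz : z.1 ∈ S
    · exact ((h.continuousOn_time hz z.2).mono hsub).congr fun t ht => hΦS z hz t (hsub ht)
    · exact continuousOn_const.congr fun t _ => hΦS' z hz t
  have hKt : ∀ t ∈ Set.Icc s s', ∫⁻ z, ENNReal.ofReal (Φ z t ^ 2)
      ∂(m.measure.prod (volume.restrict (Set.Icc a b))) ≤ K := by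
    intro t ht
    refine le_trans (le_of_eq ?_) ((SliceField.lintegral_eq hS fun x v => u x v t).trans (hK t ht))
    refine lintegral_congr fun z => ?_
    by_cases hz : z.1 ∈ S
    · rw [hΦS z hz t (hsub ht), Set.indicator_of_mem hz]
    · rw [hΦS' z hz t, Set.indicator_of_notMem hz]
  refine le_trans (le_of_eq ?_) (lintegral_sq_integral_le hΦ hs hc hKt)
  have hm : Measurable fun z : ℝ × ℝ => ∫ t in s..s', Φ z t := by
    simp only [intervalIntegral.integral_of_le hs]
    exact (StronglyMeasurable.integral_prod_right (f := Φ) hΦ.stronglyMeasurable).measurable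
  rw [lintegral_prod _ (hm.pow_const 2).ennreal_ofReal.aemeasurable, tripleNormSq_eq]
  refine lintegral_congr_ae ?_
  filter_upwards [hS] with v hv
  refine lintegral_congr fun x => ?_
  rw [hDu v hv x]
  congr 2
  refine intervalIntegral.integral_congr fun t ht => ?_
  rw [Set.uIcc_of_le hs] at ht
  exact (hΦS (v, x) hv t (hsub ht)).symm

/-- Mixed derivatives are interchanged at interior times only; continuity up to the end points makes
this sufficient. -/
lemma integral_eq_sub_of_Ioo {f f' : ℝ → ℝ} {T s s' : ℝ} (hs0 : 0 ≤ s) (hs : s ≤ s') (hs' : s' ≤ T)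
    (hf : ContinuousOn f (Set.Icc 0 T)) (hf' : ContinuousOn f' (Set.Icc 0 T))
    (hd : ∀ t ∈ Set.Ioo 0 T, HasDerivAt f (f' t) t) :
    f s' - f s = ∫ t in s..s', f' t := by
  have hsub : Set.Icc s s' ⊆ Set.Icc 0 T := Set.Icc_subset_Icc hs0 hs'
  refine (intervalIntegral.integral_eq_sub_of_hasDerivAt_of_le hs (hf.mono hsub)
    (fun t ht => hd t ⟨hs0.trans_lt ht.1, ht.2.trans_le hs'⟩) ?_).symm
  exact (hf'.mono (by rwa [Set.uIcc_of_le hs])).intervalIntegrable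

/-- The difference in time of a space derivative. -/
lemma SmoothField.tripleNormSq_sub_le (hSm : MeasurableSet S) (hS : ∀ᵐ v ∂m.measure, v ∈ S)
    (hT : 0 < T) {j : ℕ} (h : SmoothField S T (j + 1) u) {s s' : ℝ} (hs0 : 0 ≤ s) (hs : s ≤ s')
    (hs' : s' ≤ T) {K : ℝ≥0∞}
    (hK : ∀ t ∈ Set.Icc 0 T, tripleNormSq m a b (fun x v => DGIMEX.dxF^[j] (DGIMEX.dtF T u) x v t) ≤ K) :
    tripleNormSq m a b (fun x v => DGIMEX.dxF^[j] u x v s' - DGIMEX.dxF^[j] u x v s)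
      ≤ ENNReal.ofReal ((s' - s) ^ 2) * K := by
  have hsub : Set.Icc s s' ⊆ Set.Icc 0 T := Set.Icc_subset_Icc hs0 hs'
  have h1 : SmoothField S T 1 (DGIMEX.dxF^[j] u) :=
    SmoothField.iterate_dxF hT (by rwa [add_comm 1 j])
  have h2 : SmoothField S T 0 (DGIMEX.dxF^[j] (DGIMEX.dtF T u)) :=
    SmoothField.iterate_dxF hT (by rw [zero_add]; exact h.dtF hSm hT)
  refine h2.tripleNormSq_integral_le hS hs hsub (fun t ht => hK t (hsub ht)) ?_
  intro v hv x
  refine integral_eq_sub_of_Ioo hs0 hs hs' (h1.continuousOn_time hv x)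
    (h2.continuousOn_time hv x) fun t ht => ?_
  -- The hypothesis bounds `∂ₓ^j ∂ₜu`, whereas the fundamental theorem of calculus produces `∂ₜ ∂ₓ^j
  -- u`.
  rw [← h.dtF_iterate_dxF hT hv x ht]
  exact (h1.hasDerivWithinAt_dtF (r := 0) hT hv (Set.Ioo_subset_Icc_self ht)).hasDerivAt
    (Icc_mem_nhds ht.1 ht.2)

/-- The first order Taylor remainder in time. -/
lemma SmoothField.tripleNormSq_taylor_le (hSm : MeasurableSet S) (hS : ∀ᵐ v ∂m.measure, v ∈ S)
    (hT : 0 < T) (h : SmoothField S T 2 u) {s s' : ℝ} (hs0 : 0 ≤ s) (hs : s ≤ s')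
    (hs' : s' ≤ T) {K : ℝ≥0∞}
    (hK : ∀ t ∈ Set.Icc 0 T,
      tripleNormSq m a b (fun x v => DGIMEX.dtF T (DGIMEX.dtF T u) x v t) ≤ K) :
    tripleNormSq m a b (fun x v => u x v s' - u x v s - (s' - s) * DGIMEX.dtF T u x v s)
      ≤ ENNReal.ofReal ((s' - s) ^ 2) * (ENNReal.ofReal ((s' - s) ^ 2) * K) := by
  have hsub : Set.Icc s s' ⊆ Set.Icc 0 T := Set.Icc_subset_Icc hs0 hs'
  have hsm : s ∈ Set.Icc 0 T := hsub (Set.left_mem_Icc.2 hs)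
  have hs'm : s' ∈ Set.Icc 0 T := hsub (Set.right_mem_Icc.2 hs)
  have h1 : SmoothField S T 1 (DGIMEX.dtF T u) := h.dtF hSm hT
  -- The remainder is the time integral of this field, whose norm is bounded by the difference
  -- estimate for `∂ₜu` with no space derivative.
  have h2 : SmoothField S T 0 fun x v t => DGIMEX.dtF T u x v t - DGIMEX.dtF T u x v s := by
    constructor
    · have hE : MeasurableSet {p : ℝ × ℝ × ℝ | p.2.1 ∈ S ∧ p.2.2 ∈ Set.Icc 0 T} :=
        (measurable_fst.comp measurable_snd hSm).inter
          (measurable_snd.comp measurable_snd measurableSet_Icc)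
      have := (h1.measurable.sub (h1.measurable.comp (g := _)
        (f := fun p : ℝ × ℝ × ℝ => (p.1, p.2.1, s)) (by fun_prop))).indicator hE
      convert this using 1
      ext p
      by_cases hp : p ∈ {p : ℝ × ℝ × ℝ | p.2.1 ∈ S ∧ p.2.2 ∈ Set.Icc 0 T}
      · rw [Set.indicator_of_mem hp, Set.indicator_of_mem hp]
        simp only [Pi.sub_apply, Function.comp_apply]
        rw [Set.indicator_of_mem hp, Set.indicator_of_mem]
        exact ⟨hp.1, hsm⟩
      · rw [Set.indicator_of_notMem hp, Set.indicator_of_notMem hp]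
    · intro v hv
      have hc := (h1.contDiff_slice hv hsm).continuous
      exact contDiffOn_zero.2 ((h1.contDiffOn v hv).continuousOn.sub
        (hc.comp continuous_fst).continuousOn)
  refine h2.tripleNormSq_integral_le hS hs hsub ?_ ?_
  · intro t ht
    have := h1.tripleNormSq_sub_le (j := 0) hSm hS hT hs0 ht.1 (hsub ht).2 (K := K)
      (a := a) (b := b) (m := m) (by simpa using hK)
    refine this.trans (mul_le_mul_left ?_ K)
    exact ENNReal.ofReal_le_ofReal (pow_le_pow_left₀ (sub_nonneg.2 ht.1) (by linarith [ht.2]) 2)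
  · intro v hv x
    have hc := h1.continuousOn_time hv x
    rw [intervalIntegral.integral_sub ((hc.mono (by rwa [Set.uIcc_of_le hs])).intervalIntegrable)
      intervalIntegrable_const, intervalIntegral.integral_const, smul_eq_mul]
    congr 1
    exact integral_eq_sub_of_Ioo hs0 hs hs' (h.continuousOn_time hv x) hc fun t ht =>
      (h.hasDerivWithinAt_dtF (r := 1) hT hv (Set.Ioo_subset_Icc_self ht)).hasDerivAt
        (Icc_mem_nhds ht.1 ht.2)

/-- A function of `(x, t)` as a field. -/
lemma smoothField_const {ρ : ℝ → ℝ → ℝ}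
    (h : ContDiffOn ℝ r (fun p : ℝ × ℝ => ρ p.1 p.2) (Set.univ ×ˢ Set.Icc 0 T))
    (hSm : MeasurableSet S) : SmoothField S T r fun x _ t => ρ x t where
  measurable := by
    have hE : MeasurableSet {p : ℝ × ℝ × ℝ | p.2.1 ∈ S ∧ p.2.2 ∈ Set.Icc 0 T} :=
      (measurable_fst.comp measurable_snd hSm).inter
        (measurable_snd.comp measurable_snd measurableSet_Icc)
    classical
    rw [← Set.piecewise_eq_indicator]
    refine ContinuousOn.measurable_piecewise ?_ continuousOn_const hE
    exact h.continuousOn.comp (f := fun p : ℝ × ℝ × ℝ => (p.1, p.2.2)) (by fun_prop)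
      fun p hp => ⟨Set.mem_univ _, hp.2⟩
  contDiffOn _ _ := h

/-- As `⟨1⟩ = 1`, the density `ρ` can be regarded as a field that is constant in `v`, and the
estimates for `g` serve for it too. -/
lemma tripleNormSq_const (w : ℝ → ℝ) : tripleNormSq m a b (fun x _ => w x) = l2Norm a b w ^ 2 := by
  simp [tripleNormSq]

end fields

/-! ### Bounds of the exact solution -/

/-- `B` bounds the squares of the norms of a field `u` and of its time derivatives. -/
structure FieldBound (m : Model) (a b T : ℝ) (k : ℕ) (B : ℝ) (u : ℝ → ℝ → ℝ → ℝ) : Prop where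
  nonneg : 0 ≤ B
  space : ∀ j ≤ k + 1, ∀ t ∈ Set.Icc 0 T,
    tripleNormSq m a b (fun x v => dxF^[j] u x v t) ≤ ENNReal.ofReal B
  time : ∀ j ≤ k + 1, ∀ t ∈ Set.Icc 0 T,
    tripleNormSq m a b (fun x v => dxF^[j] (dtF T u) x v t) ≤ ENNReal.ofReal B
  time_two : ∀ t ∈ Set.Icc 0 T,
    tripleNormSq m a b (fun x v => dtF T (dtF T u) x v t) ≤ ENNReal.ofReal B

section
variable {m : Model} {a b T : ℝ} {k : ℕ} {B : ℝ} {u : ℝ → ℝ → ℝ → ℝ} {S : Set ℝ}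

lemma FieldBound.integral_space (hab : a < b) (hS : ∀ᵐ v ∂m.measure, v ∈ S) (hT : 0 < T)
    (hu : SmoothField S T (k + 2) u) (hB : FieldBound m a b T k B u) {j : ℕ} (hj : j ≤ k + 1)
    {t : ℝ} (ht : t ∈ Set.Icc 0 T) :
    Integrable (fun v => sqInt a b (iteratedDeriv j fun x => u x v t)) m.measure
      ∧ ∫ v, sqInt a b (iteratedDeriv j fun x => u x v t) ∂m.measure ≤ B := by
  simp only [iteratedDeriv_eq_iterate_dxF]
  have h1 : SmoothField S T 0 (dxF^[j] u) :=
    SmoothField.iterate_dxF hT (hu.of_le (by omega))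
  exact (h1.slice ht).integrable_sqInt hab hS hB.nonneg (hB.space j hj t ht)

lemma FieldBound.integral_sub (hab : a < b) (hSm : MeasurableSet S)
    (hS : ∀ᵐ v ∂m.measure, v ∈ S) (hT : 0 < T)
    (hu : SmoothField S T (k + 2) u) (hB : FieldBound m a b T k B u) {j : ℕ} (hj : j ≤ k + 1)
    {s s' : ℝ} (hs0 : 0 ≤ s) (hs : s ≤ s') (hs' : s' ≤ T) :
    Integrable (fun v => sqInt a b (iteratedDeriv j fun x => u x v s' - u x v s)) m.measure
      ∧ ∫ v, sqInt a b (iteratedDeriv j fun x => u x v s' - u x v s) ∂m.measure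
        ≤ (s' - s) ^ 2 * B := by
  have hsm : s ∈ Set.Icc 0 T := ⟨hs0, hs.trans hs'⟩
  have hs'm : s' ∈ Set.Icc 0 T := ⟨hs0.trans hs, hs'⟩
  have h1 : SmoothField S T 0 (dxF^[j] u) :=
    SmoothField.iterate_dxF hT (hu.of_le (by omega))
  have h2 := SmoothField.tripleNormSq_sub_le (m := m) (a := a) (b := b) hSm hS hT (j := j)
    (hu.of_le (by omega)) hs0 hs hs' (hB.time j hj)
  rw [← ENNReal.ofReal_mul (sq_nonneg _)] at h2
  have h3 := ((h1.slice hs'm).sub (h1.slice hsm)).integrable_sqInt hab hS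
    (mul_nonneg (sq_nonneg _) hB.nonneg) h2
  have e : (fun v => sqInt a b (iteratedDeriv j fun x => u x v s' - u x v s))
      =ᵐ[m.measure] fun v => sqInt a b fun x => dxF^[j] u x v s' - dxF^[j] u x v s := by
    filter_upwards [hS] with v hv
    congr 1
    ext x
    have c : ∀ t ∈ Set.Icc 0 T, ContDiffAt ℝ j (fun x => u x v t) x := fun t ht =>
      ((hu.contDiff_slice hv ht).of_le (by exact_mod_cast (by omega : j ≤ k + 2))).contDiffAt
    rw [iteratedDeriv_fun_sub (c s' hs'm) (c s hsm), iteratedDeriv_eq_iterate_dxF,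
      iteratedDeriv_eq_iterate_dxF]
  exact ⟨h3.1.congr e.symm, (integral_congr_ae e).trans_le h3.2⟩

lemma FieldBound.integral_taylor (hab : a < b) (hSm : MeasurableSet S)
    (hS : ∀ᵐ v ∂m.measure, v ∈ S) (hT : 0 < T)
    (hu : SmoothField S T (k + 2) u) (hB : FieldBound m a b T k B u)
    {s s' : ℝ} (hs0 : 0 ≤ s) (hs : s ≤ s') (hs' : s' ≤ T) :
    Integrable (fun v => sqInt a b fun x => u x v s' - u x v s - (s' - s) * dtF T u x v s) m.measure
      ∧ ∫ v, (sqInt a b fun x => u x v s' - u x v s - (s' - s) * dtF T u x v s) ∂m.measure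
        ≤ (s' - s) ^ 4 * B := by
  have hsm : s ∈ Set.Icc 0 T := ⟨hs0, hs.trans hs'⟩
  have hs'm : s' ∈ Set.Icc 0 T := ⟨hs0.trans hs, hs'⟩
  have h1 : SmoothField S T 1 (dtF T u) :=
    SmoothField.dtF (r := 1) hSm hT (hu.of_le (by omega))
  have h2 := SmoothField.tripleNormSq_taylor_le (m := m) (a := a) (b := b) hSm hS hT
    (hu.of_le (by omega)) hs0 hs hs' hB.time_two
  rw [← ENNReal.ofReal_mul (sq_nonneg _), ← ENNReal.ofReal_mul (sq_nonneg _)] at h2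
  have h3 := (((hu.slice hs'm).sub (hu.slice hsm)).sub
    ((h1.slice hsm).const_mul (s' - s))).integrable_sqInt hab hS
    (mul_nonneg (sq_nonneg _) (mul_nonneg (sq_nonneg _) hB.nonneg)) h2
  exact ⟨h3.1, h3.2.trans_eq (by ring)⟩

/-! ### From the hypotheses on the solution to one common bound. -/

lemma le_sq_of_rpow_half_le {x y : ℝ≥0∞} (h : x ^ (1 / 2 : ℝ) ≤ y) : x ≤ y ^ 2 := by
  have : x = (x ^ (1 / 2 : ℝ)) ^ 2 := by
    rw [← ENNReal.rpow_natCast, ← ENNReal.rpow_mul]; norm_num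
  rw [this]
  gcongr

lemma l2Norm_le_sobolevNormSq (a b : ℝ) {r j : ℕ} (hj : j ≤ r) (w : ℝ → ℝ) :
    l2Norm a b (iteratedDeriv j w) ^ 2 ≤ sobolevNormSq a b r w :=
  Finset.single_le_sum (f := fun j => l2Norm a b (iteratedDeriv j w) ^ 2)
    (fun _ _ => zero_le) (Finset.mem_range.2 (Nat.lt_succ_of_le hj))

variable {ε : ℝ} {ρ : ℝ → ℝ → ℝ} {g : ℝ → ℝ → ℝ → ℝ} {M : ℝ≥0}

/-- Some of the hypotheses bound norms by `M`, others bound squared norms; `M² + M` bounds all the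
squares. -/
lemma ofReal_le_bound (M : ℝ≥0) :
    (M : ℝ≥0∞) ≤ ENNReal.ofReal (M ^ 2 + M) ∧ (M : ℝ≥0∞) ^ 2 ≤ ENNReal.ofReal (M ^ 2 + M) := by
  have h1 : (M : ℝ≥0∞) = ENNReal.ofReal M := by simp
  rw [h1, ← ENNReal.ofReal_pow M.coe_nonneg]
  constructor <;> refine ENNReal.ofReal_le_ofReal ?_
  · nlinarith [sq_nonneg (M : ℝ)]
  · linarith [M.coe_nonneg]

lemma SolutionBound.fieldBound_rho (hM : SolutionBound m a b T k ρ g M) :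
    FieldBound m a b T k (M ^ 2 + M) fun x _ t => ρ x t where
  nonneg := by positivity
  space j hj t ht := by
    refine le_trans ?_ (ofReal_le_bound M).2
    refine le_trans ?_ (le_sq_of_rpow_half_le (hM.sobolev_rho t ht))
    refine le_trans (le_of_eq ?_) (l2Norm_le_sobolevNormSq a b hj _)
    rw [← tripleNormSq_const (m := m)]
    simp only [tripleNormSq, ← iteratedDeriv_eq_iterate_dxF]
  time j hj t ht := by
    refine le_trans ?_ (ofReal_le_bound M).2
    refine le_trans ?_ (le_sq_of_rpow_half_le (hM.sobolev_dt_rho t ht))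
    refine le_trans (le_of_eq ?_) (l2Norm_le_sobolevNormSq a b hj _)
    rw [← tripleNormSq_const (m := m)]
    simp only [tripleNormSq, ← iteratedDeriv_eq_iterate_dxF]
    rfl
  time_two t ht := by
    refine le_trans ?_ (ofReal_le_bound M).2
    refine le_trans (le_of_eq ?_) (pow_le_pow_left' (hM.dtt_rho t ht) 2)
    rw [← tripleNormSq_const (m := m)]
    rfl

lemma SolutionBound.fieldBound_g (hM : SolutionBound m a b T k ρ g M) :
    FieldBound m a b T k (M ^ 2 + M) g where
  nonneg := by positivity
  space j hj t ht := by
    refine le_trans ?_ ((hM.sobolev_g t ht).trans (ofReal_le_bound M).1)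
    refine lintegral_mono fun v => ?_
    simp only [← iteratedDeriv_eq_iterate_dxF]
    exact l2Norm_le_sobolevNormSq a b hj _
  time j hj t ht := by
    refine le_trans ?_ ((hM.sobolev_dt_g t ht).trans (ofReal_le_bound M).1)
    refine lintegral_mono fun v => ?_
    simp only [← iteratedDeriv_eq_iterate_dxF]
    exact l2Norm_le_sobolevNormSq a b hj _
  time_two t ht :=
    (le_sq_of_rpow_half_le (hM.dtt_g t ht)).trans (ofReal_le_bound M).2

/-- The regular solutions of the micro-macro system for the velocities in `S`. -/
structure SolutionOn (m : Model) (ε a b T : ℝ) (k : ℕ) (ρ : ℝ → ℝ → ℝ) (g : ℝ → ℝ → ℝ → ℝ)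
    (B : ℝ) (S : Set ℝ) : Prop where
  measurableSet : MeasurableSet S
  ae_mem : ∀ᵐ v ∂m.measure, v ∈ S
  abs_le : ∀ v ∈ S, |v| ≤ 1
  field_rho : SmoothField S T (k + 2) fun x _ t => ρ x t
  field_g : SmoothField S T (k + 2) g
  bound_rho : FieldBound m a b T k B fun x _ t => ρ x t
  bound_g : FieldBound m a b T k B g
  periodic_rho : ∀ t ∈ Set.Icc 0 T, ρ b t = ρ a t
  periodic_g : ∀ v ∈ S, ∀ t ∈ Set.Icc 0 T, g b v t = g a v t
  memLp_g : ∀ t ∈ Set.Icc 0 T, ∀ x, MemLp (fun v => g x v t) 2 m.measure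
  avg_g : ∀ t ∈ Set.Icc 0 T, ∀ x, ∫ v, g x v t ∂m.measure = 0
  macro_eq : ∀ t ∈ Set.Icc 0 T, ∀ x,
    HasDerivAt (fun y => ∫ v, v * g y v t ∂m.measure) (-(dt T ρ x t)) x
  micro_eq : ∀ v ∈ S, ∀ t ∈ Set.Icc 0 T, ∀ x,
    ε ^ 2 * dtF T g x v t + ε * (v * dxF g x v t - ∫ w, w * dxF g x w t ∂m.measure)
      + v * dx ρ x t + g x v t = 0

/-- All exceptional sets of velocities are removed at once, which leaves a measurable set on which
the conditions hold for every `x` and `t`. The micro equation is multiplied by `ε²`. -/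
lemma IsSmoothSolution.exists_solutionOn (hε : 0 < ε)
    (h : IsSmoothSolution m ε a b T (k + 2) ρ g) (hM : SolutionBound m a b T k ρ g M) :
    ∃ S, SolutionOn m ε a b T k ρ g (M ^ 2 + M) S := by
  obtain ⟨S, hS1, hS2, hS3⟩ := ((h.contDiff_g.and (h.periodic_g.and
    (h.micro_eq.and m.ae_abs_le_one)))).exists_measurable_mem
  refine ⟨S, hS2, hS1, fun v hv => (hS3 v hv).2.2.2, smoothField_const (by exact_mod_cast h.contDiff_rho) hS2,
    ⟨?_, fun v hv => by exact_mod_cast (hS3 v hv).1⟩, hM.fieldBound_rho, hM.fieldBound_g, fun t ht => ?_, fun v hv t ht => ?_,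
    h.memLp_g, h.avg_g, h.macro_eq, fun v hv t ht x => ?_⟩
  · exact h.measurable_g.indicator ((measurable_fst.comp measurable_snd hS2).inter
      (measurable_snd.comp measurable_snd measurableSet_Icc))
  · simpa using h.periodic_rho t ht a
  · simpa using (hS3 v hv).2.1 t ht a
  · have := (hS3 v hv).2.2.1 t ht x
    simp only [dtF, dxF]
    field_simp at this
    linarith

end

/-! ### Projections of fields and averages in `v` -/

section
variable {m : Model} {a b T ε : ℝ} {N : ℕ} [NeZero N] {k : ℕ} {C C' B : ℝ} {S : Set ℝ}
  {ρ : ℝ → ℝ → ℝ} {g : ℝ → ℝ → ℝ → ℝ}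

lemma SolutionOn.slice_g (hs : SolutionOn m ε a b T k ρ g B S) {t : ℝ} (ht : t ∈ Set.Icc 0 T) :
    SliceField S fun x v => g x v t := hs.field_g.slice ht

lemma SolutionOn.tripleNormSq_g_ne_top (hs : SolutionOn m ε a b T k ρ g B S) {t : ℝ}
    (ht : t ∈ Set.Icc 0 T) : tripleNormSq m a b (fun x v => g x v t) ≠ ∞ :=
  ((hs.bound_g.space 0 (Nat.zero_le _) t ht).trans_lt ENNReal.ofReal_lt_top).ne

lemma SolutionOn.contDiff_g (hs : SolutionOn m ε a b T k ρ g B S) {v : ℝ} (hv : v ∈ S) {t : ℝ}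
    (ht : t ∈ Set.Icc 0 T) : ContDiff ℝ (k + 1) fun x => g x v t :=
  (hs.field_g.contDiff_slice hv ht).of_le (by exact_mod_cast Nat.le_succ _)

lemma SolutionOn.nonempty (hs : SolutionOn m ε a b T k ρ g B S) : S.Nonempty :=
  hs.ae_mem.exists

lemma SolutionOn.contDiff_rho (hs : SolutionOn m ε a b T k ρ g B S) {t : ℝ}
    (ht : t ∈ Set.Icc 0 T) : ContDiff ℝ (k + 1) fun x => ρ x t :=
  (hs.field_rho.contDiff_slice hs.nonempty.some_mem ht).of_le (by exact_mod_cast Nat.le_succ _)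

/-- A projection chosen separately for each `v` would not be known to be measurable. Here one linear
operator per element serves all `v`, so the coefficients are fixed combinations of moments and point
values of `g`, which are square integrable in `v`. -/
lemma SolutionOn.exists_dgProjection (hs : SolutionOn m ε a b T k ρ g B S) (hab : a < b)
    (hC : AreInverseConstants k C C') (fl : Flux) :
    ∃ G : ℝ → ℝ → PiecewisePoly N, ∀ t ∈ Set.Icc 0 T, L2DG m k (G t) ∧
      ∀ v ∈ S, IsProjection fl a b k (fun x => g x v t) (G t v) := by
  choose P hP using fun i : Fin N => exists_projection hC (node_lt_succ (N := N) hab i) fl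
  refine ⟨fun t v i => P i (dof fl k (node a b N i) (node a b N (i + 1)) fun x => g x v t),
    fun t ht => ?_⟩
  have hproj : ∀ v ∈ S, IsProjection fl a b k (fun x => g x v t)
      (fun i => P i (dof fl k (node a b N i) (node a b N (i + 1)) fun x => g x v t)) :=
    fun v hv i => hP i _ (hs.contDiff_g hv ht).continuous.continuousOn
  refine ⟨⟨?_, fun i j => ?_⟩, hproj⟩
  · filter_upwards [hs.ae_mem] with v hv using (hproj v hv).inDG
  · have hd : ∀ l, MemLp (fun v => dof fl k (node a b N i) (node a b N (i + 1))
        (fun x => g x v t) l) 2 m.measure := fun l => by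
      have hm : ∀ n : ℕ, MemLp (fun v => ∫ x in (node a b N i)..(node a b N (i + 1)),
          g x v t * x ^ n) 2 m.measure := fun n =>
        (hs.slice_g ht).memLp_moment hab hs.ae_mem (hs.tripleNormSq_g_ne_top ht)
          (node_lt_succ hab i).le (element_subset_Icc hab i) (continuous_pow n)
      unfold dof
      split_ifs
      · exact hm l
      · cases fl
        · exact hs.memLp_g t ht _
        · exact hs.memLp_g t ht _
        · exact hm k
    have e : (fun v => (P i (dof fl k (node a b N i) (node a b N (i + 1))
        fun x => g x v t)).coeff j) = fun v => ∑ l, (P i (fun l' => if l = l' then 1 else 0)).coeff j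
          * dof fl k (node a b N i) (node a b N (i + 1)) (fun x => g x v t) l := by
      ext v
      rw [LinearMap.pi_apply_eq_sum_univ (P i), Polynomial.finsetSum_coeff]
      refine Finset.sum_congr rfl fun l _ => ?_
      rw [Polynomial.coeff_smul, smul_eq_mul, mul_comm]
    exact e ▸ memLp_finsetSum _ fun l _ => (hd l).const_mul _

lemma polynomial_eq_zero_of_Icc {c d : ℝ} (hcd : c < d) {p : ℝ[X]}
    (h : ∀ x ∈ Set.Icc c d, p.eval x = 0) : p = 0 :=
  Polynomial.eq_zero_of_infinite_isRoot p ((Set.Icc_infinite hcd).mono h)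

lemma IsProjection.eq_zero (hab : a < b) (hC : AreInverseConstants k C C') {fl : Flux}
    {w : ℝ → ℝ} (hw : ∀ x, w x = 0) {P : PiecewisePoly N} (h : IsProjection fl a b k w P) :
    P = 0 := by
  obtain rfl : w = fun _ => 0 := funext hw
  ext1 i
  refine polynomial_eq_zero_of_Icc (node_lt_succ (N := N) hab i) fun x hx => ?_
  have := (h i).abs_eval_le hC (node_lt_succ hab i) continuousOn_const (R := 0) (by simp) hx
  rw [mul_zero] at this
  exact abs_nonpos_iff.1 this

lemma eq_zero_of_ip_self (hab : a < b) (hC : AreInverseConstants k C C') {u : PiecewisePoly N}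
    (hu : InDG k u) (h : ip a b u u = 0) : u = 0 := by
  have h0 : ∀ i : Fin N, 0 ≤ ∫ x in (node a b N i)..(node a b N (i + 1)),
      (u i).eval x * (u i).eval x := fun i =>
    intervalIntegral.integral_nonneg (node_lt_succ hab i).le fun x _ => mul_self_nonneg _
  ext1 i
  refine polynomial_eq_zero_of_Icc (node_lt_succ (N := N) hab i) fun x hx => ?_
  have h1 := (Finset.sum_eq_zero_iff_of_nonneg fun i _ => h0 i).1 h i (Finset.mem_univ _)
  have h2 := sq_eval_mul_le hC (node_lt_succ hab i) (hu i) hx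
  simp only [sq] at h2
  rw [h1, mul_zero] at h2
  have h3 := sub_pos.2 (node_lt_succ (N := N) hab i)
  have : (u i).eval x * (u i).eval x ≤ 0 := nonpos_of_mul_nonpos_left h2 h3
  exact mul_self_eq_zero.1 (le_antisymm this (mul_self_nonneg _))

lemma ip_single (u : PiecewisePoly N) (i : Fin N) (p : ℝ[X]) :
    ip a b u (Pi.single i p)
      = ∫ x in (node a b N i)..(node a b N (i + 1)), (u i).eval x * p.eval x := by
  rw [ip, Finset.sum_eq_single i]
  · simp
  · intro j _ hj; simp [hj]
  · simp

/-- The point evaluation on element `i`. -/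
noncomputable def evalL (i : Fin N) (x : ℝ) : PiecewisePoly N →ₗ[ℝ] ℝ :=
  (Polynomial.leval x).comp (LinearMap.proj i)

lemma L2DG.eval_avg {G : ℝ → PiecewisePoly N} (hG : L2DG m k G) {f : ℝ → ℝ}
    (hf : MemLp f 2 m.measure) (i : Fin N) (x : ℝ) :
    (avg m k f G i).eval x = ∫ v, f v * (G v i).eval x ∂m.measure :=
  (hG.integral_map hf (evalL i x)).symm

lemma integral_eval_sub_mul {q : ℝ → ℝ} (hq : Continuous q) (P p : ℝ[X]) (c d : ℝ) :
    ∫ x in c..d, (P.eval x - q x) * p.eval x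
      = (∫ x in c..d, P.eval x * p.eval x) - ∫ x in c..d, q x * p.eval x := by
  have h := intervalIntegral.integral_sub (μ := volume) (a := c) (b := d)
    ((P.continuous.mul p.continuous).intervalIntegrable _ _)
    ((hq.mul p.continuous).intervalIntegrable _ _)
  simp only [Pi.mul_apply] at h
  rw [← h]
  simp only [sub_mul]

/-- Averages of projections are projections of averages. -/
lemma isProjection_avg {D : ℝ → ℝ → ℝ} (hab : a < b) (hS : ∀ᵐ v ∂m.measure, v ∈ S)
    (hD : SliceField S D) (hD2 : tripleNormSq m a b D ≠ ∞) {fl : Flux} {G : ℝ → PiecewisePoly N}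
    (hG : L2DG m k G) (hGD : ∀ᵐ v ∂m.measure, IsProjection fl a b k (fun x => D x v) (G v))
    {f : ℝ → ℝ} (hf : Measurable f) (hf1 : ∀ v, |v| ≤ 1 → |f v| ≤ 1)
    (hq : Continuous fun x => ∫ v, f v * D x v ∂m.measure) :
    IsProjection fl a b k (fun x => ∫ v, f v * D x v ∂m.measure) (avg m k f G) := by
  have hf2 : MemLp f 2 m.measure := memLp_of_abs_le_one hf hf1
  refine fun i => ⟨avg_inDG m k f G i, fun p hp => ?_, fun h => ?_, fun h => ?_⟩
  · rw [integral_eval_sub_mul hq, ← ip_single, ← hD.integral_moment hS hD2 (node_lt_succ hab i).le (element_subset_Icc hab i)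
      p.continuous hf hf1]
    have := hG.integral_map hf2 ((ipL a b).flip (Pi.single i p))
    simp only [LinearMap.flip_apply, ipL_apply] at this
    rw [← this, sub_eq_zero]
    refine integral_congr_ae ?_
    filter_upwards [hGD, hS] with v hv hvS
    have h1 := (hv i).orth p hp
    rw [integral_eval_sub_mul (hD.continuous v hvS), ← ip_single] at h1
    congr 1
    linarith
  · rw [hG.eval_avg hf2]
    refine integral_congr_ae ?_
    filter_upwards [hGD] with v hv
    rw [(hv i).left h]
  · rw [hG.eval_avg hf2]
    refine integral_congr_ae ?_
    filter_upwards [hGD] with v hv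
    rw [(hv i).right h]

lemma IsProjection.sub {fl : Flux} {w w' : ℝ → ℝ} (hw : Continuous w) (hw' : Continuous w')
    {P P' : PiecewisePoly N} (h : IsProjection fl a b k w P) (h' : IsProjection fl a b k w' P') :
    IsProjection fl a b k (fun x => w x - w' x) (P - P') := by
  refine fun i => ⟨(h.inDG.sub h'.inDG) i, fun p hp => ?_, fun e => ?_, fun e => ?_⟩
  · have h1 := (h i).orth p hp
    have h2 := (h' i).orth p hp
    have e : ∀ x, ((((P - P') i).eval x) - (w x - w' x)) * p.eval x
        = ((P i).eval x - w x) * p.eval x - ((P' i).eval x - w' x) * p.eval x := fun x => by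
      simp only [Pi.sub_apply, Polynomial.eval_sub]; ring
    simp only [e]
    rw [intervalIntegral.integral_sub, h1, h2, sub_zero]
    · exact (((P i).continuous.sub hw).mul p.continuous).intervalIntegrable _ _
    · exact (((P' i).continuous.sub hw').mul p.continuous).intervalIntegrable _ _
  · simp [(h i).left e, (h' i).left e]
  · simp [(h i).right e, (h' i).right e]

/-- The form `a_h` sees `g` only through `⟨vg⟩`, so it is `d_h` for a single piecewise polynomial
and the exchanged flux. -/
lemma L2DG.aForm_eq {G : ℝ → PiecewisePoly N} (hG : L2DG m k G) (fl : Flux) (φ : PiecewisePoly N) :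
    aForm m fl a b G φ = -dForm fl.swap a b (avg m k (fun v => v) G) φ := by
  have e1 : ∀ i x, ∫ v, v * (G v i).eval x ∂m.measure = (avg m k (fun v => v) G i).eval x :=
    fun i x => (hG.eval_avg memLp_id i x).symm
  simp only [aForm, dForm, ipDeriv, traceMinus, tracePlus, e1, Flux.hatVG_eq]
  ring

lemma L2DG.integral_eq {G : ℝ → PiecewisePoly N} (hG : L2DG m k G)
    (L : PiecewisePoly N →ₗ[ℝ] ℝ) : ∫ v, L (G v) ∂m.measure = L (avg m k (fun _ => 1) G) := by
  have := hG.integral_map (f := fun _ => 1) (memLp_const 1) L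
  simpa using this

/-- The part `Π` of the transport term is a linear functional that does not depend on `v`; it
therefore vanishes on families of mean zero. -/
lemma integral_upwindForm_eq {G : ℝ → PiecewisePoly N} (hG : L2DG m k G) :
    ∃ L : PiecewisePoly N →ₗ[ℝ] ℝ,
      ∀ ψ, ∫ w, upwindForm a b w (G w) ψ ∂m.measure = L ψ := by
  have hf : ∀ f : ℝ → ℝ, Measurable f → (∀ v, |v| ≤ 1 → |f v| ≤ 1) → ∀ (fl : Flux) ψ,
      Integrable (fun v => f v * dForm fl a b (G v) ψ) m.measure
      ∧ ∫ v, f v * dForm fl a b (G v) ψ ∂m.measure = dL a b fl (avg m k f G) ψ := by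
    intro f hf hf1 fl ψ
    have h2 : MemLp f 2 m.measure := memLp_of_abs_le_one hf hf1
    have h3 := hG.integral_map h2 ((dL a b fl).flip ψ)
    have h4 := h2.integrable_mul (hG.memLp_map ((dL a b fl).flip ψ))
    simp only [LinearMap.flip_apply, dL_apply] at h3 h4 ⊢
    exact ⟨h4, h3⟩
  have hmax := hf (fun v => max v 0) (by fun_prop) fun v hv => by
    rw [abs_of_nonneg (le_max_right _ _)]; exact max_le (abs_le.1 hv).2 zero_le_one
  have hmin := hf (fun v => min v 0) (by fun_prop) fun v hv => by
    rw [abs_of_nonpos (min_le_right _ _), neg_le]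
    exact le_min (abs_le.1 hv).1 (by norm_num)
  refine ⟨-(dL a b .rightLeft (avg m k (fun v => max v 0) G)
    + dL a b .leftRight (avg m k (fun v => min v 0) G)), fun ψ => ?_⟩
  simp only [upwindForm_eq]
  rw [integral_neg, integral_add (hmax _ ψ).1 (hmin _ ψ).1, (hmax _ ψ).2, (hmin _ ψ).2]
  simp

/-! ### The scheme without denominators, and conservation of `⟨g⟩ = 0`. -/

variable {fl : Flux} {τ : ℝ} {ρ₀ : ℝ → ℝ} {g₀ : ℝ → ℝ → ℝ} {ρh : ℕ → PiecewisePoly N}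
  {gh : ℕ → ℝ → PiecewisePoly N}

lemma IsDGIMEX1.l2DG (h : IsDGIMEX1 m fl ε a b τ k ρ₀ g₀ ρh gh) (n : ℕ) : L2DG m k (gh n) :=
  ⟨h.inDG_g n, h.memLp_g n⟩

/-- The scheme for `g`, multiplied by `ε² τ`. -/
lemma IsDGIMEX1.step_g' (h : IsDGIMEX1 m fl ε a b τ k ρ₀ g₀ ρh gh) (hε : 0 < ε) (hτ : 0 < τ)
    (n : ℕ) : ∀ᵐ v ∂m.measure, ∀ ψ, InDG k ψ →
      ε ^ 2 * ip a b (gh (n + 1) v - gh n v) ψ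
        + τ * ε * (upwindForm a b v (gh n v) ψ - ∫ w, upwindForm a b w (gh n w) ψ ∂m.measure)
        - τ * (v * dForm fl a b (ρh (n + 1)) ψ) + τ * ip a b (gh (n + 1) v) ψ = 0 := by
  filter_upwards [h.step_g n] with v hv ψ hψ
  have h1 := hv ψ hψ
  have h2 : ip a b ((1 / τ) • (gh (n + 1) v - gh n v)) ψ
      = 1 / τ * ip a b (gh (n + 1) v - gh n v) ψ := by
    rw [← ipL_apply, map_smul, LinearMap.smul_apply, ipL_apply, smul_eq_mul]
  rw [h2, bForm] at h1
  field_simp at h1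
  linarith

lemma IsDGIMEX1.step_rho' (h : IsDGIMEX1 m fl ε a b τ k ρ₀ g₀ ρh gh) (hτ : 0 < τ) (n : ℕ)
    {φ : PiecewisePoly N} (hφ : InDG k φ) :
    ip a b (ρh (n + 1) - ρh n) φ = τ * dForm fl.swap a b (avg m k (fun v => v) (gh n)) φ := by
  have h1 := h.step_rho n φ hφ
  rw [(h.l2DG n).aForm_eq, ← ipL_apply, map_smul, LinearMap.smul_apply, ipL_apply, smul_eq_mul]
    at h1
  field_simp at h1
  linarith

/-- The numerical solution keeps `⟨g⟩ = 0`. -/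
lemma IsDGIMEX1.avg_eq_zero (hab : a < b) (hC : AreInverseConstants k C C') (hε : 0 < ε)
    (hτ : 0 < τ) (h : IsDGIMEX1 m fl ε a b τ k ρ₀ g₀ ρh gh)
    (h0 : avg m k (fun _ => 1) (gh 0) = 0) (n : ℕ) : avg m k (fun _ => 1) (gh n) = 0 := by
  induction n with
  | zero => exact h0
  | succ n ih =>
    set A := avg m k (fun _ => 1) (gh (n + 1)) with hA
    have hAdg : InDG k A := avg_inDG _ _ _ _
    have hip : ∀ j, ∫ v, ip a b (gh j v) A ∂m.measure = ip a b (avg m k (fun _ => 1) (gh j)) A :=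
      fun j => (h.l2DG j).integral_eq ((ipL a b).flip A)
    have hipi : ∀ j, Integrable (fun v => ip a b (gh j v) A) m.measure := fun j =>
      ((h.l2DG j).memLp_map ((ipL a b).flip A)).integrable (by norm_num)
    have hsub : ∀ u w : PiecewisePoly N, ip a b (u - w) A = ip a b u A - ip a b w A :=
      fun u w => by rw [← ipL_apply, map_sub, LinearMap.sub_apply, ipL_apply, ipL_apply]
    have hup : Integrable (fun v => upwindForm a b v (gh n v) A) m.measure := by
      refine (h.l2DG n).integrable_upwindForm (Z := fun _ => A)
        ⟨Filter.Eventually.of_forall fun _ => hAdg, fun i j => memLp_const _⟩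
    have hv : Integrable (fun v : ℝ => v) m.measure := memLp_id.integrable (by norm_num)
    -- The scheme tested with its own new mean, then averaged: transport cancels against its mean,
    -- `⟨v⟩ = 0` removes `d_h`, and the old mean is zero, which leaves `(ε² + τ) ‖A‖² = 0`.
    have e : ∫ v, (ε ^ 2 * (ip a b (gh (n + 1) v) A - ip a b (gh n v) A)
        + τ * ε * (upwindForm a b v (gh n v) A - ∫ w, upwindForm a b w (gh n w) A ∂m.measure)
        - τ * (v * dForm fl a b (ρh (n + 1)) A) + τ * ip a b (gh (n + 1) v) A) ∂m.measure = 0 := by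
      refine integral_eq_zero_of_ae ?_
      filter_upwards [h.step_g' hε hτ n] with v hv
      have := hv A hAdg
      rwa [hsub] at this
    have i1 : Integrable (fun v => ε ^ 2 * (ip a b (gh (n + 1) v) A - ip a b (gh n v) A))
      m.measure := ((hipi _).sub (hipi _)).const_mul _
    have i2 : Integrable (fun v => τ * ε * (upwindForm a b v (gh n v) A
      - ∫ w, upwindForm a b w (gh n w) A ∂m.measure)) m.measure :=
      (hup.sub (integrable_const _)).const_mul _
    have i3 : Integrable (fun v => τ * (v * dForm fl a b (ρh (n + 1)) A)) m.measure :=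
      (hv.mul_const _).const_mul _
    have i4 : Integrable (fun v => τ * ip a b (gh (n + 1) v) A) m.measure := (hipi _).const_mul _
    have i12 : Integrable (fun v => ε ^ 2 * (ip a b (gh (n + 1) v) A - ip a b (gh n v) A)
      + τ * ε * (upwindForm a b v (gh n v) A
        - ∫ w, upwindForm a b w (gh n w) A ∂m.measure)) m.measure := i1.add i2
    have i123 : Integrable (fun v => ε ^ 2 * (ip a b (gh (n + 1) v) A - ip a b (gh n v) A)
      + τ * ε * (upwindForm a b v (gh n v) A
        - ∫ w, upwindForm a b w (gh n w) A ∂m.measure)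
      - τ * (v * dForm fl a b (ρh (n + 1)) A)) m.measure := i12.sub i3
    rw [integral_add i123 i4, integral_sub i12 i3, integral_add i1 i2,
      integral_const_mul, integral_const_mul, integral_const_mul, integral_const_mul,
      integral_sub (hipi _) (hipi _), integral_sub hup (integrable_const _), integral_mul_const,
      m.integral_id, hip, hip, ih, ← hA] at e
    have z : ip a b 0 A = 0 := by rw [← ipL_apply]; simp
    rw [z] at e
    simp only [integral_const, probReal_univ, smul_eq_mul] at e
    have hpos : 0 < ε ^ 2 + τ := by positivity
    have : (ε ^ 2 + τ) * ip a b A A = 0 := by linarith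
    exact eq_zero_of_ip_self hab hC hAdg ((mul_eq_zero.1 this).resolve_left hpos.ne')

end

/-! ### Consistency of the scheme -/

section
variable {m : Model} {a b T ε : ℝ} {N : ℕ} [NeZero N] {k : ℕ} {C C' B : ℝ} {S : Set ℝ}
  {ρ : ℝ → ℝ → ℝ} {g : ℝ → ℝ → ℝ → ℝ} {fl : Flux} {t t' : ℝ}

lemma SolutionOn.sqInt_rho_le (hs : SolutionOn m ε a b T k ρ g B S) (hab : a < b) (hT : 0 < T)
    {j : ℕ} (hj : j ≤ k + 1) (ht : t ∈ Set.Icc 0 T) :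
    sqInt a b (iteratedDeriv j fun x => ρ x t) ≤ B := by
  simpa using (hs.bound_rho.integral_space hab hs.ae_mem hT hs.field_rho hj ht).2

lemma SolutionOn.sqInt_rho_sub_le (hs : SolutionOn m ε a b T k ρ g B S) (hab : a < b) (hT : 0 < T)
    {j : ℕ} (hj : j ≤ k + 1) (ht : 0 ≤ t) (htt : t ≤ t') (ht' : t' ≤ T) :
    sqInt a b (iteratedDeriv j fun x => ρ x t' - ρ x t) ≤ (t' - t) ^ 2 * B := by
  simpa using (hs.bound_rho.integral_sub hab hs.measurableSet hs.ae_mem hT hs.field_rho hj ht htt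
    ht').2

lemma SolutionOn.sqInt_rho_taylor_le (hs : SolutionOn m ε a b T k ρ g B S) (hab : a < b)
    (hT : 0 < T) (ht : 0 ≤ t) (htt : t ≤ t') (ht' : t' ≤ T) :
    sqInt a b (fun x => ρ x t' - ρ x t - (t' - t) * dt T ρ x t) ≤ (t' - t) ^ 4 * B := by
  have := (hs.bound_rho.integral_taylor hab hs.measurableSet hs.ae_mem hT hs.field_rho ht htt
    ht').2
  simpa [dtF] using this

lemma SolutionOn.continuous_dt_rho (hs : SolutionOn m ε a b T k ρ g B S) (hT : 0 < T)
    (ht : t ∈ Set.Icc 0 T) : Continuous fun x => dt T ρ x t :=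
  ((SmoothField.dtF (r := k + 1) hs.measurableSet hT hs.field_rho).contDiff_slice
    hs.nonempty.some_mem ht).continuous

lemma SolutionOn.continuous_dx_rho (hs : SolutionOn m ε a b T k ρ g B S) (hT : 0 < T)
    (ht : t ∈ Set.Icc 0 T) : Continuous fun x => dx ρ x t :=
  ((SmoothField.dxF (r := k + 1) hT hs.field_rho).contDiff_slice
    hs.nonempty.some_mem ht).continuous

lemma sqrt_le_mul_sqrt {x y c : ℝ} (hc : 0 ≤ c) (h : x ≤ c ^ 2 * y) : √x ≤ c * √y := by
  refine (Real.sqrt_le_sqrt h).trans_eq ?_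
  rw [Real.sqrt_mul (sq_nonneg c), Real.sqrt_sq hc]

/-- The projection of the flux `⟨vg⟩` is consistent. -/
lemma SolutionOn.abs_dForm_avg_sub_le (hs : SolutionOn m ε a b T k ρ g B S) (hab : a < b)
    (hT : 0 < T) (hC : AreInverseConstants k C C') (ht : t ∈ Set.Icc 0 T)
    {G : ℝ → PiecewisePoly N} (hG : L2DG m k G)
    (hGp : ∀ v ∈ S, IsProjection fl a b k (fun x => g x v t) (G v))
    {φ : PiecewisePoly N} (hφ : InDG k φ) :
    |dForm fl a b (avg m k (fun v => v) G) φ - pint a b (fun x => dt T ρ x t) φ|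
      ≤ errConst C * fl.rate k (meshSize a b N) * √B * nrm a b φ := by
  set Q := avg m k (fun v => v) G with hQ
  set q : ℝ → ℝ := fun x => ∫ v, v * g x v t ∂m.measure with hqdef
  have hq : ∀ x, HasDerivAt q (-(dt T ρ x t)) x := hs.macro_eq t ht
  have hqc : Continuous q := continuous_iff_continuousAt.2 fun x => (hq x).continuousAt
  have hqb : q b = q a := by
    refine integral_congr_ae ?_
    filter_upwards [hs.ae_mem] with v hv
    rw [hs.periodic_g v hv t ht]
  have hQp : IsProjection fl a b k q Q :=
    isProjection_avg hab hs.ae_mem (hs.slice_g ht) (hs.tripleNormSq_g_ne_top ht) hG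
      (hs.ae_mem.mono hGp) (f := fun v => v) measurable_id (fun _ h => h) hqc
  have h1 := dForm_add_pint hab fl hq (hs.continuous_dt_rho hT ht).neg hqb hQp hφ
  have h2 : pint a b (fun x => -(dt T ρ x t)) φ = -pint a b (fun x => dt T ρ x t) φ := by
    have := pint_const_mul (a := a) (b := b) (-1) (fun x => dt T ρ x t) φ
    simpa using this
  rw [h2, ← sub_eq_add_neg] at h1
  rw [h1]
  have hh := (meshSize_pos (N := N) hab).le
  -- The average `⟨vg⟩` is only known to be differentiable once, so the trace error is not estimated
  -- from its own regularity: it is an average of trace errors of `g(·, v)`, and Cauchy–Schwarz in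
  -- `v` applies.
  by_cases hfl : fl = .central
  · have hX := hs.bound_g.integral_space hab hs.ae_mem hT hs.field_g le_rfl ht
    have hr : fl.rate k (meshSize a b N) = meshSize a b N ^ k := by subst hfl; rfl
    rw [hr]
    refine abs_sum_mul_jump_le hab hC ?_ hφ
    have hm : ∀ i : Fin N, MemLp (fun v => hatL a b fl i (G v) - g (node a b N i) v t) 2
        m.measure := fun i => (hG.memLp_map _).sub (hs.memLp_g t ht _)
    have he : ∀ i : Fin N, fl.hatRho (traceMinus a b Q i) (tracePlus a b Q i) - q (node a b N i)
        = ∫ v, v * (hatL a b fl i (G v) - g (node a b N i) v t) ∂m.measure := fun i => by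
      have i1 : Integrable (fun v => v * hatL a b fl i (G v)) m.measure :=
        memLp_id.integrable_mul (hG.memLp_map _)
      have i2 : Integrable (fun v => v * g (node a b N i) v t) m.measure :=
        memLp_id.integrable_mul (hs.memLp_g t ht _)
      rw [← hatL_apply, hQ, ← hG.integral_map memLp_id, hqdef, ← integral_sub i1 i2]
      simp only [mul_sub]
    calc ∑ i : Fin N, (fl.hatRho (traceMinus a b Q i) (tracePlus a b Q i) - q (node a b N i)) ^ 2
        ≤ ∑ i : Fin N, ∫ v, (hatL a b fl i (G v) - g (node a b N i) v t) ^ 2 ∂m.measure := by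
          refine Finset.sum_le_sum fun i _ => ?_
          rw [he i]
          refine (sq_integral_mul_le memLp_id (hm i)).trans ?_
          exact mul_le_of_le_one_left (integral_nonneg fun v => sq_nonneg _) m.integral_sq_le_one
      _ = ∫ v, ∑ i : Fin N, (hatL a b fl i (G v) - g (node a b N i) v t) ^ 2 ∂m.measure :=
          (integral_finsetSum _ fun i _ => (hm i).integrable_sq).symm
      _ ≤ ∫ v, (1 + projConst C) ^ 2 * meshSize a b N ^ (2 * k + 1)
            * sqInt a b (iteratedDeriv (k + 1) fun x => g x v t) ∂m.measure := by
          refine integral_mono_ae (integrable_finsetSum _ fun i _ => (hm i).integrable_sq)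
            (hX.1.const_mul _) ?_
          filter_upwards [hs.ae_mem] with v hv
          simp only [hatL_apply]
          exact (hGp v hv).sum_hatRho_sub_sq_le hab hC fl (hs.contDiff_g hv ht)
            (hs.periodic_g v hv t ht)
      _ ≤ (1 + projConst C) ^ 2 * meshSize a b N ^ (2 * k + 1) * B := by
          rw [integral_const_mul]
          exact mul_le_mul_of_nonneg_left hX.2 (by positivity)
  · have : ∀ i : Fin N, (fl.hatRho (traceMinus a b Q i) (tracePlus a b Q i)
        - q (node a b N i)) * jump a b φ i = 0 := fun i => by
      rw [hQp.hatRho_eq hfl hqb i, sub_self, zero_mul]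
    simp only [this, Finset.sum_const_zero, abs_zero]
    have := errConst_nonneg hC
    have := fl.rate_nonneg k hh
    have := nrm_nonneg (a := a) (b := b) φ
    positivity

/-- The residual of the scheme for `ρ`. -/
lemma SolutionOn.abs_macro_residual_le (hs : SolutionOn m ε a b T k ρ g B S) (hab : a < b)
    (hT : 0 < T) (hC : AreInverseConstants k C C') (ht : 0 ≤ t) (htt : t ≤ t') (ht' : t' ≤ T)
    {fl' : Flux} (hfl : fl'.rate k (meshSize a b N) = fl.rate k (meshSize a b N))
    {G : ℝ → PiecewisePoly N} (hG : L2DG m k G)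
    (hGp : ∀ v ∈ S, IsProjection fl' a b k (fun x => g x v t) (G v)) {P P' : PiecewisePoly N}
    (hP : IsProjection fl a b k (fun x => ρ x t) P)
    (hP' : IsProjection fl a b k (fun x => ρ x t') P') {φ : PiecewisePoly N} (hφ : InDG k φ) :
    |(t' - t) * dForm fl' a b (avg m k (fun v => v) G) φ - ip a b (P' - P) φ|
      ≤ (t' - t) * (√B * (t' - t) + 2 * errConst C * fl.rate k (meshSize a b N) * √B)
        * nrm a b φ := by
  have hτ : 0 ≤ t' - t := sub_nonneg.2 htt
  have htm : t ∈ Set.Icc 0 T := ⟨ht, htt.trans ht'⟩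
  have htm' : t' ∈ Set.Icc 0 T := ⟨ht.trans htt, ht'⟩
  have hc := hs.contDiff_rho htm
  have hc' := hs.contDiff_rho htm'
  have hd := hs.continuous_dt_rho hT htm
  have hφ0 := nrm_nonneg (a := a) (b := b) φ
  have h1 := hs.abs_dForm_avg_sub_le hab hT hC htm hG hGp hφ
  have h2 := (hP'.sub hc'.continuous hc.continuous hP).abs_ip_sub_pint_le_rate hab hC
    (hc'.sub hc) hφ
  have h2' := sqrt_le_mul_sqrt hτ (hs.sqInt_rho_sub_le hab hT le_rfl ht htt ht')
  have h3 := abs_pint_le hab (((hc'.continuous.sub hc.continuous).sub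
    (continuous_const.mul hd)).continuousOn) φ (f := fun x => ρ x t' - ρ x t - (t' - t) * dt T ρ x t)
  have h3' : √(sqInt a b fun x => ρ x t' - ρ x t - (t' - t) * dt T ρ x t)
      ≤ (t' - t) ^ 2 * √B := by
    refine sqrt_le_mul_sqrt (sq_nonneg _) ?_
    exact (hs.sqInt_rho_taylor_le hab hT ht htt ht').trans_eq (by ring)
  rw [pint_sub hab (f := fun x => ρ x t' - ρ x t) (g := fun x => (t' - t) * dt T ρ x t)
    (hc'.continuous.sub hc.continuous).continuousOn (continuous_const.mul hd).continuousOn,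
    pint_const_mul] at h3
  rw [hfl] at h1
  have hK : 0 ≤ errConst C * fl.rate k (meshSize a b N) :=
    mul_nonneg (errConst_nonneg hC) (fl.rate_nonneg k (meshSize_pos hab).le)
  have h2'' := h2.trans (mul_le_mul_of_nonneg_right (mul_le_mul_of_nonneg_left h2' hK) hφ0)
  have h3'' := h3.trans (mul_le_mul_of_nonneg_right h3' hφ0)
  -- Three residuals: the flux, the projection of the increment of `ρ`, and the Taylor remainder in
  -- time.
  have e : (t' - t) * dForm fl' a b (avg m k (fun v => v) G) φ - ip a b (P' - P) φ
      = (t' - t) * (dForm fl' a b (avg m k (fun v => v) G) φ - pint a b (fun x => dt T ρ x t) φ)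
        - (ip a b (P' - P) φ - pint a b (fun x => ρ x t' - ρ x t) φ)
        - (pint a b (fun x => ρ x t' - ρ x t) φ
          - (t' - t) * pint a b (fun x => dt T ρ x t) φ) := by ring
  rw [e]
  have h1' := mul_le_mul_of_nonneg_left h1 hτ
  rw [← abs_of_nonneg hτ, ← abs_mul, abs_of_nonneg hτ] at h1'
  refine (abs_sub _ _).trans ((add_le_add ((abs_sub _ _).trans (add_le_add h1' h2'')) h3'').trans_eq ?_)
  ring

end

section
variable {m : Model} {a b T ε : ℝ} {N : ℕ} [NeZero N] {k : ℕ} {C C' B : ℝ} {S : Set ℝ}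
  {ρ : ℝ → ℝ → ℝ} {g : ℝ → ℝ → ℝ → ℝ} {fl : Flux} {t t' : ℝ}

/-! ### The residual of the scheme for `g`. -/

lemma mul_le_young {c : ℝ} (hc : 0 < c) (x y : ℝ) : x * y ≤ c * x ^ 2 + y ^ 2 / (4 * c) := by
  have : c * x ^ 2 + y ^ 2 / (4 * c) - x * y = c * (x - y / (2 * c)) ^ 2 := by field_simp; ring
  nlinarith [mul_nonneg hc.le (sq_nonneg (x - y / (2 * c)))]

/-- The bound of the mean residual of the scheme for `g`. -/
noncomputable def microConst (k : ℕ) (K h r ε τ δ B : ℝ) : ℝ :=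
  ε ^ 2 / 2 * (K ^ 2 * (h ^ (k + 1)) ^ 2 * B)
    + 5 / (2 * δ) * (ε ^ 4 * τ ^ 2 * B + K ^ 2 * r ^ 2 * B + τ ^ 2 * B + K ^ 2 * r ^ 2 * B
      + τ ^ 2 * B)
    + ε / δ * (K ^ 2 * h ^ (2 * k + 1) * B)

/-- Young's inequality with a different partner for each kind of residual. `A₁` goes to `ε² p²`,
which the Gronwall argument tolerates without a factor `1/δ`; `A₃` goes to the upwind dissipation;
the other five share `(δ/2) p²` equally, hence `δ/10`. -/
lemma micro_young {τ δ ε p J A₁ A₂ A₃ A₄ A₅ A₆ A₇ : ℝ} (hτ : 0 < τ) (hδ : 0 < δ) (hε : 0 < ε) :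
    ε ^ 2 * (A₁ * p) + ε ^ 2 * (A₂ * p) + τ * ε * (A₃ * J) + τ * (A₄ * p) + τ * (A₅ * p)
        + τ * (A₆ * p) + τ * (A₇ * p)
      ≤ τ * (ε ^ 2 / 2 * p ^ 2 + δ / 2 * p ^ 2 + δ / 4 * (ε * J ^ 2)
        + (ε ^ 2 / 2 * (A₁ ^ 2 / τ ^ 2)
          + 5 / (2 * δ) * (ε ^ 4 * (A₂ ^ 2 / τ ^ 2) + A₄ ^ 2 + A₅ ^ 2 + A₆ ^ 2 + A₇ ^ 2)
          + ε / δ * A₃ ^ 2)) := by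
  have hδ' : 0 < δ / 10 := by positivity
  have y1 := mul_le_mul_of_nonneg_left (mul_le_young (c := 1 / 2) (by norm_num) p (A₁ / τ))
    (by positivity : 0 ≤ τ * ε ^ 2)
  have y2 := mul_le_mul_of_nonneg_left (mul_le_young hδ' p (ε ^ 2 * A₂ / τ)) hτ.le
  have y3 := mul_le_mul_of_nonneg_left (mul_le_young (by positivity : 0 < δ / 4) J A₃)
    (by positivity : 0 ≤ τ * ε)
  have y4 := mul_le_mul_of_nonneg_left (mul_le_young hδ' p A₄) hτ.le
  have y5 := mul_le_mul_of_nonneg_left (mul_le_young hδ' p A₅) hτ.le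
  have y6 := mul_le_mul_of_nonneg_left (mul_le_young hδ' p A₆) hτ.le
  have y7 := mul_le_mul_of_nonneg_left (mul_le_young hδ' p A₇) hτ.le
  refine le_trans (le_of_eq ?_)
    ((add_le_add (add_le_add (add_le_add (add_le_add (add_le_add (add_le_add y1 y2) y3) y4) y5) y6)
      y7).trans (le_of_eq ?_)) <;> field_simp <;> ring

/-- `⟨v ∂ₓg⟩` is continuous. -/
lemma SolutionOn.continuous_avg_dx (hs : SolutionOn m ε a b T k ρ g B S) (hT : 0 < T) (hε : 0 < ε)
    (ht : t ∈ Set.Icc 0 T) : Continuous fun x => ∫ w, w * dxF g x w t ∂m.measure := by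
  -- No bound of `∂ₓg` uniform in `v` is assumed, so dominated convergence is not at hand. Instead,
  -- the micro equation for one velocity expresses the average by continuous functions.
  obtain ⟨v, hv⟩ := hs.nonempty
  have h1 : Continuous fun x => dtF T g x v t :=
    ((SmoothField.dtF (r := k + 1) hs.measurableSet hT hs.field_g).contDiff_slice hv ht).continuous
  have h2 : Continuous fun x => dxF g x v t :=
    ((SmoothField.dxF (r := k + 1) hT hs.field_g).contDiff_slice hv ht).continuous
  have h3 := hs.continuous_dx_rho hT ht
  have h4 := (hs.contDiff_g hv ht).continuous
  have e : (fun x => ∫ w, w * dxF g x w t ∂m.measure) = fun x =>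
      (ε ^ 2 * dtF T g x v t + ε * (v * dxF g x v t) + v * dx ρ x t + g x v t) / ε := by
    ext x
    have := hs.micro_eq v hv t ht x
    rw [eq_div_iff hε.ne']
    linarith
  rw [e]
  fun_prop

/-- The micro equation tested with a piecewise polynomial. -/
lemma SolutionOn.pint_micro_eq (hs : SolutionOn m ε a b T k ρ g B S) (hab : a < b) (hT : 0 < T)
    (hε : 0 < ε) (ht : t ∈ Set.Icc 0 T) {v : ℝ} (hv : v ∈ S) (ψ : PiecewisePoly N) :
    ε ^ 2 * pint a b (fun x => dtF T g x v t) ψ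
      + ε * (v * pint a b (fun x => dxF g x v t) ψ
        - pint a b (fun x => ∫ w, w * dxF g x w t ∂m.measure) ψ)
      + v * pint a b (fun x => dx ρ x t) ψ + pint a b (fun x => g x v t) ψ = 0 := by
  have h1 : Continuous fun x => dtF T g x v t :=
    ((SmoothField.dtF (r := k + 1) hs.measurableSet hT hs.field_g).contDiff_slice hv ht).continuous
  have h2 : Continuous fun x => dxF g x v t :=
    ((SmoothField.dxF (r := k + 1) hT hs.field_g).contDiff_slice hv ht).continuous
  have h3 := hs.continuous_dx_rho hT ht
  have h4 := (hs.contDiff_g hv ht).continuous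
  have h5 := hs.continuous_avg_dx hT hε ht
  have e := hs.micro_eq v hv t ht
  have z : pint a b (fun x => ε ^ 2 * dtF T g x v t
      + ε * (v * dxF g x v t - ∫ w, w * dxF g x w t ∂m.measure) + v * dx ρ x t + g x v t) ψ = 0 := by
    simp only [e, pint, zero_mul, intervalIntegral.integral_zero, Finset.sum_const_zero]
  rw [pint_add hab (f := fun x => ε ^ 2 * dtF T g x v t
      + ε * (v * dxF g x v t - ∫ w, w * dxF g x w t ∂m.measure) + v * dx ρ x t)
      (g := fun x => g x v t) (by fun_prop) h4.continuousOn,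
    pint_add hab (f := fun x => ε ^ 2 * dtF T g x v t
      + ε * (v * dxF g x v t - ∫ w, w * dxF g x w t ∂m.measure))
      (g := fun x => v * dx ρ x t) (by fun_prop) (by fun_prop),
    pint_add hab (f := fun x => ε ^ 2 * dtF T g x v t)
      (g := fun x => ε * (v * dxF g x v t - ∫ w, w * dxF g x w t ∂m.measure))
      (by fun_prop) (by fun_prop),
    pint_const_mul, pint_const_mul,
    pint_sub hab (f := fun x => v * dxF g x v t)
      (g := fun x => ∫ w, w * dxF g x w t ∂m.measure) (by fun_prop) h5.continuousOn,
    pint_const_mul, pint_const_mul] at z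
  exact z

/-- The residual of the scheme for `g`. -/
lemma SolutionOn.exists_micro_residual_le (hs : SolutionOn m ε a b T k ρ g B S) (hab : a < b)
    (hT : 0 < T) (hε : 0 < ε) (hC : AreInverseConstants k C C') {δ : ℝ} (hδ : 0 < δ)
    (ht : 0 ≤ t) (htt : t < t') (ht' : t' ≤ T)
    {fl' : Flux} (hfl : fl'.rate k (meshSize a b N) = fl.rate k (meshSize a b N))
    {G G' : ℝ → PiecewisePoly N}
    (hGp : ∀ v ∈ S, IsProjection fl' a b k (fun x => g x v t) (G v))
    (hGp' : ∀ v ∈ S, IsProjection fl' a b k (fun x => g x v t') (G' v)) {P' : PiecewisePoly N}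
    (hP' : IsProjection fl a b k (fun x => ρ x t') P') :
    ∃ e : ℝ → ℝ, Integrable e m.measure ∧
      ∫ v, e v ∂m.measure ≤ microConst k (errConst C) (meshSize a b N)
        (fl.rate k (meshSize a b N)) ε (t' - t) δ B ∧
      ∀ v ∈ S, ∀ ψ, InDG k ψ →
        -(ε ^ 2 * ip a b (G' v - G v) ψ + (t' - t) * ε * upwindForm a b v (G v) ψ
            - (t' - t) * (v * dForm fl a b P' ψ) + (t' - t) * ip a b (G' v) ψ)
          ≤ -((t' - t) * ε * pint a b (fun x => ∫ w, w * dxF g x w t ∂m.measure) ψ)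
            + (t' - t) * (ε ^ 2 / 2 * ip a b ψ ψ + δ / 2 * ip a b ψ ψ
              + δ / 4 * (ε * (|v| * jumpSq a b ψ)) + e v) := by
  have hτ : 0 < t' - t := sub_pos.2 htt
  have htm : t ∈ Set.Icc 0 T := ⟨ht, htt.le.trans ht'⟩
  have htm' : t' ∈ Set.Icc 0 T := ⟨ht.trans htt.le, ht'⟩
  have hB := hs.bound_g.nonneg
  have hh := (meshSize_pos (N := N) hab).le
  set h := meshSize a b N with hhdef
  set r := fl.rate k h with hrdef
  have hr : 0 ≤ r := fl.rate_nonneg k hh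
  set K := errConst C with hK
  have hK0 : 0 ≤ K := errConst_nonneg hC
  set τ := t' - t with hτdef
  obtain ⟨iw, hw⟩ := hs.bound_g.integral_sub hab hs.measurableSet hs.ae_mem hT hs.field_g le_rfl
    ht htt.le ht'
  obtain ⟨i2, h2⟩ := hs.bound_g.integral_taylor hab hs.measurableSet hs.ae_mem hT hs.field_g
    ht htt.le ht'
  obtain ⟨i0, h0⟩ := hs.bound_g.integral_space hab hs.ae_mem hT hs.field_g le_rfl htm
  obtain ⟨i1, h1⟩ := hs.bound_g.integral_space hab hs.ae_mem hT hs.field_g le_rfl htm'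
  obtain ⟨iy, hy⟩ := hs.bound_g.integral_sub hab hs.measurableSet hs.ae_mem hT hs.field_g
    (Nat.zero_le _) ht htt.le ht'
  simp only [iteratedDeriv_zero, ← hτdef] at iy hy hw h2 i2
  set Xw : ℝ → ℝ := fun v => sqInt a b (iteratedDeriv (k + 1) fun x => g x v t' - g x v t) with hXw
  set Y2 : ℝ → ℝ := fun v => sqInt a b fun x => g x v t' - g x v t - τ * dtF T g x v t with hY2
  set X0 : ℝ → ℝ := fun v => sqInt a b (iteratedDeriv (k + 1) fun x => g x v t) with hX0
  set X1 : ℝ → ℝ := fun v => sqInt a b (iteratedDeriv (k + 1) fun x => g x v t') with hX1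
  set Y1 : ℝ → ℝ := fun v => sqInt a b fun x => g x v t' - g x v t with hY1
  have j1 : Integrable (fun v => ε ^ 2 / 2 * (K ^ 2 * (h ^ (k + 1)) ^ 2 * (Xw v / τ ^ 2)))
    m.measure := ((iw.div_const _).const_mul _).const_mul _
  have j2 : Integrable (fun v => ε ^ 4 * (Y2 v / τ ^ 2) + (K ^ 2 * r ^ 2 * B + τ ^ 2 * B))
    m.measure := ((i2.div_const _).const_mul _).add (integrable_const _)
  have j3 : Integrable (fun v => ε ^ 4 * (Y2 v / τ ^ 2) + (K ^ 2 * r ^ 2 * B + τ ^ 2 * B)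
    + K ^ 2 * r ^ 2 * X1 v) m.measure := j2.add (i1.const_mul _)
  have j4 : Integrable (fun v => ε ^ 4 * (Y2 v / τ ^ 2) + (K ^ 2 * r ^ 2 * B + τ ^ 2 * B)
    + K ^ 2 * r ^ 2 * X1 v + Y1 v) m.measure := j3.add iy
  have j5 : Integrable (fun v => ε ^ 2 / 2 * (K ^ 2 * (h ^ (k + 1)) ^ 2 * (Xw v / τ ^ 2))
    + 5 / (2 * δ) * (ε ^ 4 * (Y2 v / τ ^ 2) + (K ^ 2 * r ^ 2 * B + τ ^ 2 * B)
    + K ^ 2 * r ^ 2 * X1 v + Y1 v)) m.measure := j1.add (j4.const_mul _)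
  have j6 : Integrable (fun v => ε / δ * (K ^ 2 * h ^ (2 * k + 1) * X0 v)) m.measure :=
    (i0.const_mul _).const_mul _
  -- Young's inequality is used for each `v`; the resulting squares are linear in the norms of `g(·,
  -- v)`, and only they are averaged.
  refine ⟨_, j5.add j6, ?_, fun v hv ψ hψ => ?_⟩
  · have hw' : (∫ v, Xw v ∂m.measure) / τ ^ 2 ≤ B := by
      rw [div_le_iff₀ (by positivity), mul_comm]; exact hw
    have h2' : (∫ v, Y2 v ∂m.measure) / τ ^ 2 ≤ τ ^ 2 * B := by
      rw [div_le_iff₀ (by positivity)]; exact h2.trans_eq (by ring)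
    simp only [Pi.add_apply]
    rw [integral_add j5 j6, integral_add j1 (j4.const_mul _), integral_const_mul,
      integral_const_mul, integral_div, integral_const_mul, integral_add j3 iy,
      integral_add j2 (i1.const_mul _),
      integral_add ((i2.div_const _).const_mul _) (integrable_const _), integral_const_mul,
      integral_const_mul, integral_div, integral_const_mul, integral_const_mul]
    simp only [integral_const, probReal_univ, smul_eq_mul, one_mul, microConst]
    have q1 : ε ^ 4 * ((∫ v, Y2 v ∂m.measure) / τ ^ 2) ≤ ε ^ 4 * τ ^ 2 * B :=
      (mul_le_mul_of_nonneg_left h2' (by positivity)).trans_eq (by ring)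
    have q2 : K ^ 2 * r ^ 2 * ∫ v, X1 v ∂m.measure ≤ K ^ 2 * r ^ 2 * B :=
      mul_le_mul_of_nonneg_left h1 (by positivity)
    refine add_le_add (add_le_add ?_ ?_) ?_
    · gcongr
    · refine mul_le_mul_of_nonneg_left ?_ (by positivity)
      linarith
    · gcongr
  · have c0 := hs.contDiff_g hv htm
    have c1 := hs.contDiff_g hv htm'
    have ct : Continuous fun x => dtF T g x v t :=
      ((SmoothField.dtF (r := k + 1) hs.measurableSet hT hs.field_g).contDiff_slice hv
        htm).continuous
    have hp0 := nrm_nonneg (a := a) (b := b) ψ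
    have hv1 := hs.abs_le v hv
    have b1 := ((hGp' v hv).sub c1.continuous c0.continuous (hGp v hv)).abs_ip_sub_pint_le hab hC
      (c1.sub c0) ψ
    have b2 := abs_pint_le hab (f := fun x => g x v t' - g x v t - τ * dtF T g x v t)
      ((c1.continuous.sub c0.continuous).sub (continuous_const.mul ct)).continuousOn ψ
    rw [pint_sub hab (f := fun x => g x v t' - g x v t) (g := fun x => τ * dtF T g x v t)
      (c1.continuous.sub c0.continuous).continuousOn (continuous_const.mul ct).continuousOn,
      pint_const_mul] at b2
    have b3 := (hGp v hv).abs_upwindForm_sub_le hab hC c0 (hs.periodic_g v hv t htm) hψ hv1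
    have b4 := hP'.abs_dForm_add_pint_le hab hC (hs.contDiff_rho htm')
      (hs.periodic_rho t' htm') hψ
    have b4' : √(sqInt a b (iteratedDeriv (k + 1) fun x => ρ x t')) ≤ √B :=
      Real.sqrt_le_sqrt (hs.sqInt_rho_le hab hT le_rfl htm')
    have d0 := hs.continuous_dx_rho hT htm
    have d1 := hs.continuous_dx_rho hT htm'
    -- The exact equation is taken at the old time, while the scheme uses `ρ` and the relaxation
    -- term at the new one. This and `b7` account for the shift.
    have b5 := abs_pint_le hab (f := fun x => dx ρ x t' - dx ρ x t)
      (d1.sub d0).continuousOn ψ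
    rw [pint_sub hab d1.continuousOn d0.continuousOn] at b5
    have b5' : √(sqInt a b fun x => dx ρ x t' - dx ρ x t) ≤ τ * √B := by
      refine sqrt_le_mul_sqrt hτ.le ?_
      have := hs.sqInt_rho_sub_le hab hT (j := 1) (by omega) ht htt.le ht'
      rw [iteratedDeriv_one] at this
      have e : deriv (fun x => ρ x t' - ρ x t) = fun x => dx ρ x t' - dx ρ x t := by
        ext x
        exact deriv_fun_sub ((hs.contDiff_rho htm').differentiable (by simp) x)
          ((hs.contDiff_rho htm).differentiable (by simp) x)
      rwa [e] at this
    have b6 := (hGp' v hv).abs_ip_sub_pint_le_rate hab hC c1 hψ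
    have b7 := abs_pint_le hab (f := fun x => g x v t' - g x v t)
      (c1.continuous.sub c0.continuous).continuousOn ψ
    have s7 := pint_sub hab (f := fun x => g x v t') (g := fun x => g x v t)
      c1.continuous.continuousOn c0.continuous.continuousOn ψ
    have hm := hs.pint_micro_eq hab hT hε htm hv ψ
    have e0 : deriv (fun x => g x v t) = fun x => dxF g x v t := rfl
    have e1 : deriv (fun x => ρ x t') = fun x => dx ρ x t' := rfl
    rw [e0] at b3
    rw [e1] at b4
    rw [hfl] at b6
    have hKr : 0 ≤ K * r := mul_nonneg hK0 hr
    have b4'' := b4.trans (mul_le_mul_of_nonneg_right (mul_le_mul_of_nonneg_left b4' hKr) hp0)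
    have b5'' := b5.trans (mul_le_mul_of_nonneg_right b5' hp0)
    have hvτ : |τ * v| ≤ τ := by
      rw [abs_mul, abs_of_pos hτ]; exact mul_le_of_le_one_right hτ.le hv1
    have f4 : τ * v * (dForm fl a b P' ψ + pint a b (fun x => dx ρ x t') ψ)
        ≤ τ * (K * r * √B * nrm a b ψ) := by
      refine (le_abs_self _).trans ?_
      rw [abs_mul]
      exact mul_le_mul hvτ b4'' (abs_nonneg _) hτ.le
    have f5 : -(τ * v * (pint a b (fun x => dx ρ x t') ψ - pint a b (fun x => dx ρ x t) ψ))
        ≤ τ * (τ * √B * nrm a b ψ) := by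
      refine (neg_le_abs _).trans ?_
      rw [abs_mul]
      exact mul_le_mul hvτ b5'' (abs_nonneg _) hτ.le
    have f1 := mul_le_mul_of_nonneg_left ((neg_le_abs _).trans b1) (sq_nonneg ε)
    have f2 := mul_le_mul_of_nonneg_left ((neg_le_abs _).trans b2) (sq_nonneg ε)
    have f3 := mul_le_mul_of_nonneg_left ((neg_le_abs _).trans b3) (mul_pos hτ hε).le
    have f6 := mul_le_mul_of_nonneg_left ((neg_le_abs _).trans b6) hτ.le
    have f7 := mul_le_mul_of_nonneg_left ((neg_le_abs _).trans b7) hτ.le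
    have Y := micro_young (p := nrm a b ψ) (J := √(|v| * jumpSq a b ψ))
      (A₁ := K * h ^ (k + 1) * √(Xw v)) (A₂ := √(Y2 v)) (A₃ := K * √(h ^ (2 * k + 1)) * √(X0 v))
      (A₄ := K * r * √B) (A₅ := τ * √B) (A₆ := K * r * √(X1 v)) (A₇ := √(Y1 v)) hτ hδ hε
    have hjs : 0 ≤ |v| * jumpSq a b ψ := mul_nonneg (abs_nonneg v) (jumpSq_nonneg a b ψ)
    simp only [mul_pow] at Y
    rw [Real.sq_sqrt (sqInt_nonneg hab _), Real.sq_sqrt (sqInt_nonneg hab _),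
      Real.sq_sqrt (sqInt_nonneg hab _), Real.sq_sqrt (sqInt_nonneg hab _),
      Real.sq_sqrt (sqInt_nonneg hab _), Real.sq_sqrt hB, Real.sq_sqrt hjs,
      Real.sq_sqrt (pow_nonneg hh _), nrm_sq hab] at Y
    simp only [Pi.add_apply] at f1 ⊢
    rw [s7] at f7
    have hm' := congrArg (fun z => τ * z) hm
    simp only [mul_zero] at hm'
    have Y' : τ * (ε ^ 2 / 2 * ip a b ψ ψ + δ / 2 * ip a b ψ ψ + δ / 4 * (ε * (|v| * jumpSq a b ψ))
        + (ε ^ 2 / 2 * (K ^ 2 * (h ^ (k + 1)) ^ 2 * Xw v / τ ^ 2)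
          + 5 / (2 * δ) * (ε ^ 4 * (Y2 v / τ ^ 2) + K ^ 2 * r ^ 2 * B + τ ^ 2 * B
            + K ^ 2 * r ^ 2 * X1 v + Y1 v) + ε / δ * (K ^ 2 * h ^ (2 * k + 1) * X0 v)))
        = τ * (ε ^ 2 / 2 * ip a b ψ ψ + δ / 2 * ip a b ψ ψ + δ / 4 * (ε * (|v| * jumpSq a b ψ))
        + (ε ^ 2 / 2 * (K ^ 2 * (h ^ (k + 1)) ^ 2 * (Xw v / τ ^ 2))
          + 5 / (2 * δ) * (ε ^ 4 * (Y2 v / τ ^ 2) + (K ^ 2 * r ^ 2 * B + τ ^ 2 * B)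
            + K ^ 2 * r ^ 2 * X1 v + Y1 v) + ε / δ * (K ^ 2 * h ^ (2 * k + 1) * X0 v))) := by
      ring
    rw [Y'] at Y
    rw [s7] at f1 f2
    refine le_trans ?_ (add_le_add_right Y _)
    linarith [f1, f2, f3, f4, f5, f6, f7, hm']

end

/-! ### The error equations -/

section
variable {m : Model} {a b T ε : ℝ} {N : ℕ} [NeZero N] {k : ℕ} {C C' B : ℝ} {S : Set ℝ}
  {ρ : ℝ → ℝ → ℝ} {g : ℝ → ℝ → ℝ → ℝ} {fl : Flux} {t t' : ℝ} {τ : ℝ} {ρ₀ : ℝ → ℝ}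
  {g₀ : ℝ → ℝ → ℝ} {ρh : ℕ → PiecewisePoly N} {gh : ℕ → ℝ → PiecewisePoly N}

lemma SolutionOn.avg_projection_eq_zero (hs : SolutionOn m ε a b T k ρ g B S) (hab : a < b)
    (hC : AreInverseConstants k C C') (ht : t ∈ Set.Icc 0 T) {G : ℝ → PiecewisePoly N}
    (hG : L2DG m k G)
    (hGp : ∀ᵐ v ∂m.measure, IsProjection fl a b k (fun x => g x v t) (G v)) :
    avg m k (fun _ => 1) G = 0 := by
  have h0 : ∀ x, ∫ v, 1 * g x v t ∂m.measure = 0 := fun x => by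
    simpa using hs.avg_g t ht x
  refine IsProjection.eq_zero hab hC h0 (fl := fl) (isProjection_avg hab hs.ae_mem
    (hs.slice_g ht) (hs.tripleNormSq_g_ne_top ht) hG hGp (f := fun _ => 1) measurable_const
    (fun _ _ => by simp) ?_)
  simp only [h0]
  exact continuous_const

lemma L2DG.integral_map_sub_eq_zero {G H : ℝ → PiecewisePoly N} (hG : L2DG m k G)
    (hH : L2DG m k H) (hG0 : avg m k (fun _ => 1) G = 0) (hH0 : avg m k (fun _ => 1) H = 0)
    (L : PiecewisePoly N →ₗ[ℝ] ℝ) : ∫ v, L (G v - H v) ∂m.measure = 0 := by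
  simp only [map_sub]
  rw [integral_sub ((hG.memLp_map L).integrable (by norm_num))
    ((hH.memLp_map L).integrable (by norm_num)), hG.integral_eq, hH.integral_eq, hG0, hH0]
  simp

/-- The error equation for `g`, tested with the error. -/
lemma SolutionOn.micro_error_le (hs : SolutionOn m ε a b T k ρ g B S) (hab : a < b)
    (hT : 0 < T) (hε : 0 < ε) (hC : AreInverseConstants k C C') {σ : ℝ} (hσ : σ < 1) (hτ : 0 < τ)
    (h : IsDGIMEX1 m fl ε a b τ k ρ₀ g₀ ρh gh)
    (havg : ∀ n, avg m k (fun _ => 1) (gh n) = 0) {n : ℕ}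
    (ht : 0 ≤ t) (htt : t' - t = τ) (ht' : t' ≤ T)
    {fl' : Flux} (hfl : fl'.rate k (meshSize a b N) = fl.rate k (meshSize a b N))
    {G G' : ℝ → PiecewisePoly N} (hG : L2DG m k G) (hG' : L2DG m k G')
    (hGp : ∀ v ∈ S, IsProjection fl' a b k (fun x => g x v t) (G v))
    (hGp' : ∀ v ∈ S, IsProjection fl' a b k (fun x => g x v t') (G' v)) {P' : PiecewisePoly N}
    (hP' : IsProjection fl a b k (fun x => ρ x t') P') :
    ε ^ 2 * ∫ v, ip a b ((gh (n + 1) v - G' v) - (gh n v - G v)) (gh (n + 1) v - G' v) ∂m.measure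
        + τ * ε * ∫ v, upwindForm a b v (gh n v - G v) (gh (n + 1) v - G' v) ∂m.measure
        - τ * dForm fl a b (ρh (n + 1) - P') (avg m k (fun v => v) fun v => gh (n + 1) v - G' v)
        + τ * energyG m a b (fun v => gh (n + 1) v - G' v)
      ≤ τ * (ε ^ 2 / 2 * energyG m a b (fun v => gh (n + 1) v - G' v)
        + (1 - σ) / 2 * energyG m a b (fun v => gh (n + 1) v - G' v)
        + (1 - σ) / 4 * (ε * energyJ m a b fun v => gh (n + 1) v - G' v)
        + microConst k (errConst C) (meshSize a b N) (fl.rate k (meshSize a b N)) ε τ (1 - σ) B) := by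
  have htlt : t < t' := by linarith
  have htm' : t' ∈ Set.Icc 0 T := ⟨ht.trans htlt.le, ht'⟩
  have htm : t ∈ Set.Icc 0 T := ⟨ht, htlt.le.trans ht'⟩
  obtain ⟨e, he, heS, hres⟩ := hs.exists_micro_residual_le hab hT hε hC (sub_pos.2 hσ) ht htlt ht'
    hfl hGp hGp' hP'
  rw [htt] at heS hres
  have hG'0 := hs.avg_projection_eq_zero hab hC htm' hG' (hs.ae_mem.mono hGp')
  have hκ := (hs.continuous_avg_dx hT hε htm).continuousOn (s := Set.Icc a b)
  obtain ⟨L, hL⟩ := integral_upwindForm_eq (a := a) (b := b) (h.l2DG n)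
  have hZ : L2DG m k fun v => gh (n + 1) v - G' v := (h.l2DG (n + 1)).sub hG'
  have hY : L2DG m k fun v => gh n v - G v := (h.l2DG n).sub hG
  set Z : ℝ → PiecewisePoly N := fun v => gh (n + 1) v - G' v with hZdef
  set Y : ℝ → PiecewisePoly N := fun v => gh n v - G v with hYdef
  -- The `v`-independent parts of the scheme and of the exact equation are eliminated here and in
  -- `hκ0`: numerical solution and projection both have mean zero.
  have hL0 : ∫ v, L (Z v) ∂m.measure = 0 :=
    (h.l2DG (n + 1)).integral_map_sub_eq_zero hG' (havg _) hG'0 L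
  have hκ0 : ∫ v, pintL hab hκ (Z v) ∂m.measure = 0 :=
    (h.l2DG (n + 1)).integral_map_sub_eq_zero hG' (havg _) hG'0 (pintL hab hκ)
  have hLi : Integrable (fun v => L (Z v)) m.measure := (hZ.memLp_map L).integrable (by norm_num)
  have hκi : Integrable (fun v => pintL hab hκ (Z v)) m.measure :=
    (hZ.memLp_map _).integrable (by norm_num)
  have hd : ∫ v, v * dForm fl a b (ρh (n + 1) - P') (Z v) ∂m.measure
      = dForm fl a b (ρh (n + 1) - P') (avg m k (fun v => v) Z) := by
    have := hZ.integral_map memLp_id (dL a b fl (ρh (n + 1) - P'))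
    simpa only [dL_apply] using this
  have hdi : Integrable (fun v => v * dForm fl a b (ρh (n + 1) - P') (Z v)) m.measure := by
    have := memLp_id.integrable_mul (hZ.memLp_map (dL a b fl (ρh (n + 1) - P')))
    simp only [dL_apply] at this
    exact this
  have i1 := ((hZ.sub hY).integrable_ip (a := a) (b := b) hZ).const_mul (ε ^ 2)
  have i2 := (hY.integrable_upwindForm (a := a) (b := b) hZ).const_mul (τ * ε)
  have i3 := hdi.const_mul τ
  have iG := hZ.integrable_ip (a := a) (b := b) hZ
  have iJ := hZ.integrable_jumpSq (a := a) (b := b)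
  have i4 := iG.const_mul τ
  have lhs : ∫ v, (ε ^ 2 * ip a b (Z v - Y v) (Z v) + τ * ε * upwindForm a b v (Y v) (Z v)
        - τ * (v * dForm fl a b (ρh (n + 1) - P') (Z v)) + τ * ip a b (Z v) (Z v)) ∂m.measure
      = ε ^ 2 * ∫ v, ip a b (Z v - Y v) (Z v) ∂m.measure
        + τ * ε * ∫ v, upwindForm a b v (Y v) (Z v) ∂m.measure
        - τ * dForm fl a b (ρh (n + 1) - P') (avg m k (fun v => v) Z)
        + τ * energyG m a b Z := by
    have i12 : Integrable (fun v => ε ^ 2 * ip a b (Z v - Y v) (Z v)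
      + τ * ε * upwindForm a b v (Y v) (Z v)) m.measure := i1.add i2
    have i123 : Integrable (fun v => ε ^ 2 * ip a b (Z v - Y v) (Z v)
      + τ * ε * upwindForm a b v (Y v) (Z v)
      - τ * (v * dForm fl a b (ρh (n + 1) - P') (Z v))) m.measure := i12.sub i3
    rw [integral_add i123 i4, integral_sub i12 i3, integral_add i1 i2, integral_const_mul,
      integral_const_mul, integral_const_mul, integral_const_mul, hd]
    rfl
  have k1 : Integrable (fun v => ε ^ 2 / 2 * ip a b (Z v) (Z v)
    + (1 - σ) / 2 * ip a b (Z v) (Z v)) m.measure := (iG.const_mul _).add (iG.const_mul _)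
  have k2 : Integrable (fun v => ε ^ 2 / 2 * ip a b (Z v) (Z v)
    + (1 - σ) / 2 * ip a b (Z v) (Z v) + (1 - σ) / 4 * (ε * (|v| * jumpSq a b (Z v))))
    m.measure := k1.add ((iJ.const_mul _).const_mul _)
  have k3 : Integrable (fun v => ε ^ 2 / 2 * ip a b (Z v) (Z v)
    + (1 - σ) / 2 * ip a b (Z v) (Z v) + (1 - σ) / 4 * (ε * (|v| * jumpSq a b (Z v))) + e v)
    m.measure := k2.add he
  have k4 : Integrable (fun v => τ * ε * L (Z v) - τ * ε * pintL hab hκ (Z v)) m.measure :=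
    (hLi.const_mul _).sub (hκi.const_mul _)
  have rhs : ∫ v, (τ * ε * L (Z v) - τ * ε * pintL hab hκ (Z v)
        + τ * (ε ^ 2 / 2 * ip a b (Z v) (Z v) + (1 - σ) / 2 * ip a b (Z v) (Z v)
          + (1 - σ) / 4 * (ε * (|v| * jumpSq a b (Z v))) + e v)) ∂m.measure
      = τ * (ε ^ 2 / 2 * energyG m a b Z + (1 - σ) / 2 * energyG m a b Z
        + (1 - σ) / 4 * (ε * energyJ m a b Z) + ∫ v, e v ∂m.measure) := by
    rw [integral_add k4 (k3.const_mul _), integral_sub (hLi.const_mul _) (hκi.const_mul _),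
      integral_const_mul, integral_const_mul, integral_const_mul, hL0, hκ0, integral_add k2 he,
      integral_add k1 ((iJ.const_mul _).const_mul _),
      integral_add (iG.const_mul _) (iG.const_mul _), integral_const_mul, integral_const_mul,
      integral_const_mul, integral_const_mul]
    simp only [mul_zero, sub_zero, zero_add]
    rfl
  rw [← lhs]
  refine le_trans ?_ (mul_le_mul_of_nonneg_left (add_le_add_right heS _) hτ.le)
  rw [← rhs]
  refine integral_mono_ae (((i1.add i2).sub i3).add i4) (k4.add (k3.const_mul τ)) ?_
  filter_upwards [hs.ae_mem, h.step_g' hε hτ n, hZ.inDG] with v hv hst hZv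
  have s1 := hst (Z v) hZv
  have s2 := hres v hv (Z v) hZv
  rw [hL] at s1
  have z1 : ip a b (Z v - Y v) (Z v)
      = ip a b (gh (n + 1) v - gh n v) (Z v) - ip a b (G' v - G v) (Z v) := by
    rw [← ipL_apply, ← ipL_apply, ← ipL_apply, ← LinearMap.sub_apply, ← map_sub]
    congr 2
    simp only [hZdef, hYdef]; abel
  have z2 : upwindForm a b v (Y v) (Z v)
      = upwindForm a b v (gh n v) (Z v) - upwindForm a b v (G v) (Z v) := by
    rw [← upwindL_apply, ← upwindL_apply, ← upwindL_apply, ← LinearMap.sub_apply, ← map_sub]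
  have z3 : dForm fl a b (ρh (n + 1) - P') (Z v)
      = dForm fl a b (ρh (n + 1)) (Z v) - dForm fl a b P' (Z v) := by
    rw [← dL_apply, ← dL_apply, ← dL_apply, ← LinearMap.sub_apply, ← map_sub]
  have z4 : ip a b (Z v) (Z v) = ip a b (gh (n + 1) v) (Z v) - ip a b (G' v) (Z v) := by
    rw [← ipL_apply, ← ipL_apply, ← ipL_apply, ← LinearMap.sub_apply, ← map_sub]
  have z5 : pintL hab hκ (Z v) = pint a b (fun x => ∫ w, w * dxF g x w t ∂m.measure) (Z v) := rfl
  simp only [z5]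
  have lhs' : ε ^ 2 * ip a b (Z v - Y v) (Z v) + τ * ε * upwindForm a b v (Y v) (Z v)
        - τ * (v * dForm fl a b (ρh (n + 1) - P') (Z v)) + τ * ip a b (Z v) (Z v)
      = τ * ε * L (Z v) - (ε ^ 2 * ip a b (G' v - G v) (Z v)
        + τ * ε * upwindForm a b v (G v) (Z v) - τ * (v * dForm fl a b P' (Z v))
        + τ * ip a b (G' v) (Z v)) := by
    rw [z1, z2, z3]
    rw [show τ * ip a b (Z v) (Z v) = τ * (ip a b (gh (n + 1) v) (Z v) - ip a b (G' v) (Z v)) by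
      rw [← z4]]
    linear_combination s1
  refine le_of_eq_of_le lhs' ?_
  linarith [s2]

/-- The error equation for `ρ`. -/
lemma SolutionOn.abs_macro_error_le (hs : SolutionOn m ε a b T k ρ g B S) (hab : a < b)
    (hT : 0 < T) (hC : AreInverseConstants k C C') (hτ : 0 < τ)
    (h : IsDGIMEX1 m fl ε a b τ k ρ₀ g₀ ρh gh) {n : ℕ}
    (ht : 0 ≤ t) (htt : t' - t = τ) (ht' : t' ≤ T)
    {G : ℝ → PiecewisePoly N} (hG : L2DG m k G)
    (hGp : ∀ v ∈ S, IsProjection fl.swap a b k (fun x => g x v t) (G v)) {P P' : PiecewisePoly N}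
    (hP : IsProjection fl a b k (fun x => ρ x t) P)
    (hP' : IsProjection fl a b k (fun x => ρ x t') P') {φ : PiecewisePoly N} (hφ : InDG k φ) :
    |ip a b ((ρh (n + 1) - P') - (ρh n - P)) φ
        - τ * dForm fl.swap a b (avg m k (fun v => v) fun v => gh n v - G v) φ|
      ≤ τ * (√B * τ + 2 * errConst C * fl.rate k (meshSize a b N) * √B) * nrm a b φ := by
  have h1 := hs.abs_macro_residual_le hab hT hC ht (by linarith) ht' (fl.rate_swap k _) hG hGp hP
    hP' hφ
  rw [htt] at h1
  convert h1 using 2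
  have e1 : ip a b ((ρh (n + 1) - P') - (ρh n - P)) φ
      = ip a b (ρh (n + 1) - ρh n) φ - ip a b (P' - P) φ := by
    rw [← ipL_apply, ← ipL_apply, ← ipL_apply, ← LinearMap.sub_apply, ← map_sub]
    congr 2
    abel
  have e2 : dForm fl.swap a b (avg m k (fun v => v) fun v => gh n v - G v) φ
      = dForm fl.swap a b (avg m k (fun v => v) (gh n)) φ
        - dForm fl.swap a b (avg m k (fun v => v) G) φ := by
    have hi := fun {H : ℝ → PiecewisePoly N} (hH : L2DG m k H) =>
      hH.integral_map memLp_id ((dL a b fl.swap).flip φ)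
    simp only [LinearMap.flip_apply, dL_apply] at hi
    rw [← hi ((h.l2DG n).sub hG), ← hi (h.l2DG n), ← hi hG, ← integral_sub]
    · refine integral_congr_ae (Filter.Eventually.of_forall fun v => ?_)
      simp only [← dL_apply, map_sub, LinearMap.sub_apply, mul_sub]
    · have := memLp_id.integrable_mul ((h.l2DG n).memLp_map ((dL a b fl.swap).flip φ))
      simp only [LinearMap.flip_apply, dL_apply] at this
      exact this
    · have := memLp_id.integrable_mul (hG.memLp_map ((dL a b fl.swap).flip φ))
      simp only [LinearMap.flip_apply, dL_apply] at this
      exact this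
  rw [e1, e2, h.step_rho' hτ n hφ]
  ring

end

/-! ### The first time step -/

section
variable {m : Model} {a b T ε : ℝ} {N : ℕ} [NeZero N] {k : ℕ} {C C' B : ℝ} {S : Set ℝ}
  {ρ : ℝ → ℝ → ℝ} {g : ℝ → ℝ → ℝ → ℝ} {fl : Flux} {t t' : ℝ} {τ : ℝ}

/-- The constant of the inverse inequality for the form `d_h`. -/
noncomputable def formConst (k : ℕ) (C C' : ℝ) : ℝ := √(derivConst k C') + 2 * C

/-- The crude inverse estimate with a full factor `1/h`. It serves for the first time step only,
where a factor `τ` is available. -/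
lemma abs_dForm_le_inv (hab : a < b) (hC : AreInverseConstants k C C') (fl : Flux)
    {u w : PiecewisePoly N} (hu : InDG k u) (hw : InDG k w) :
    |dForm fl a b u w| ≤ formConst k C C' / meshSize a b N * nrm a b u * nrm a b w := by
  have hh := meshSize_pos (N := N) hab
  have hC1 := hC.one_le
  set h := meshSize a b N
  have hw0 := nrm_nonneg (a := a) (b := b) w
  have h1 : nrm a b (pderiv w) ≤ √(derivConst k C') / h * nrm a b w := by
    rw [nrm, nrm, ← Real.sqrt_sq hh.le, ← Real.sqrt_div (derivConst_nonneg hC),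
      ← Real.sqrt_mul (div_nonneg (derivConst_nonneg hC) (sq_nonneg _))]
    exact Real.sqrt_le_sqrt (ip_pderiv_self_le' hab hC hw)
  have h2 : √(C / h) * √(jumpSq a b w) ≤ 2 * C / h * nrm a b w := by
    rw [← Real.sqrt_mul (by positivity)]
    refine Real.sqrt_le_iff.2 ⟨by positivity, ?_⟩
    refine (mul_le_mul_of_nonneg_left (jumpSq_le hab hC hw) (by positivity)).trans_eq ?_
    rw [mul_pow, nrm_sq hab]
    ring
  refine (abs_dForm_le hab hC fl hu w).trans ?_
  refine (mul_le_mul_of_nonneg_left (add_le_add h1 h2) (nrm_nonneg u)).trans_eq ?_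
  rw [formConst]
  ring

/-- Test with `ξ₁` and divide by its norm. Nothing is needed from the equation for `g`, hence no
power of `ε` appears. -/
lemma nrm_le_of_step (hab : a < b) (hC : AreInverseConstants k C C') {fl : Flux} {R : ℝ}
    (hτ : 0 ≤ τ) (hR : 0 ≤ R) {ξ₀ ξ₁ A : PiecewisePoly N} (hξ : InDG k ξ₁) (hA : InDG k A)
    (h : |ip a b (ξ₁ - ξ₀) ξ₁ - τ * dForm fl a b A ξ₁| ≤ τ * R * nrm a b ξ₁) :
    nrm a b ξ₁ ≤ nrm a b ξ₀ + τ * (formConst k C C' / meshSize a b N * nrm a b A) + τ * R := by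
  have hh := meshSize_pos (N := N) hab
  have hf : 0 ≤ formConst k C C' := by
    have := hC.one_le
    unfold formConst; positivity
  have h0 := nrm_nonneg (a := a) (b := b) ξ₀
  have h1 := nrm_nonneg (a := a) (b := b) ξ₁
  have hA0 := nrm_nonneg (a := a) (b := b) A
  rcases h1.eq_or_lt with h1 | h1
  · rw [← h1]; positivity
  have e : ip a b ξ₁ ξ₁ = ip a b ξ₀ ξ₁ + ip a b (ξ₁ - ξ₀) ξ₁ := by
    simp only [← ipL_apply, map_sub, LinearMap.sub_apply]; ring
  have b1 := (le_abs_self _).trans (abs_ip_le hab ξ₀ ξ₁)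
  have b2 := (le_abs_self _).trans (abs_dForm_le_inv hab hC fl hA hξ)
  have b3 := (le_abs_self _).trans h
  have b4 := mul_le_mul_of_nonneg_left b2 hτ
  rw [← nrm_sq hab] at e
  refine le_of_mul_le_mul_right ?_ h1
  nlinarith

/-- For the alternating fluxes, `h^k` is at most `1` or at most `h^(k+1)`, according as `h ≤ 1` or
`h ≥ 1`. For the central flux `h^k` is the rate itself. -/
lemma Flux.mul_pow_le_rate (fl : Flux) (k : ℕ) {h : ℝ} (hh : 0 ≤ h) (hτ : 0 ≤ τ) (hτ1 : τ ≤ 1) :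
    τ * h ^ k ≤ τ + fl.rate k h := by
  have hc : τ * h ^ k ≤ h ^ k := mul_le_of_le_one_left (by positivity) hτ1
  have ha : τ * h ^ k ≤ τ + h ^ (k + 1) := by
    rcases le_total h 1 with h1 | h1
    · have := mul_le_of_le_one_right hτ (pow_le_one₀ hh h1 (n := k))
      have : 0 ≤ h ^ (k + 1) := by positivity
      linarith
    · have : h ^ k ≤ h ^ (k + 1) := pow_le_pow_right₀ h1 (Nat.le_succ k)
      linarith
  cases fl
  · exact ha
  · exact ha
  · simp only [Flux.rate]; linarith

/-- Besides the adapted projection, the `L²` projection has to be admitted, since the scheme is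
started from it whatever the flux. -/
lemma IsProjection.distSq_rho_le (hs : SolutionOn m ε a b T k ρ g B S) (hab : a < b)
    (hT : 0 < T) (hC : AreInverseConstants k C C') (ht : t ∈ Set.Icc 0 T) {fl' : Flux}
    (hfl : fl' = fl ∨ fl' = .central) {P : PiecewisePoly N}
    (hP : IsProjection fl' a b k (fun x => ρ x t) P) :
    distSq a b P (fun x => ρ x t)
      ≤ 2 * (1 + projConst C) ^ 2 * fl.rate k (meshSize a b N) ^ 2 * B := by
  have hB : 0 ≤ B := hs.bound_rho.nonneg
  have h1 := hs.sqInt_rho_le hab hT le_rfl ht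
  have h2 := hs.sqInt_rho_le hab hT (Nat.le_succ k) ht
  have hr : ∀ fl : Flux, (1 + projConst C) ^ 2 * fl.rate k (meshSize a b N) ^ 2
        * (sqInt a b (iteratedDeriv k fun x => ρ x t)
          + sqInt a b (iteratedDeriv (k + 1) fun x => ρ x t))
      ≤ 2 * (1 + projConst C) ^ 2 * fl.rate k (meshSize a b N) ^ 2 * B := fun fl => by
    refine (mul_le_mul_of_nonneg_left (add_le_add h2 h1) (by positivity)).trans_eq ?_
    ring
  by_cases e : fl' = fl
  · subst e
    exact (hP.distSq_le_rate hab hC (hs.contDiff_rho ht)).trans (hr _)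
  · have hc : fl ≠ .central := fun h => e ((hfl.resolve_left e).trans h.symm)
    have hr' : meshSize a b N ^ (2 * (k + 1)) = fl.rate k (meshSize a b N) ^ 2 := by
      cases fl
      · simp only [Flux.rate]; ring
      · simp only [Flux.rate]; ring
      · exact absurd rfl hc
    refine (hP.distSq_le hab hC (hs.contDiff_rho ht)).trans ?_
    rw [hr']
    have h0 : 0 ≤ (1 + projConst C) ^ 2 * fl.rate k (meshSize a b N) ^ 2 := by positivity
    nlinarith [mul_le_mul_of_nonneg_left h1 h0, mul_nonneg h0 hB]

/-! ### From discrete to continuous norms -/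

lemma toFun_eq (hab : a < b) (u : PiecewisePoly N) {i : Fin N} {x : ℝ}
    (hx : x ∈ Set.Ico (node a b N i) (node a b N (i + 1))) : toFun a b u x = (u i).eval x := by
  rw [toFun, Finset.sum_eq_single i, Set.indicator_of_mem hx]
  · intro j _ hj
    refine Set.indicator_of_notMem (fun hx' => ?_) _
    rcases lt_or_gt_of_ne hj with h | h
    · have := node_mono (N := N) hab (Nat.succ_le_of_lt (Fin.lt_def.1 h))
      exact absurd (hx'.2.trans_le (this.trans hx.1)) (lt_irrefl _)
    · have := node_mono (N := N) hab (Nat.succ_le_of_lt (Fin.lt_def.1 h))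
      exact absurd (hx.2.trans_le (this.trans hx'.1)) (lt_irrefl _)
  · simp

lemma Ico_subset_iUnion :
    Set.Ico a b ⊆ ⋃ i : Fin N, Set.Ico (node a b N i) (node a b N (i + 1)) := by
  intro x hx
  have key : ∀ n ≤ N, x < node a b N n →
      ∃ i : Fin N, x ∈ Set.Ico (node a b N i) (node a b N (i + 1)) := by
    intro n
    induction n with
    | zero => intro _ h; rw [node_zero] at h; exact absurd hx.1 (not_le.2 h)
    | succ n ih =>
      intro hn h
      by_cases h' : x < node a b N n
      · exact ih (by omega) h'
      · exact ⟨⟨n, hn⟩, not_lt.1 h', h⟩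
  have := key N le_rfl (by rw [node_last]; exact hx.2)
  simpa using this

/-- The half-open elements cover `[a, b]` up to the point `b`, which suffices for this inequality.
-/
lemma l2Norm_sub_toFun_le (hab : a < b) {w : ℝ → ℝ} (hw : Continuous w) (u : PiecewisePoly N) :
    l2Norm a b (fun x => w x - toFun a b u x) ^ 2 ≤ ENNReal.ofReal (distSq a b u w) := by
  have h0 : ∀ i : Fin N, 0 ≤ ∫ x in (node a b N i)..(node a b N (i + 1)),
      ((u i).eval x - w x) ^ 2 := fun i =>
    intervalIntegral.integral_nonneg (node_lt_succ hab i).le fun x _ => sq_nonneg _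
  rw [l2Norm_sq, ← setLIntegral_congr Ico_ae_eq_Icc, distSq,
    ENNReal.ofReal_sum_of_nonneg fun i _ => h0 i]
  refine (lintegral_mono_set (Ico_subset_iUnion (N := N))).trans ?_
  refine (lintegral_iUnion_le _ _).trans ?_
  rw [tsum_fintype]
  refine Finset.sum_le_sum fun i _ => ?_
  have hc : Continuous fun x => ((u i).eval x - w x) ^ 2 := ((u i).continuous.sub hw).pow 2
  rw [← lintegral_Icc_eq_ofReal (node_lt_succ hab i).le hc.continuousOn fun x => sq_nonneg _]
  refine le_trans (le_of_eq ?_) (lintegral_mono_set Set.Ico_subset_Icc_self)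
  refine setLIntegral_congr_fun measurableSet_Ico fun x hx => ?_
  rw [toFun_eq hab u hx, ← neg_sub, neg_sq]

lemma distSq_le_two_mul (hab : a < b) {w : ℝ → ℝ} (hw : Continuous w) (u P : PiecewisePoly N) :
    distSq a b u w ≤ 2 * distSq a b P w + 2 * ip a b (u - P) (u - P) := by
  simp only [distSq, ip, Finset.mul_sum, ← Finset.sum_add_distrib]
  refine Finset.sum_le_sum fun i _ => ?_
  have c1 : Continuous fun x => ((P i).eval x - w x) ^ 2 := ((P i).continuous.sub hw).pow 2
  have c2 : Continuous fun x => ((u - P) i).eval x * ((u - P) i).eval x :=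
    ((u - P) i).continuous.mul ((u - P) i).continuous
  have c3 : Continuous fun x => ((u i).eval x - w x) ^ 2 := ((u i).continuous.sub hw).pow 2
  rw [← intervalIntegral.integral_const_mul, ← intervalIntegral.integral_const_mul,
    ← intervalIntegral.integral_add ((c1.const_mul 2).intervalIntegrable _ _)
      ((c2.const_mul 2).intervalIntegrable _ _)]
  refine intervalIntegral.integral_mono_on (node_lt_succ hab i).le (c3.intervalIntegrable _ _)
    (((c1.const_mul 2).add (c2.const_mul 2)).intervalIntegrable _ _) fun x _ => ?_
  simp only [Pi.sub_apply, Polynomial.eval_sub]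
  nlinarith [sq_nonneg ((P i).eval x - w x - ((u i).eval x - (P i).eval x))]

lemma SolutionOn.tripleNormSq_sub_le (hs : SolutionOn m ε a b T k ρ g B S) (hab : a < b)
    (hT : 0 < T) (hC : AreInverseConstants k C C') (ht : t ∈ Set.Icc 0 T)
    {G H : ℝ → PiecewisePoly N} (hG : L2DG m k G) (hH : L2DG m k H)
    (hGp : ∀ v ∈ S, IsProjection fl a b k (fun x => g x v t) (G v)) :
    tripleNormSq m a b (fun x v => g x v t - toFun a b (H v) x)
      ≤ ENNReal.ofReal (2 * (1 + projConst C) ^ 2 * meshSize a b N ^ (2 * (k + 1)) * B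
        + 2 * energyG m a b fun v => H v - G v) := by
  obtain ⟨i0, h0⟩ := hs.bound_g.integral_space hab hs.ae_mem hT hs.field_g le_rfl ht
  have hh := (meshSize_pos (N := N) hab).le
  have iG := (hH.sub hG).integrable_ip (a := a) (b := b) (hH.sub hG)
  have hF := (i0.const_mul (2 * (1 + projConst C) ^ 2 * meshSize a b N ^ (2 * (k + 1)))).add
    (iG.const_mul 2)
  have hpos : ∀ v, 0 ≤ 2 * (1 + projConst C) ^ 2 * meshSize a b N ^ (2 * (k + 1))
      * sqInt a b (iteratedDeriv (k + 1) fun x => g x v t)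
      + 2 * ip a b (H v - G v) (H v - G v) := fun v => by
    have := sqInt_nonneg hab (iteratedDeriv (k + 1) fun x => g x v t)
    have := ip_self_nonneg hab (H v - G v)
    positivity
  calc tripleNormSq m a b (fun x v => g x v t - toFun a b (H v) x)
      ≤ ∫⁻ v, ENNReal.ofReal (2 * (1 + projConst C) ^ 2 * meshSize a b N ^ (2 * (k + 1))
          * sqInt a b (iteratedDeriv (k + 1) fun x => g x v t)
          + 2 * ip a b (H v - G v) (H v - G v)) ∂m.measure := by
        refine lintegral_mono_ae ?_
        filter_upwards [hs.ae_mem] with v hv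
        have hc := hs.contDiff_g hv ht
        refine (l2Norm_sub_toFun_le hab hc.continuous (H v)).trans (ENNReal.ofReal_le_ofReal ?_)
        refine (distSq_le_two_mul hab hc.continuous (H v) (G v)).trans ?_
        have := (hGp v hv).distSq_le hab hC hc
        linarith
    _ = ENNReal.ofReal (∫ v, (2 * (1 + projConst C) ^ 2 * meshSize a b N ^ (2 * (k + 1))
          * sqInt a b (iteratedDeriv (k + 1) fun x => g x v t)
          + 2 * ip a b (H v - G v) (H v - G v)) ∂m.measure) :=
        (ofReal_integral_eq_lintegral_ofReal hF (Filter.Eventually.of_forall hpos)).symm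
    _ ≤ _ := by
        refine ENNReal.ofReal_le_ofReal ?_
        rw [integral_add (i0.const_mul _) (iG.const_mul _), integral_const_mul,
          integral_const_mul]
        exact add_le_add (mul_le_mul_of_nonneg_left h0 (by positivity)) le_rfl

/-- The initial error of `g`. -/
lemma SolutionOn.energyG_projection_le (hs : SolutionOn m ε a b T k ρ g B S) (hab : a < b)
    (hT : 0 < T) (hC : AreInverseConstants k C C') (ht : t ∈ Set.Icc 0 T) {fl' : Flux}
    {G H : ℝ → PiecewisePoly N} (hG : L2DG m k G) (hH : L2DG m k H)
    (hGp : ∀ v ∈ S, IsProjection fl a b k (fun x => g x v t) (G v))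
    (hHp : ∀ᵐ v ∂m.measure, IsProjection fl' a b k (fun x => g x v t) (H v)) :
    energyG m a b (fun v => H v - G v)
      ≤ 4 * (1 + projConst C) ^ 2 * meshSize a b N ^ (2 * (k + 1)) * B := by
  obtain ⟨i0, h0⟩ := hs.bound_g.integral_space hab hs.ae_mem hT hs.field_g le_rfl ht
  have hh := (meshSize_pos (N := N) hab).le
  have h1 : energyG m a b (fun v => H v - G v)
      ≤ ∫ v, 4 * (1 + projConst C) ^ 2 * meshSize a b N ^ (2 * (k + 1))
        * sqInt a b (iteratedDeriv (k + 1) fun x => g x v t) ∂m.measure := by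
    refine integral_mono_ae ((hH.sub hG).integrable_ip (hH.sub hG)) (i0.const_mul _) ?_
    filter_upwards [hs.ae_mem, hHp] with v hv hHv
    have hc := hs.contDiff_g hv ht
    have n1 := nrm_sub_le hab hc.continuous (H v) (G v)
    have d1 := Real.sqrt_le_sqrt (hHv.distSq_le hab hC hc)
    have d2 := Real.sqrt_le_sqrt ((hGp v hv).distSq_le hab hC hc)
    have hn := pow_le_pow_left₀ (nrm_nonneg _) (n1.trans (add_le_add d1 d2)) 2
    rw [nrm_sq hab, ← two_mul, mul_pow, Real.sq_sqrt] at hn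
    · linarith
    · have := sqInt_nonneg hab (iteratedDeriv (k + 1) fun x => g x v t)
      positivity
  refine h1.trans ?_
  rw [integral_const_mul]
  exact mul_le_mul_of_nonneg_left h0 (by positivity)

end

/-! ### The error estimate -/

/-- The order of the squared error. -/
noncomputable def orderSq (k : ℕ) (fl : Flux) (h ε τ σ : ℝ) : ℝ :=
  ε ^ 2 * h ^ (2 * (k + 1)) + fl.rate k h ^ 2 + τ ^ 2
    + 1 / (1 - σ) * ((1 + ε ^ 4) * τ ^ 2 + fl.rate k h ^ 2 + ε * h ^ (2 * k + 1))

/-- The constant of the residual of the scheme for `ρ`. -/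
noncomputable def macroConst (C r τ B : ℝ) : ℝ := √B * τ + 2 * errConst C * r * √B

/-- The constant of the error of `ρ` after the first time step. -/
noncomputable def firstStepConst (k : ℕ) (C C' : ℝ) : ℝ :=
  4 * (1 + projConst C) + 2 * formConst k C C' * (1 + projConst C) + (1 + 2 * errConst C)

/-- The constant of the error estimate. -/
noncomputable def errorConst (k : ℕ) (C C' T B : ℝ) : ℝ :=
  2 * (Real.exp (4 * T) * (2 * firstStepConst k C C' ^ 2 * B + 4 * (1 + projConst C) ^ 2 * B
    + 2 * T * (2 * (B * (2 + 8 * errConst C ^ 2)) + 10 * B * (1 + errConst C ^ 2))))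
    + 4 * (1 + projConst C) ^ 2 * B + 1

section
variable {m : Model} {a b T ε : ℝ} {N : ℕ} [NeZero N] {k : ℕ} {C C' B : ℝ} {S : Set ℝ}
  {ρ : ℝ → ℝ → ℝ} {g : ℝ → ℝ → ℝ → ℝ} {fl : Flux} {τ σ : ℝ}
  {ρh : ℕ → PiecewisePoly N} {gh : ℕ → ℝ → PiecewisePoly N}

lemma macroConst_sq_le (hB : 0 ≤ B) (C r τ : ℝ) :
    macroConst C r τ B ^ 2 ≤ B * (2 + 8 * errConst C ^ 2) * (τ ^ 2 + r ^ 2) := by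
  have e : macroConst C r τ B ^ 2 = B * (τ + 2 * errConst C * r) ^ 2 := by
    rw [macroConst, show √B * τ + 2 * errConst C * r * √B = √B * (τ + 2 * errConst C * r) by ring,
      mul_pow, Real.sq_sqrt hB]
  rw [e, mul_assoc B]
  refine mul_le_mul_of_nonneg_left ?_ hB
  nlinarith [sq_nonneg (τ - 2 * errConst C * r), sq_nonneg τ, sq_nonneg r,
    mul_nonneg (sq_nonneg (errConst C)) (sq_nonneg τ)]

/-- A comparison monomial by monomial. Here `τ < 1/2` turns `3 τ / (1 - σ)` into `(3/2) / (1 - σ)`.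
-/
lemma residual_le_orderSq (hB : 0 ≤ B) (C : ℝ) {h : ℝ} (hh : 0 ≤ h) (hε : 0 < ε) (hτ0 : 0 < τ)
    (hτ1 : τ < 1 / 2) (hσ : σ < 1) :
    macroConst C (fl.rate k h) τ B ^ 2 + 3 * τ * macroConst C (fl.rate k h) τ B ^ 2 / (1 - σ)
        + 2 * microConst k (errConst C) h (fl.rate k h) ε τ (1 - σ) B
      ≤ (2 * (B * (2 + 8 * errConst C ^ 2)) + 10 * B * (1 + errConst C ^ 2))
        * orderSq k fl h ε τ σ := by
  have hR := macroConst_sq_le hB C (fl.rate k h) τ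
  set R := macroConst C (fl.rate k h) τ B
  set c := B * (2 + 8 * errConst C ^ 2)
  set K := errConst C
  set r := fl.rate k h
  have hc : 0 ≤ c := by positivity
  have hd : 0 < 1 / (1 - σ) := one_div_pos.2 (sub_pos.2 hσ)
  have e1 : 3 * τ * R ^ 2 / (1 - σ) ≤ 3 / 2 * (1 / (1 - σ) * (c * (τ ^ 2 + r ^ 2))) := by
    have : 3 * τ * R ^ 2 ≤ 3 / 2 * (c * (τ ^ 2 + r ^ 2)) := by
      refine (mul_le_mul (by linarith : 3 * τ ≤ 3 / 2) hR (sq_nonneg _) (by norm_num))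
    rw [div_eq_mul_one_div]
    nlinarith [mul_le_mul_of_nonneg_right this hd.le]
  have e2 : 2 * microConst k K h r ε τ (1 - σ) B
      = K ^ 2 * B * (ε ^ 2 * h ^ (2 * (k + 1)))
        + 5 * B * (1 / (1 - σ) * (ε ^ 4 * τ ^ 2)) + 10 * B * K ^ 2 * (1 / (1 - σ) * r ^ 2)
        + 10 * B * (1 / (1 - σ) * τ ^ 2)
        + 2 * (B * K ^ 2) * (1 / (1 - σ) * (ε * h ^ (2 * k + 1))) := by
    have : (1 - σ) ≠ 0 := (sub_pos.2 hσ).ne'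
    rw [microConst]
    field_simp
    ring
  have a1 : 0 ≤ ε ^ 2 * h ^ (2 * (k + 1)) := by positivity
  have a2 : 0 ≤ 1 / (1 - σ) * (ε ^ 4 * τ ^ 2) := by positivity
  have a3 : 0 ≤ 1 / (1 - σ) * r ^ 2 := by positivity
  have a4 : 0 ≤ 1 / (1 - σ) * τ ^ 2 := by positivity
  have a5 : 0 ≤ 1 / (1 - σ) * (ε * h ^ (2 * k + 1)) := by positivity
  have a6 : 0 ≤ r ^ 2 := sq_nonneg r
  have a7 : 0 ≤ τ ^ 2 := sq_nonneg τ
  have hW : orderSq k fl h ε τ σ = ε ^ 2 * h ^ (2 * (k + 1)) + r ^ 2 + τ ^ 2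
      + 1 / (1 - σ) * τ ^ 2 + 1 / (1 - σ) * (ε ^ 4 * τ ^ 2) + 1 / (1 - σ) * r ^ 2
      + 1 / (1 - σ) * (ε * h ^ (2 * k + 1)) := by
    rw [orderSq]; ring
  rw [e2, hW]
  generalize ε ^ 2 * h ^ (2 * (k + 1)) = A1 at *
  generalize 1 / (1 - σ) * (ε ^ 4 * τ ^ 2) = A2 at *
  generalize 1 / (1 - σ) * (ε * h ^ (2 * k + 1)) = A5 at *
  have e1' : 3 * τ * R ^ 2 / (1 - σ)
      ≤ 3 / 2 * c * (1 / (1 - σ) * τ ^ 2) + 3 / 2 * c * (1 / (1 - σ) * r ^ 2) := by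
    refine e1.trans_eq ?_
    ring
  generalize 1 / (1 - σ) * τ ^ 2 = A4 at *
  generalize 1 / (1 - σ) * r ^ 2 = A3 at *
  have hD : 0 ≤ B * K ^ 2 := by positivity
  have p1 := mul_nonneg hc a1
  have p2 := mul_nonneg hc a2
  have p3 := mul_nonneg hc a3
  have p4 := mul_nonneg hc a4
  have p5 := mul_nonneg hc a5
  have p6 := mul_nonneg hc a6
  have p7 := mul_nonneg hc a7
  have q1 := mul_nonneg hB a1
  have q2 := mul_nonneg hB a2
  have q3 := mul_nonneg hB a3
  have q4 := mul_nonneg hB a4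
  have q5 := mul_nonneg hB a5
  have q6 := mul_nonneg hB a6
  have q7 := mul_nonneg hB a7
  have s1 := mul_nonneg hD a1
  have s2 := mul_nonneg hD a2
  have s3 := mul_nonneg hD a3
  have s4 := mul_nonneg hD a4
  have s5 := mul_nonneg hD a5
  have s6 := mul_nonneg hD a6
  have s7 := mul_nonneg hD a7
  linarith

/-- The energy at index zero contains `ξ^1`. Initially both errors are differences of two
projections of the same function; the contribution of `ζ^0`, of order `h^(k+1)`, meets `τ / h` and
becomes `τ h^k`. -/
lemma SolutionOn.first_step_le (hs : SolutionOn m ε a b T k ρ g B S) (hab : a < b)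
    (hT : 0 < T) (hC : AreInverseConstants k C C') (hτ0 : 0 < τ) (hτ1 : τ < 1 / 2) (hτT : τ ≤ T)
    (h : IsDGIMEX1 m fl ε a b τ k (fun x => ρ x 0) (fun x v => g x v 0) ρh gh)
    {G : ℝ → PiecewisePoly N} (hG : L2DG m k G)
    (hGp : ∀ v ∈ S, IsProjection fl.swap a b k (fun x => g x v 0) (G v)) {P P' : PiecewisePoly N}
    (hP : IsProjection fl a b k (fun x => ρ x 0) P)
    (hP' : IsProjection fl a b k (fun x => ρ x τ) P') :
    ip a b (ρh 1 - P') (ρh 1 - P')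
        + ε ^ 2 * energyG m a b (fun v => gh 0 v - G v)
      ≤ 2 * firstStepConst k C C' ^ 2 * B * (τ ^ 2 + fl.rate k (meshSize a b N) ^ 2)
        + ε ^ 2 * (4 * (1 + projConst C) ^ 2 * meshSize a b N ^ (2 * (k + 1)) * B) := by
  have hB : 0 ≤ B := hs.bound_rho.nonneg
  have h0 : (0 : ℝ) ∈ Set.Icc 0 T := ⟨le_rfl, hT.le⟩
  have hh := meshSize_pos (N := N) hab
  have hGe := hs.energyG_projection_le hab hT hC h0 hG (h.l2DG 0) hGp
    (h.init_g.mono fun v hv => hv.isProjection)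
  refine add_le_add ?_ (mul_le_mul_of_nonneg_left hGe (sq_nonneg ε))
  have hζ : L2DG m k fun v => gh 0 v - G v := (h.l2DG 0).sub hG
  set A := avg m k (fun v => v) fun v => gh 0 v - G v with hA
  have hA1 := hs.abs_macro_error_le hab hT hC hτ0 h (n := 0) le_rfl (sub_zero τ) hτT hG hGp hP hP'
    ((h.inDG_rho 1).sub hP'.inDG)
  set r := fl.rate k (meshSize a b N) with hr
  have hr0 : 0 ≤ r := fl.rate_nonneg k hh.le
  have hK := errConst_nonneg hC
  have hp := one_le_projConst C
  have hf : 0 ≤ formConst k C C' := by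
    have := hC.one_le
    unfold formConst; positivity
  have step := nrm_le_of_step hab hC hτ0.le (by positivity) ((h.inDG_rho 1).sub hP'.inDG)
    (avg_inDG _ _ _ _) hA1
  rw [← hA] at step
  have n0 : nrm a b (ρh 0 - P) ≤ 4 * (1 + projConst C) * r * √B := by
    refine (nrm_sub_le hab (hs.contDiff_rho h0).continuous (ρh 0) P).trans ?_
    have hX : ∀ x, x ≤ 2 * (1 + projConst C) ^ 2 * r ^ 2 * B →
        √x ≤ 2 * (1 + projConst C) * r * √B := fun x hx => by
      refine sqrt_le_mul_sqrt (by positivity) (hx.trans ?_)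
      have : 0 ≤ (1 + projConst C) ^ 2 * r ^ 2 * B := by positivity
      linarith
    have d1 := hX _ (h.init_rho.isProjection.distSq_rho_le (fl := fl) hs hab hT hC h0 (Or.inr rfl))
    have d2 := hX _ (hP.distSq_rho_le (fl := fl) hs hab hT hC h0 (Or.inl rfl))
    linarith
  have nA : nrm a b A ≤ 2 * (1 + projConst C) * meshSize a b N ^ (k + 1) * √B := by
    rw [nrm]
    refine sqrt_le_mul_sqrt (by positivity) ((ip_avg_self_le hab hζ).trans ?_)
    refine (mul_le_of_le_one_left (energyG_nonneg hab _) m.integral_sq_le_one).trans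
      (hGe.trans_eq ?_)
    ring
  have tA : τ * (formConst k C C' / meshSize a b N * nrm a b A)
      ≤ 2 * formConst k C C' * (1 + projConst C) * √B * (τ + r) := by
    have e1 : τ * (formConst k C C' / meshSize a b N * nrm a b A)
        ≤ τ * (formConst k C C' / meshSize a b N
          * (2 * (1 + projConst C) * meshSize a b N ^ (k + 1) * √B)) := by gcongr
    refine e1.trans ?_
    have e2 : τ * (formConst k C C' / meshSize a b N
          * (2 * (1 + projConst C) * meshSize a b N ^ (k + 1) * √B))
        = 2 * formConst k C C' * (1 + projConst C) * √B * (τ * meshSize a b N ^ k) := by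
      field_simp
      ring
    rw [e2]
    exact mul_le_mul_of_nonneg_left (fl.mul_pow_le_rate k hh.le hτ0.le (by linarith))
      (by positivity)
  have tR : τ * (√B * τ + 2 * errConst C * r * √B) ≤ (1 + 2 * errConst C) * √B * (τ + r) := by
    have : √B * τ + 2 * errConst C * r * √B ≤ (1 + 2 * errConst C) * √B * (τ + r) := by
      have q1 : 0 ≤ √B * r := by positivity
      have q2 : 0 ≤ errConst C * √B * τ := by positivity
      linarith
    exact (mul_le_of_le_one_left (by positivity) (by linarith)).trans this
  have n0' : 4 * (1 + projConst C) * r * √B ≤ 4 * (1 + projConst C) * √B * (τ + r) := by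
    have : 0 ≤ 4 * (1 + projConst C) * √B * τ := by positivity
    linarith
  have n1 : nrm a b (ρh 1 - P') ≤ firstStepConst k C C' * √B * (τ + r) := by
    refine (step.trans (add_le_add (add_le_add (n0.trans n0') tA) tR)).trans_eq ?_
    rw [firstStepConst]
    ring
  rw [← nrm_sq hab]
  refine (pow_le_pow_left₀ (nrm_nonneg _) n1 2).trans ?_
  rw [mul_pow, mul_pow, Real.sq_sqrt hB]
  have : 0 ≤ firstStepConst k C C' ^ 2 * B := by positivity
  nlinarith [mul_nonneg this (sq_nonneg (τ - r))]

/-- Two pairs of inverse constants occur: `C`, `C'` belong to the time step restriction and serve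
for stability only, while `C₀`, `C₀'` determine the projection estimates and hence the final
constant. -/
lemma SolutionOn.energy_le (hs : SolutionOn m ε a b T k ρ g B S) (hab : a < b)
    (hT : 0 < T) (hε : 0 < ε) {C₀ C₀' : ℝ} (hC₀ : AreInverseConstants k C₀ C₀')
    (hC : AreInverseConstants k C C') (hτ0 : 0 < τ) (hτ1 : τ < 1 / 2) (hσ0 : 0 < σ) (hσ1 : σ < 1)
    (hτ : τ ≤ σ * dtStab m k C C' ε (meshSize a b N))
    (h : IsDGIMEX1 m fl ε a b τ k (fun x => ρ x 0) (fun x v => g x v 0) ρh gh)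
    {G : ℝ → ℝ → PiecewisePoly N} (hG : ∀ t ∈ Set.Icc 0 T, L2DG m k (G t) ∧
      ∀ v ∈ S, IsProjection fl.swap a b k (fun x => g x v t) (G t v)) {P : ℝ → PiecewisePoly N}
    (hP : ∀ t ∈ Set.Icc 0 T, IsProjection fl a b k (fun x => ρ x t) (P t)) (n : ℕ)
    (hn : ((n + 1 : ℕ) : ℝ) * τ ≤ T) :
    ip a b (ρh (n + 1) - P ((n + 1 : ℕ) * τ)) (ρh (n + 1) - P ((n + 1 : ℕ) * τ))
        + ε ^ 2 * energyG m a b (fun v => gh n v - G (n * τ) v)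
      ≤ Real.exp (4 * T) * (2 * firstStepConst k C₀ C₀' ^ 2 * B + 4 * (1 + projConst C₀) ^ 2 * B
        + 2 * T * (2 * (B * (2 + 8 * errConst C₀ ^ 2)) + 10 * B * (1 + errConst C₀ ^ 2)))
        * orderSq k fl (meshSize a b N) ε τ σ := by
  have hB : 0 ≤ B := hs.bound_rho.nonneg
  have hh := meshSize_pos (N := N) hab
  have hr0 : 0 ≤ fl.rate k (meshSize a b N) := fl.rate_nonneg k hh.le
  have hK := errConst_nonneg hC₀
  have hδ : 0 < 1 - σ := sub_pos.2 hσ1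
  have hmem : ∀ j : ℕ, j ≤ n + 1 → (j : ℝ) * τ ∈ Set.Icc 0 T := fun j hj =>
    ⟨by positivity, (mul_le_mul_of_nonneg_right (by exact_mod_cast hj) hτ0.le).trans hn⟩
  have h0 : (0 : ℝ) ∈ Set.Icc 0 T := ⟨le_rfl, hT.le⟩
  have havg := h.avg_eq_zero hab hC₀ hε hτ0 (hs.avg_projection_eq_zero hab hC₀ h0 (h.l2DG 0)
    (h.init_g.mono fun v hv => hv.isProjection))
  have hR : 0 ≤ macroConst C₀ (fl.rate k (meshSize a b N)) τ B := by
    unfold macroConst; positivity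
  have hS : 0 ≤ microConst k (errConst C₀) (meshSize a b N) (fl.rate k (meshSize a b N)) ε τ
      (1 - σ) B := by
    unfold microConst; positivity
  let E : ℕ → ℝ := fun j =>
    ip a b (ρh (j + 1) - P ((j + 1 : ℕ) * τ)) (ρh (j + 1) - P ((j + 1 : ℕ) * τ))
      + ε ^ 2 * energyG m a b (fun v => gh j v - G (j * τ) v)
  have hE0 : 0 ≤ E 0 :=
    add_nonneg (ip_self_nonneg hab _) (mul_nonneg (sq_nonneg ε) (energyG_nonneg hab _))
  have hstep : ∀ j < n, E (j + 1) ≤ (1 + 4 * τ) * E j + 2 * τ *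
      (macroConst C₀ (fl.rate k (meshSize a b N)) τ B ^ 2
        + 3 * τ * macroConst C₀ (fl.rate k (meshSize a b N)) τ B ^ 2 / (1 - σ)
        + 2 * microConst k (errConst C₀) (meshSize a b N) (fl.rate k (meshSize a b N)) ε τ
          (1 - σ) B) := by
    intro j hj
    have m0 := hmem j (by omega)
    have m1 := hmem (j + 1) (by omega)
    have m2 := hmem (j + 1 + 1) (by omega)
    have e1 : ((j + 1 : ℕ) : ℝ) * τ - j * τ = τ := by push_cast; ring
    have e2 : ((j + 1 + 1 : ℕ) : ℝ) * τ - (j + 1 : ℕ) * τ = τ := by push_cast; ring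
    -- The step takes `g` from `j` to `j + 1` and `ρ` from `j + 1` to `j + 2`; the value of `ρ` at
    -- `j + 1` drives `g`, and the new `g` then drives `ρ`.
    refine energy_step hab hC fl hε hτ0 hτ1 hσ0 hσ1 hτ hR hS
      ((h.inDG_rho _).sub (hP _ m1).inDG) ((h.inDG_rho _).sub (hP _ m2).inDG)
      ((h.l2DG _).sub (hG _ m0).1) ((h.l2DG _).sub (hG _ m1).1) (fun φ hφ => ?_) ?_
    · exact hs.abs_macro_error_le hab hT hC₀ hτ0 h m1.1 e2 m2.2 (hG _ m1).1 (hG _ m1).2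
        (hP _ m1) (hP _ m2) hφ
    · exact hs.micro_error_le hab hT hε hC₀ hσ1 hτ0 h havg m0.1 e1 m1.2 (fl.rate_swap k _)
        (hG _ m0).1 (hG _ m1).1 (hG _ m0).2 (hG _ m1).2 (hP _ m1)
  have hQ := residual_le_orderSq (k := k) (fl := fl) hB C₀ hh.le hε hτ0 hτ1 hσ1
  have hgr := discrete_gronwall hτ0.le (by positivity) hE0 hstep
  have hτT : τ ≤ T := by simpa using (hmem 1 (by omega)).2
  have g0 := hG 0 h0
  have p0 := hP 0 h0
  have p1 := hP τ ⟨hτ0.le, hτT⟩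
  have hE0' : E 0 ≤ 2 * firstStepConst k C₀ C₀' ^ 2 * B
        * (τ ^ 2 + fl.rate k (meshSize a b N) ^ 2)
        + ε ^ 2 * (4 * (1 + projConst C₀) ^ 2 * meshSize a b N ^ (2 * (k + 1)) * B) := by
    have := hs.first_step_le hab hT hC₀ hτ0 hτ1 hτT h g0.1 g0.2 p0 p1
    simpa [E] using this
  have hW1 : 0 ≤ 1 / (1 - σ) * ((1 + ε ^ 4) * τ ^ 2 + fl.rate k (meshSize a b N) ^ 2
      + ε * meshSize a b N ^ (2 * k + 1)) := by positivity
  have hW2 : 0 ≤ ε ^ 2 * meshSize a b N ^ (2 * (k + 1)) := by positivity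
  set W := orderSq k fl (meshSize a b N) ε τ σ with hWdef
  have hW0 : 0 ≤ W := by rw [hWdef, orderSq]; positivity
  have w1 : τ ^ 2 + fl.rate k (meshSize a b N) ^ 2 ≤ W := by rw [hWdef, orderSq]; linarith
  have w2 : ε ^ 2 * meshSize a b N ^ (2 * (k + 1)) ≤ W := by
    rw [hWdef, orderSq]
    linarith [sq_nonneg τ, sq_nonneg (fl.rate k (meshSize a b N))]
  have hE0'' : E 0 ≤ (2 * firstStepConst k C₀ C₀' ^ 2 * B + 4 * (1 + projConst C₀) ^ 2 * B) * W := by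
    have v1 := mul_le_mul_of_nonneg_left w1
      (by positivity : 0 ≤ 2 * firstStepConst k C₀ C₀' ^ 2 * B)
    have v2 := mul_le_mul_of_nonneg_left w2 (by positivity : 0 ≤ 4 * (1 + projConst C₀) ^ 2 * B)
    linarith
  have hnT : (n : ℝ) * τ ≤ T := (hmem n (by omega)).2
  have hn0 : 0 ≤ (n : ℝ) * τ := by positivity
  refine hgr.trans ?_
  rw [mul_assoc (Real.exp (4 * T))]
  refine mul_le_mul (Real.exp_le_exp.2 (by linarith)) ?_ (by positivity) (Real.exp_pos _).le
  rw [add_mul, mul_assoc (2 * T)]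
  refine add_le_add hE0'' ?_
  exact mul_le_mul (by linarith) hQ (by positivity) (by positivity)

lemma SolutionOn.errorSq_le (hs : SolutionOn m ε a b T k ρ g B S) (hab : a < b)
    (hT : 0 < T) (hε : 0 < ε) {C₀ C₀' : ℝ} (hC₀ : AreInverseConstants k C₀ C₀')
    (hC : AreInverseConstants k C C') (hτ0 : 0 < τ) (hτ1 : τ < 1 / 2) (hσ0 : 0 < σ) (hσ1 : σ < 1)
    (hτ : τ ≤ σ * dtStab m k C C' ε (meshSize a b N))
    (h : IsDGIMEX1 m fl ε a b τ k (fun x => ρ x 0) (fun x v => g x v 0) ρh gh) {n : ℕ}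
    (hn : 1 ≤ n) (hnT : n * τ ≤ T) :
    errorSq m ε a b τ ρ g ρh gh n
      ≤ ENNReal.ofReal (errorConst k C₀ C₀' T B * orderSq k fl (meshSize a b N) ε τ σ) := by
  obtain ⟨n, rfl⟩ := Nat.exists_eq_succ_of_ne_zero (Nat.one_le_iff_ne_zero.1 hn)
  simp only [Nat.succ_eq_add_one] at hnT ⊢
  have hB : 0 ≤ B := hs.bound_rho.nonneg
  have hh := meshSize_pos (N := N) hab
  obtain ⟨G, hG⟩ := hs.exists_dgProjection (N := N) hab hC₀ fl.swap
  choose Pr hPr using fun i : Fin N => exists_projection hC₀ (node_lt_succ (N := N) hab i) fl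
  let P : ℝ → PiecewisePoly N := fun t i =>
    Pr i (dof fl k (node a b N i) (node a b N (i + 1)) fun x => ρ x t)
  have hP : ∀ t ∈ Set.Icc 0 T, IsProjection fl a b k (fun x => ρ x t) (P t) := fun t ht i =>
    hPr i _ (hs.contDiff_rho ht).continuous.continuousOn
  have hE := hs.energy_le hab hT hε hC₀ hC hτ0 hτ1 hσ0 hσ1 hτ h hG hP n hnT
  have hm1 : ((n + 1 : ℕ) : ℝ) * τ ∈ Set.Icc 0 T := ⟨by positivity, hnT⟩
  have hm0 : (n : ℝ) * τ ∈ Set.Icc 0 T :=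
    ⟨by positivity, (mul_le_mul_of_nonneg_right (by simp) hτ0.le).trans hnT⟩
  have hcρ := (hs.contDiff_rho hm1).continuous
  have h1 := (l2Norm_sub_toFun_le hab hcρ (ρh (n + 1))).trans
    (ENNReal.ofReal_le_ofReal (distSq_le_two_mul hab hcρ (ρh (n + 1)) (P ((n + 1 : ℕ) * τ))))
  have h2 := hs.tripleNormSq_sub_le hab hT hC₀ hm0 (hG _ hm0).1 (h.l2DG n) (hG _ hm0).2
  have h3 := (hP _ hm1).distSq_rho_le (fl := fl) hs hab hT hC₀ hm1 (Or.inl rfl)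
  have hd0 : 0 ≤ distSq a b (P ((n + 1 : ℕ) * τ)) fun x => ρ x ((n + 1 : ℕ) * τ) :=
    Finset.sum_nonneg fun i _ =>
      intervalIntegral.integral_nonneg (node_lt_succ hab i).le fun x _ => sq_nonneg _
  have hi0 := ip_self_nonneg hab (ρh (n + 1) - P ((n + 1 : ℕ) * τ))
  have hg0 := energyG_nonneg (m := m) hab fun v => gh n v - G (n * τ) v
  rw [errorSq, Nat.add_sub_cancel]
  refine (add_le_add h1 (mul_le_mul_right h2 _)).trans ?_
  rw [← ENNReal.ofReal_mul (sq_nonneg ε), ← ENNReal.ofReal_add (by positivity) (by positivity)]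
  refine ENNReal.ofReal_le_ofReal ?_
  have hδ : 0 < 1 - σ := sub_pos.2 hσ1
  have hW1 : 0 ≤ 1 / (1 - σ) * ((1 + ε ^ 4) * τ ^ 2 + fl.rate k (meshSize a b N) ^ 2
      + ε * meshSize a b N ^ (2 * k + 1)) := by positivity
  set W := orderSq k fl (meshSize a b N) ε τ σ with hWdef
  have w : ε ^ 2 * meshSize a b N ^ (2 * (k + 1)) + fl.rate k (meshSize a b N) ^ 2 ≤ W := by
    rw [hWdef, orderSq]; linarith [sq_nonneg τ]
  have hW0 : 0 ≤ W := le_trans (by positivity) w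
  have v := mul_le_mul_of_nonneg_left w (by positivity : 0 ≤ 4 * (1 + projConst C₀) ^ 2 * B)
  have v' : 0 ≤ 2 * (1 + projConst C₀) ^ 2 * B * (ε ^ 2 * meshSize a b N ^ (2 * (k + 1))) := by
    positivity
  rw [errorConst]
  linarith

end
end DGIMEX

theorem mainTheorem2 (m : Model) (k : ℕ) (T : ℝ) (hT : 0 < T) (M : ℝ≥0) :
    ∃ Cs : ℝ, 0 < Cs ∧
      ∀ (a b : ℝ), a < b → ∀ (N : ℕ) [NeZero N] (ε Δt σ Cinv Cinv' : ℝ),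
        0 < ε → 0 < Δt → 0 < σ → σ < 1 → AreInverseConstants k Cinv Cinv' →
        Δt ≤ σ * dtStab m k Cinv Cinv' ε (meshSize a b N) → Δt < 1 / 2 →
        ∀ (ρ : ℝ → ℝ → ℝ) (g : ℝ → ℝ → ℝ → ℝ),
          IsSmoothSolution m ε a b T (k + 2) ρ g → SolutionBound m a b T k ρ g M →
          (∀ fl : Flux, fl.IsAlternating →
            ∀ (ρh : ℕ → PiecewisePoly N) (gh : ℕ → ℝ → PiecewisePoly N),
              IsDGIMEX1 m fl ε a b Δt k (fun x => ρ x 0) (fun x v => g x v 0) ρh gh →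
              ∀ n : ℕ, 1 ≤ n → n * Δt ≤ T →
                errorSq m ε a b Δt ρ g ρh gh n ≤ ENNReal.ofReal
                  (Cs * ((1 + ε ^ 2) * meshSize a b N ^ (2 * k + 2) + Δt ^ 2
                    + 1 / (1 - σ) * ((1 + ε ^ 4) * Δt ^ 2 + meshSize a b N ^ (2 * k + 2)
                      + ε * meshSize a b N ^ (2 * k + 1))))) ∧
          (∀ (ρh : ℕ → PiecewisePoly N) (gh : ℕ → ℝ → PiecewisePoly N),
              IsDGIMEX1 m .central ε a b Δt k (fun x => ρ x 0) (fun x v => g x v 0) ρh gh →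
              ∀ n : ℕ, 1 ≤ n → n * Δt ≤ T →
                errorSq m ε a b Δt ρ g ρh gh n ≤ ENNReal.ofReal
                  (Cs * (ε ^ 2 * meshSize a b N ^ (2 * k + 2) + meshSize a b N ^ (2 * k) + Δt ^ 2
                    + 1 / (1 - σ) * ((1 + ε ^ 4) * Δt ^ 2 + meshSize a b N ^ (2 * k)
                      + ε * meshSize a b N ^ (2 * k + 1))))) := by
  -- The constant must not depend on the inverse constants in the time step bound, so one pair is
  -- fixed beforehand. If no pair existed, the claim would be vacuous; existence thus need not be
  -- proved.
  by_cases hex : ∃ C C', AreInverseConstants k C C'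
  · obtain ⟨C₀, C₀', hC₀⟩ := hex
    refine ⟨errorConst k C₀ C₀' T (M ^ 2 + M), by unfold errorConst; positivity, ?_⟩
    intro a b hab N _ ε τ σ C C' hε hτ0 hσ0 hσ1 hC hτ hτ1 ρ g hsol hM
    obtain ⟨S, hs⟩ := hsol.exists_solutionOn hε hM
    refine ⟨fun fl hfl ρh gh h n hn hnT => ?_, fun ρh gh h n hn hnT => ?_⟩
    · refine (hs.errorSq_le hab hT hε hC₀ hC hτ0 hτ1 hσ0 hσ1 hτ h hn hnT).trans_eq ?_
      -- The squared rate joins `ε² h^(2k+2)` and produces the factor `1 + ε²`.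
      have hr : fl.rate k (meshSize a b N) = meshSize a b N ^ (k + 1) := by
        rcases hfl with rfl | rfl <;> rfl
      rw [orderSq, hr]
      ring_nf
    · refine (hs.errorSq_le hab hT hε hC₀ hC hτ0 hτ1 hσ0 hσ1 hτ h hn hnT).trans_eq ?_
      rw [orderSq, Flux.rate]
      ring_nf
  · refine ⟨1, one_pos, ?_⟩
    intro a b _ N _ ε τ σ C C' _ _ _ _ hC
    exact absurd ⟨C, C', hC⟩ hex
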